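/- Let $M$ be a compact complex manifold and $\omega$ a real-analytic Kähler form on $M$ (a closed, positive, real-analytic $(1,1)$-form), with Riemannian distance function $d$. Let $\mathcal H_\omega$ be the set of $u\in C^\infty(M)$ (real valued) with $\omega+i\partial\bar\partial u>0$. If $u$ is a real-analytic local potential of $\omega$ ($i\partial\bar\partial u=\omega$) and $u_{\mathbb C}(z,w)$ is its polarization (holomorphic in $z$, antiholomorphic in $w$, with $u_{\mathbb C}(z,z)=u(z)$), the Calabi diastasis of $\omega$ is locally the function $D_\omega(z,w)=u(z)+u(w)-2\operatorname{Re}u_{\mathbb C}(z,w)$. Call an open neighbourhood $V$ of the diagonal in $M\times M$ admissible if $D_\omega$ is defined on $V$ — that is, $D_\omega$ is a function on $V$ and every point of $V$ lies in some $W\times W$, with $W\subset M$ open and connected, such that on $(W\times W)\cap V$ it is given by the formula above for a real-analytic potential $u$ of $\omega$ on $W$ having a polarization on $W\times W$ — and if there is a constant $C>0$ with $D_\omega(p,q)\ge C\,d(p,q)^2$ for all $(p,q)\in V$. For $V$ admissible and $\psi:M\to\mathbb R\cup\{\infty\}$ put $$L_\omega(\psi)(q)=\operatorname{usc}\ \sup_{p\in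 M,\ (p,q)\in V}\bigl[-D_\omega(p,q)-\psi(p)\bigr],$$ where $\operatorname{usc}$ denotes the upper semicontinuous regularization in $q$. Then admissible neighbourhoods exist, and for every admissible $V$ (and $D_\omega$ on $V$) there is a set $\mathcal U_\omega\subset\mathcal H_\omega$ containing $0$, open in the $C^2$-topology on $C^\infty(M)$, such that: * for every $\eta\in\mathcal U_\omega$, $L_\omega(\eta)$ is a (finite) smooth function that lies in $\mathcal U_\omega$; * for every $\eta\in\mathcal U_\omega$ and every $q\in M$, the supremum $\sup_{p\in M,\ (p,q)\in V}[-D_\omega(p,q)-\eta(p)]$ is attained at exactly one point $p=:G(\eta)(q)$; * $L_\omega:\mathcal U_\omega\to\mathcal U_\omega$ is Fréchet differentiable at every $\eta\in\mathcal U_\omega$, and its differential is the continuous linear map $C^\infty(M)\to C^\infty(M)$ given by $$dL_\omega(\eta)\cdot\chi=-\chi\circ G(\eta),\qquad \chi\in C^\infty(M).$$ Here $C^\infty(M)$ carries its usual Fréchet space topology, and Fréchet differentiability of $L$ at $\eta$ with differential $A$ is that of topological vector spaces: $R(\chi)=L(\eta+\chi)-L(\eta)-A\chi$ is $o(\chi)$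 as $\chi\to0$, i.e. for every continuous seminorm $p$ there is a continuous seminorm $s$ such that for each $\varepsilon>0$ one has $p(R(\chi))\le\varepsilon\,s(\chi)$ for all $\chi$ close enough to $0$. -/

import Mathlib

open Set Filter Topology
open scoped Manifold ContDiff ENNReal

namespace ComplexLegendre

noncomputable section

/-! ### Spaces of smooth functions and their topologies -/

section SmoothFunctions

variable (E : Type*) [NormedAddCommGroup E] [NormedSpace ℝ E]
  (M : Type*) [TopologicalSpace M] [ChartedSpace E M]

/-- `C^∞(M)`: the vector space of real valued smooth functions on `M`. -/
abbrev SmoothFun : Type _ := C^∞⟮𝓘(ℝ, E), M; 𝓘(ℝ, ℝ), ℝ⟯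

/-- The `C^k`-topology on `C^∞(M)`: uniform convergence, on the compact subsets of the charts, of
all partial derivatives of order at most `k` (of all orders, if `k = ∞`). -/
@[reducible] def ckTopology (k : ℕ∞) : TopologicalSpace (SmoothFun E M) :=
  ⨅ (x : M) (j : ℕ) (_ : (j : ℕ∞) ≤ k),
    TopologicalSpace.induced
      (fun f : SmoothFun E M =>
        UniformOnFun.ofFun {K : Set E | IsCompact K ∧ K ⊆ (chartAt E x).target}
          (iteratedFDeriv ℝ j (f ∘ (chartAt E x).symm)))
      inferInstance

/-- `C^∞(M)` carries its usual (Fréchet space) topology, the `C^∞`-topology. -/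
instance smoothFunTopology : TopologicalSpace (SmoothFun E M) := ckTopology E M ⊤

end SmoothFunctions

variable {E : Type*} [NormedAddCommGroup E] [NormedSpace ℂ E]
  {M : Type*} [TopologicalSpace M] [ChartedSpace E M]

/-! ### Forms on a complex manifold -/

/-- The complex structure on the (real) tangent space of a complex manifold. -/
def J (x : M) : TangentSpace 𝓘(ℝ, E) x → TangentSpace 𝓘(ℝ, E) x :=
  fun v : E => (Complex.I • v : E)

variable (E M) in
/-- Real 2-forms on `M` (without regularity). -/
abbrev TwoForm : Type _ := ∀ x : M, TangentSpace 𝓘(ℝ, E) x [⋀^Fin 2]→L[ℝ] ℝ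

/-- The pull-back of a 2-form on `M` to the target of the chart at `x`, by the inverse chart. -/
def formInChart (Ω : TwoForm E M) (x : M) (y : E) : E [⋀^Fin 2]→L[ℝ] ℝ :=
  (Ω ((chartAt E x).symm y)).compContinuousLinearMap
    (mfderiv 𝓘(ℝ, E) 𝓘(ℝ, E) (chartAt E x).symm y)

/-- `Ω` is a real analytic Kähler form: a real analytic, closed, positive (1,1)-form. -/
structure IsAnalyticKahlerForm (Ω : TwoForm E M) : Prop where
  analytic : ∀ x : M, AnalyticOnNhd ℝ (formInChart Ω x) (chartAt E x).target
  closed : ∀ x : M, ∀ y ∈ (chartAt E x).target, extDeriv (formInChart Ω x) y = 0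
  type_one_one : ∀ (x : M) (v w : TangentSpace 𝓘(ℝ, E) x), Ω x ![J x v, J x w] = Ω x ![v, w]
  pos : ∀ (x : M) (v : TangentSpace 𝓘(ℝ, E) x), v ≠ 0 → 0 < Ω x ![v, J x v]

/-- The value at `x` of the real (1,1)-form `i∂∂̄u`, in the holomorphic chart at `x` (whose
differential at `x` is the identity of the tangent space). In terms of the real second derivative,
`i∂∂̄u (v, w) = (D²u (Jv, w) - D²u (v, Jw)) / 2`; so `i∂∂̄|z|² = i dz ∧ dz̄ = 2 dx ∧ dy`. -/
def ddbar (u : M → ℝ) (x : M) (v w : TangentSpace 𝓘(ℝ, E) x) : ℝ :=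
  let H : E →L[ℝ] E →L[ℝ] ℝ := fderiv ℝ (fderiv ℝ (u ∘ (chartAt E x).symm)) (chartAt E x x)
  (H (J x v) w - H v (J x w)) / 2

/-- The space of smooth functions `u` with `Ω + i∂∂̄u > 0`. -/
def kahlerPotentials (Ω : TwoForm E M) : Set (SmoothFun E M) :=
  {u | ∀ (x : M) (v : TangentSpace 𝓘(ℝ, E) x), v ≠ 0 →
    0 < Ω x ![v, J x v] + ddbar (u : M → ℝ) x v (J x v)}

/-- The distance function of the Riemannian metric of a Kähler form `Ω`, for which the square of
the length of a tangent vector `v` is `Ω (v, Jv)`. It is infinite between points in different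
components of `M`. -/
def kahlerEDist (Ω : TwoForm E M) (p q : M) : ℝ≥0∞ :=
  letI : ∀ x : M, ENorm (TangentSpace 𝓘(ℝ, E) x) :=
    fun x => ⟨fun v => ENNReal.ofReal (Real.sqrt (Ω x ![v, J x v]))⟩
  Manifold.riemannianEDist 𝓘(ℝ, E) p q

/-! ### The diastasis -/

/-- `u` is a real analytic potential of `Ω` on the open set `W`: `Ω = i∂∂̄u` on `W`. -/
structure IsPotentialOn (Ω : TwoForm E M) (u : M → ℝ) (W : Set M) : Prop where
  analytic : ContMDiffOn 𝓘(ℝ, E) 𝓘(ℝ, ℝ) ω u W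
  eq_ddbar : ∀ x ∈ W, ∀ v w : TangentSpace 𝓘(ℝ, E) x, Ω x ![v, w] = ddbar u x v w

variable (E) in
/-- `P` is a polarization of `u` on `W × W`: a (jointly real analytic) function that is holomorphic
in the first variable, antiholomorphic in the second, and equal to `u` on the diagonal. -/
structure IsPolarizationOn (u : M → ℝ) (P : M → M → ℂ) (W : Set M) : Prop where
  analytic : ContMDiffOn (𝓘(ℝ, E).prod 𝓘(ℝ, E)) 𝓘(ℝ, ℂ) ω (fun z : M × M => P z.1 z.2) (W ×ˢ W)
  holomorphic_left : ∀ w ∈ W, MDifferentiableOn 𝓘(ℂ, E) 𝓘(ℂ, ℂ) (fun z => P z w) W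
  antiholomorphic_right :
    ∀ z ∈ W, MDifferentiableOn 𝓘(ℂ, E) 𝓘(ℂ, ℂ) (fun w => starRingEnd ℂ (P z w)) W
  diagonal : ∀ z ∈ W, P z z = (u z : ℂ)

/-- On `V`, the function `D` is the Calabi diastasis of `Ω`: any point of `V` lies in a product
`W × W` such that `D (z, w) = u z + u w - 2 Re u_ℂ (z, w)` there, with `u` a real analytic potential
of `Ω` on `W` and `u_ℂ` its polarization. -/
def IsDiastasisOn (Ω : TwoForm E M) (V : Set (M × M)) (D : M → M → ℝ) : Prop :=
  ∀ p q : M, (p, q) ∈ V → ∃ (W : Set M) (u : M → ℝ) (P : M → M → ℂ),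
    IsOpen W ∧ IsPreconnected W ∧ p ∈ W ∧ q ∈ W ∧
    IsPotentialOn Ω u W ∧ IsPolarizationOn E u P W ∧
    ∀ z ∈ W, ∀ w ∈ W, (z, w) ∈ V → D z w = u z + u w - 2 * (P z w).re

/-- The neighbourhoods `V` of the diagonal over which the Legendre transform is taken: the diastasis
`D` of `Ω` is defined on `V`, and `D (p, q) ≥ C d (p, q)²` there, with a constant `C > 0` and the
distance function `d` of `Ω`. -/
structure IsLegendreDomain (Ω : TwoForm E M) (V : Set (M × M)) (D : M → M → ℝ) : Prop where
  isOpen : IsOpen V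
  diagonal_subset : ∀ p : M, (p, p) ∈ V
  isDiastasisOn : IsDiastasisOn Ω V D
  lower_bound : ∃ C : ℝ, 0 < C ∧ ∀ p q : M, (p, q) ∈ V →
    ENNReal.ofReal C * kahlerEDist Ω p q ^ 2 ≤ ENNReal.ofReal (D p q)

/-! ### The Legendre transform -/

/-- The upper semicontinuous regularization of a function. -/
def uscReg {X : Type*} [TopologicalSpace X] (f : X → EReal) (x : X) : EReal :=
  limsup f (𝓝 x)

/-- The complex Legendre transform of a function `ψ` on `M`. -/
def legendre {X : Type*} [TopologicalSpace X] (V : Set (X × X)) (D : X → X → ℝ) (ψ : X → EReal) :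
    X → EReal :=
  uscReg fun q => ⨆ (p : X) (_ : (p, q) ∈ V), (-(D p q : EReal) - ψ p)

/-- The supremum that defines the Legendre transform of `η` at `q` is attained at `z`. -/
def IsAttainedAt {X : Type*} (V : Set (X × X)) (D : X → X → ℝ) (η : X → ℝ) (q z : X) : Prop :=
  (z, q) ∈ V ∧ ∀ p : X, (p, q) ∈ V → -D p q - η p ≤ -D z q - η z

end

end ComplexLegendre

/-! Existence of admissible neighbourhoods is a local construction followed by gluing. In a chart,
the coefficients of the closed real-analytic (1,1)-form are polarized into functions holomorphic in
`z` and antiholomorphic in `w`, by inserting a complex variable into their power series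
(`exists_polarization`). A function of this type that vanishes on the diagonal is zero
(`IsSesquiAt.eq_zero_of_diagonal`), so closedness persists off the diagonal, and two integrations,
first in `w`, then in `z`, give a polarization `P` whose restriction to the diagonal is a potential.
The same principle shows that the diastasis does not depend on the potential (`localDiastasis_eq`),
so that local diastases glue. On the diagonal its Hessian in `z` agrees with the metric on pairs
`(v, v)`, and its mixed Hessian with minus the metric; a Taylor expansion then gives the quadratic
lower bound.

For the transform, `L η q` is minus the minimum over `p` of `D p q + η p`. If `|η| < ε`, then `D ≥ C
d²` forces every competitor at least as good as `p = q` to lie near `q`, inside one chart ball. If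
moreover the second derivatives of `η` are small in finitely many charts, the function to be
minimized is strictly convex there: the minimizer `G η q` exists, is unique and is a nondegenerate
critical point. Implicit differentiation controls the jets of `G` with a loss of one derivative, but
the derivative of the value is just `-∂D/∂q` at the critical point (the envelope formula), so `L η`
has as many controlled derivatives as `η`. Hence `L` is continuous in the `C²`-topology. It is an
involution: combining the critical equations for `L η` and `η` with the symmetry of `D` gives
`∂₁D(q, p) = ∂₁D(q, p')`, where `q` is the minimizer for `L η` at `p` and `p'` the one for `η` at
`q`, and the definite mixed Hessian forces `p = p'`. So the set of small `η` with small `L η` is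
`C²`-open and mapped into itself.

For differentiability, expand `s ↦ L (η + s χ)` by Taylor with integral remainder. The first
derivative is `-χ ∘ G`, and the second variation in a direction `ζ` is the inverse Hessian paired
with `dζ` at the minimizer. The remainder `R χ ζ`, with separate base perturbation and direction, is
quadratic in `ζ` and continuous at the origin into `C^∞`, which already implies that `R χ χ` is
`o(χ)` (`hasFDerivAt_of_quadratic_remainder`).

Continuity in function-space topologies is handled throughout by families with jointly continuous
jets (`JetContAt`); the parameter is often the function itself, ranging over the space of smooth
functions. -/

namespace ComplexLegendre

noncomputable section

/-! ### Families of functions with jointly continuous jets -/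

section JetCont

variable {X X' : Type*} [TopologicalSpace X] [TopologicalSpace X']
  {E F G : Type*} [NormedAddCommGroup E] [NormedSpace ℝ E] [NormedAddCommGroup F] [NormedSpace ℝ F]
  [NormedAddCommGroup G] [NormedSpace ℝ G]

/-- Near `(a, y)`, the functions `T b` are of class `C^k`, and their derivatives of order at most
`k` are jointly continuous in the parameter and the variable. -/
def JetContAt (k : ℕ) (T : X → E → F) (a : X) (y : E) : Prop :=
  ∀ᶠ p : X × E in 𝓝 (a, y), ContDiffAt ℝ k (T p.1) p.2 ∧
    ∀ j ≤ k, ContinuousAt (fun p : X × E => iteratedFDeriv ℝ j (T p.1) p.2) p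

theorem eventually_slice {Y : Type*} [TopologicalSpace Y] {P : X × Y → Prop} {p : X × Y}
    (h : ∀ᶠ q in 𝓝 p, P q) :
    ∀ᶠ y in 𝓝 p.2, P (p.1, y) :=
  (Continuous.prodMk_right p.1).tendsto' p.2 p rfl |>.eventually h

namespace JetContAt

variable {k : ℕ} {T S : X → E → F} {a : X} {y : E}

theorem eventually (h : JetContAt k T a y) : ∀ᶠ p : X × E in 𝓝 (a, y), JetContAt k T p.1 p.2 :=
  eventually_eventually_nhds.2 h

theorem contDiffAt (h : JetContAt k T a y) : ContDiffAt ℝ k (T a) y := h.self_of_nhds.1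

theorem continuousAt_iteratedFDeriv (h : JetContAt k T a y) {j : ℕ} (hj : j ≤ k) :
    ContinuousAt (fun p : X × E => iteratedFDeriv ℝ j (T p.1) p.2) (a, y) :=
  h.self_of_nhds.2 j hj

theorem of_le (h : JetContAt k T a y) {l : ℕ} (hl : l ≤ k) : JetContAt l T a y :=
  h.mono fun _ hp => ⟨hp.1.of_le (by exact_mod_cast hl), fun j hj => hp.2 j (hj.trans hl)⟩

theorem congr (h : JetContAt k T a y) (hTS : ∀ᶠ p : X × E in 𝓝 (a, y), T p.1 p.2 = S p.1 p.2) :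
    JetContAt k S a y := by
  have h1 : ∀ᶠ p : X × E in 𝓝 (a, y), T p.1 =ᶠ[𝓝 p.2] S p.1 := by
    filter_upwards [eventually_eventually_nhds.2 hTS] with p hp
    exact eventually_slice hp
  filter_upwards [h, eventually_eventually_nhds.2 h1] with p hp hq
  refine ⟨hp.1.congr_of_eventuallyEq (Filter.EventuallyEq.symm hq.self_of_nhds), fun j hj => ?_⟩
  refine (hp.2 j hj).congr ?_
  filter_upwards [hq] with q hq
  exact (hq.iteratedFDeriv ℝ j).self_of_nhds

theorem continuousAt (h : JetContAt k T a y) :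
    ContinuousAt (fun p : X × E => T p.1 p.2) (a, y) := by
  have := h.continuousAt_iteratedFDeriv (Nat.zero_le k)
  simp only [iteratedFDeriv_zero_eq_comp] at this
  exact ((continuousMultilinearCurryFin0 ℝ E F).continuous.continuousAt.comp this).congr
    (Eventually.of_forall fun p => by simp)

theorem _root_.ComplexLegendre.jetContAt_zero :
    JetContAt 0 T a y ↔ ∀ᶠ p : X × E in 𝓝 (a, y), ContinuousAt (fun p : X × E => T p.1 p.2) p := by
  refine ⟨fun h => h.eventually.mono fun p hp => hp.continuousAt, fun h => ?_⟩
  filter_upwards [eventually_eventually_nhds.2 h] with p hp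
  constructor
  · rw [Nat.cast_zero, contDiffAt_zero]
    have := eventually_slice hp
    obtain ⟨u, hu, hu'⟩ := this.exists_mem
    refine ⟨u, hu, fun z hz => ?_⟩
    have h1 := hu' z hz
    exact (h1.comp (f := fun z => (p.1, z)) (by fun_prop)).continuousWithinAt
  · intro j hj
    obtain rfl : j = 0 := by omega
    simp only [iteratedFDeriv_zero_eq_comp]
    exact (continuousMultilinearCurryFin0 ℝ E F).symm.continuous.continuousAt.comp hp.self_of_nhds

/-- Lowers the order by one, so that a formula for the first derivative can be bootstrapped: jets of
order `k` of the right-hand side give jets of order `k + 1` of the function. -/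
theorem _root_.ComplexLegendre.jetContAt_succ :
    JetContAt (k + 1) T a y ↔
      (∀ᶠ p : X × E in 𝓝 (a, y), ContinuousAt (fun p : X × E => T p.1 p.2) p) ∧
      (∀ᶠ p : X × E in 𝓝 (a, y), DifferentiableAt ℝ (T p.1) p.2) ∧
      JetContAt k (fun b => fderiv ℝ (T b)) a y := by
  constructor
  · intro h
    refine ⟨h.eventually.mono fun p hp => hp.continuousAt,
      h.mono fun p hp => hp.1.differentiableAt (by simp), ?_⟩
    refine h.mono fun p hp => ⟨hp.1.fderiv_right (by simp), fun j hj => ?_⟩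
    have := hp.2 (j + 1) (by omega)
    simp only [iteratedFDeriv_succ_eq_comp_right] at this
    exact ((continuousMultilinearCurryRightEquiv' ℝ j E F).continuous.continuousAt.comp this).congr
      (Eventually.of_forall fun p => by simp)
  · rintro ⟨h0, h1, h2⟩
    filter_upwards [h0, eventually_eventually_nhds.2 h1, h2] with p hp0 hp1 hp2
    constructor
    · rw [Nat.cast_add, Nat.cast_one, contDiffAt_succ_iff_hasFDerivAt]
      obtain ⟨u, hu, hu'⟩ := (eventually_slice hp1).exists_mem
      exact ⟨fderiv ℝ (T p.1), ⟨u, hu, fun z hz => (hu' z hz).hasFDerivAt⟩, hp2.1⟩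
    · intro j hj
      rcases j with _ | j
      · simp only [iteratedFDeriv_zero_eq_comp]
        exact (continuousMultilinearCurryFin0 ℝ E F).symm.continuous.continuousAt.comp hp0
      · simp only [iteratedFDeriv_succ_eq_comp_right]
        exact (continuousMultilinearCurryRightEquiv' ℝ j E F).symm.continuous.continuousAt.comp
          (hp2.2 j (by omega))

theorem fderiv (h : JetContAt (k + 1) T a y) : JetContAt k (fun b => fderiv ℝ (T b)) a y :=
  (jetContAt_succ.1 h).2.2

theorem of_contDiffAt {f : E → F} (hf : ContDiffAt ℝ k f y) (a : X) :
    JetContAt k (fun _ => f) a y := by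
  have h1 : ∀ᶠ z in 𝓝 y, ContDiffAt ℝ k f z := hf.eventually (by simp)
  have h2 : ∀ᶠ p : X × E in 𝓝 (a, y), ContDiffAt ℝ k f p.2 := continuousAt_snd.eventually h1
  refine h2.mono fun p hp => ⟨hp, fun j hj => ?_⟩
  have := (hp.iteratedFDeriv_right (m := 0) (i := j) (by exact_mod_cast (by simpa using hj))).continuousAt
  exact this.comp continuousAt_snd

/-- The parameter space carries only a topology, so a family may be indexed by a function space.
Continuity of `g` is needed near `b` and not just at `b`, because the definition speaks of all
nearby points. -/
theorem comp_param (h : JetContAt k T a y) {g : X' → X} {b : X'}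
    (hb : g b = a) (hg : ∀ᶠ b' in 𝓝 b, ContinuousAt g b') :
    JetContAt k (fun b => T (g b)) b y := by
  have hg0 : ContinuousAt (fun p : X' × E => (g p.1, p.2)) (b, y) :=
    (hg.self_of_nhds.comp continuousAt_fst).prodMk continuousAt_snd
  have h1 : ∀ᶠ p : X' × E in 𝓝 (b, y), ContinuousAt g p.1 := continuousAt_fst.eventually hg
  subst hb
  filter_upwards [hg0.eventually h, h1] with p hp hgp
  exact ⟨hp.1, fun j hj => ContinuousAt.comp (f := fun p : X' × E => (g p.1, p.2)) (hp.2 j hj)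
    ((hgp.comp continuousAt_fst).prodMk continuousAt_snd)⟩

/-- By Faà di Bruno, a jet of the composite is a finite sum of continuous multilinear expressions in
the jets of `S b` at `T b z` and of `T b` at `z`. -/
theorem comp {S : X → F → G} (hS : JetContAt k S a (T a y)) (hT : JetContAt k T a y) :
    JetContAt k (fun b z => S b (T b z)) a y := by
  have hc : ContinuousAt (fun p : X × E => (p.1, T p.1 p.2)) (a, y) :=
    continuousAt_fst.prodMk hT.continuousAt
  filter_upwards [hT.eventually, (hc.eventually hS.eventually), eventually_eventually_nhds.2 hT,
    eventually_eventually_nhds.2 (hc.eventually hS)] with p h1 h2 h3 h4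
  refine ⟨h2.contDiffAt.comp p.2 h1.contDiffAt, fun j hj => ?_⟩
  have hev : (fun q : X × E => iteratedFDeriv ℝ j (fun z => S q.1 (T q.1 z)) q.2) =ᶠ[𝓝 p]
      fun q => (ftaylorSeries ℝ (S q.1) (T q.1 q.2)).taylorComp (ftaylorSeries ℝ (T q.1) q.2) j := by
    filter_upwards [h3, h4] with q hq3 hq4
    exact iteratedFDeriv_comp (hq4.1) hq3.1 (by exact_mod_cast hj)
  refine ContinuousAt.congr ?_ hev.symm
  unfold FormalMultilinearSeries.taylorComp
  refine tendsto_finsetSum _ fun c _ => ?_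
  have hB := (c.compAlongOrderedFinpartitionL ℝ E F G).analyticOnNhd_uncurry_of_multilinear
    (s := univ)
  have hcp : ContinuousAt (fun p : X × E => (p.1, T p.1 p.2)) p :=
    continuousAt_fst.prodMk h1.continuousAt
  have hc1 : ContinuousAt (fun q : X × E => iteratedFDeriv ℝ c.length (S q.1) (T q.1 q.2)) p :=
    ContinuousAt.comp (f := fun p : X × E => (p.1, T p.1 p.2))
      (h2.continuousAt_iteratedFDeriv (c.length_le.trans hj)) hcp
  have hc2 : ContinuousAt (fun q : X × E =>
      (fun i : Fin c.length => iteratedFDeriv ℝ (c.partSize i) (T q.1) q.2)) p :=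
    continuousAt_pi.2 fun i => h1.continuousAt_iteratedFDeriv ((c.partSize_le i).trans hj)
  exact ContinuousAt.comp (f := fun q : X × E => (iteratedFDeriv ℝ c.length (S q.1) (T q.1 q.2),
    (fun i : Fin c.length => iteratedFDeriv ℝ (c.partSize i) (T q.1) q.2)))
    (hB _ (mem_univ _)).continuousAt (hc1.prodMk hc2)

theorem clm_comp (L : F →L[ℝ] G) (hT : JetContAt k T a y) :
    JetContAt k (fun b z => L (T b z)) a y :=
  comp (of_contDiffAt L.contDiff.contDiffAt a) hT

theorem contDiff_comp {f : F → G} (hT : JetContAt k T a y) (hf : ContDiffAt ℝ k f (T a y)) :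
    JetContAt k (fun b z => f (T b z)) a y :=
  comp (of_contDiffAt hf a) hT

theorem prodMk {S : X → E → G} (hT : JetContAt k T a y) (hS : JetContAt k S a y) :
    JetContAt k (fun b z => (T b z, S b z)) a y := by
  filter_upwards [hT.eventually, hS.eventually, eventually_eventually_nhds.2 hT,
    eventually_eventually_nhds.2 hS] with p h1 h2 h3 h4
  refine ⟨h1.contDiffAt.prodMk h2.contDiffAt, fun j hj => ?_⟩
  have hev : (fun q : X × E => iteratedFDeriv ℝ j (fun z => (T q.1 z, S q.1 z)) q.2) =ᶠ[𝓝 p]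
      fun q => (iteratedFDeriv ℝ j (T q.1) q.2).prod (iteratedFDeriv ℝ j (S q.1) q.2) := by
    filter_upwards [h3, h4] with q hq3 hq4
    exact iteratedFDeriv_prodMk hq3.1 hq4.1 (by exact_mod_cast hj)
  refine ContinuousAt.congr ?_ hev.symm
  exact (ContinuousMultilinearMap.prodL ℝ _ F G).continuous.continuousAt.comp
    ((h1.continuousAt_iteratedFDeriv hj).prodMk (h2.continuousAt_iteratedFDeriv hj))

theorem id : JetContAt k (fun _ z => z) a y := of_contDiffAt contDiffAt_id a

theorem add (hT : JetContAt k T a y) (hS : JetContAt k S a y) :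
    JetContAt k (fun b z => T b z + S b z) a y :=
  (hT.prodMk hS).clm_comp (ContinuousLinearMap.fst ℝ F F + ContinuousLinearMap.snd ℝ F F)

theorem neg (hT : JetContAt k T a y) : JetContAt k (fun b z => - T b z) a y :=
  hT.clm_comp (-ContinuousLinearMap.id ℝ F)

theorem sub (hT : JetContAt k T a y) (hS : JetContAt k S a y) :
    JetContAt k (fun b z => T b z - S b z) a y :=
  (hT.add hS.neg).congr (Eventually.of_forall fun _ => (sub_eq_add_neg _ _).symm)

theorem clm_apply {A : X → E → F →L[ℝ] G} (hA : JetContAt k A a y) (hT : JetContAt k T a y) :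
    JetContAt k (fun b z => A b z (T b z)) a y :=
  contDiff_comp (f := fun p : (F →L[ℝ] G) × F => p.1 p.2) (hA.prodMk hT)
    (isBoundedBilinearMap_apply.contDiff.contDiffAt)

theorem const_param (g : X → F) (hg : ∀ᶠ b in 𝓝 a, ContinuousAt g b) :
    JetContAt k (fun b _ => g b) a y := by
  -- The tautological family, with parameter space `F`; the general case is its pull-back along `g`.
  have : JetContAt (X := F) (E := E) k (fun c _ => c) (g a) y := by
    refine Eventually.of_forall fun p => ⟨contDiffAt_const, fun j _ => ?_⟩
    rcases j with _ | j
    · simp only [iteratedFDeriv_zero_eq_comp]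
      exact (continuousMultilinearCurryFin0 ℝ E F).symm.continuous.continuousAt.comp
        continuousAt_fst
    · simp only [iteratedFDeriv_succ_const]
      exact continuousAt_const
  exact this.comp_param rfl hg

theorem smul {c : X → E → ℝ} (hc : JetContAt k c a y) (hT : JetContAt k T a y) :
    JetContAt k (fun b z => c b z • T b z) a y :=
  contDiff_comp (f := fun p : ℝ × F => p.1 • p.2) (hc.prodMk hT)
    (contDiff_smul.contDiffAt)

end JetContAt

end JetCont

/-! ### Integrals over `[0, 1]` of families with continuous jets. -/

section Integral

variable {X Z : Type*} [TopologicalSpace X] [TopologicalSpace Z]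
  {E F : Type*} [NormedAddCommGroup E] [NormedSpace ℝ E] [NormedAddCommGroup F] [NormedSpace ℝ F]

/-- Compactness of `[0, 1]` makes the continuity in `z` uniform in `t`. -/
theorem continuousAt_intervalIntegral {f : ℝ → Z → F} {z₀ : Z}
    (h : ∀ t ∈ Icc (0 : ℝ) 1, ContinuousAt (fun p : ℝ × Z => f p.1 p.2) (t, z₀))
    (h' : ∀ᶠ z in 𝓝 z₀, ContinuousOn (fun t => f t z) (Icc 0 1)) :
    ContinuousAt (fun z => ∫ t in (0 : ℝ)..1, f t z) z₀ := by
  rw [ContinuousAt, Metric.tendsto_nhds]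
  intro ε hε
  have h1 : ∀ᶠ z in 𝓝 z₀, ∀ t ∈ Icc (0 : ℝ) 1, ‖f t z - f t z₀‖ ≤ ε / 2 := by
    refine isCompact_Icc.eventually_forall_of_forall_eventually fun t ht => ?_
    have hc : ContinuousAt (fun p : Z × ℝ => f p.2 p.1 - f p.2 z₀) (z₀, t) := by
      refine ContinuousAt.sub ?_ ?_
      · exact ContinuousAt.comp (f := fun p : Z × ℝ => (p.2, p.1)) (x := (z₀, t))
          (h t ht) (by fun_prop)
      · exact ContinuousAt.comp (f := fun p : Z × ℝ => (p.2, z₀)) (x := (z₀, t))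
          (h t ht) (by fun_prop)
    have := hc.norm.eventually_lt_const (u := ε / 2) (by simpa using half_pos hε)
    exact this.mono fun p hp => le_of_lt hp
  have h0 := h'.self_of_nhds
  filter_upwards [h1, h'] with z hz hz'
  rw [dist_eq_norm, ← intervalIntegral.integral_sub]
  · refine (intervalIntegral.norm_integral_le_of_norm_le_const (C := ε / 2)
      fun t ht => hz t ?_).trans_lt (by norm_num; linarith)
    rw [uIoc_of_le zero_le_one] at ht
    exact ⟨ht.1.le, ht.2⟩
  · exact ContinuousOn.intervalIntegrable (by rwa [uIcc_of_le zero_le_one])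
  · exact ContinuousOn.intervalIntegrable (by rwa [uIcc_of_le zero_le_one])

theorem hasFDerivAt_intervalIntegral {f : ℝ → E → F} {y₀ : E}
    (h : ∀ t ∈ Icc (0 : ℝ) 1, ∀ᶠ p : ℝ × E in 𝓝 (t, y₀), DifferentiableAt ℝ (f p.1) p.2 ∧
      ContinuousAt (fun p : ℝ × E => f p.1 p.2) p ∧
      ContinuousAt (fun p : ℝ × E => fderiv ℝ (f p.1) p.2) p) :
    HasFDerivAt (fun y => ∫ t in (0 : ℝ)..1, f t y)
      (∫ t in (0 : ℝ)..1, fderiv ℝ (f t) y₀) y₀ := by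
  have h1 : ∀ᶠ y in 𝓝 y₀, ∀ t ∈ Icc (0 : ℝ) 1, DifferentiableAt ℝ (f t) y ∧
      ContinuousAt (fun p : ℝ × E => f p.1 p.2) (t, y) ∧
      ContinuousAt (fun p : ℝ × E => fderiv ℝ (f p.1) p.2) (t, y) := by
    refine isCompact_Icc.eventually_forall_of_forall_eventually fun t ht => ?_
    exact (continuous_swap.tendsto' (y₀, t) (t, y₀) rfl).eventually (h t ht)
  have hco : ∀ y, (∀ t ∈ Icc (0 : ℝ) 1, ContinuousAt (fun p : ℝ × E => f p.1 p.2) (t, y)) →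
      ContinuousOn (fun t => f t y) (Icc 0 1) := fun y hy t ht =>
    (ContinuousAt.comp (f := fun t : ℝ => (t, y)) (hy t ht) (by fun_prop)).continuousWithinAt
  have hco' : ContinuousOn (fun t => fderiv ℝ (f t) y₀) (Icc 0 1) := fun t ht =>
    (ContinuousAt.comp (f := fun t : ℝ => (t, y₀)) (h1.self_of_nhds t ht).2.2
      (by fun_prop)).continuousWithinAt
  obtain ⟨C, hC⟩ := isCompact_Icc.exists_bound_of_continuousOn hco'
  have h2 : ∀ᶠ y in 𝓝 y₀, ∀ t ∈ Icc (0 : ℝ) 1, ‖fderiv ℝ (f t) y‖ ≤ C + 1 := by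
    refine isCompact_Icc.eventually_forall_of_forall_eventually fun t ht => ?_
    have := ContinuousAt.comp (f := fun p : E × ℝ => (p.2, p.1)) (x := (y₀, t))
      (h1.self_of_nhds t ht).2.2 (by fun_prop)
    exact (this.norm.eventually_lt_const (u := C + 1) ((hC t ht).trans_lt (lt_add_one C))).mono
      fun p hp => le_of_lt hp
  have hI : uIoc (0 : ℝ) 1 ⊆ Icc 0 1 := by
    rw [uIoc_of_le zero_le_one]; exact Ioc_subset_Icc_self
  refine intervalIntegral.hasFDerivAt_integral_of_dominated_of_fderiv_le
    (bound := fun _ => C + 1) (F' := fun y t => fderiv ℝ (f t) y) (h1.and h2) ?_ ?_ ?_ ?_ ?_ ?_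
  · filter_upwards [h1] with y hy
    exact ((hco y fun t ht => (hy t ht).2.1).mono hI).aestronglyMeasurable measurableSet_uIoc
  · refine ContinuousOn.intervalIntegrable ?_
    rw [uIcc_of_le zero_le_one]
    exact hco y₀ fun t ht => (h1.self_of_nhds t ht).2.1
  · exact (hco'.mono hI).aestronglyMeasurable measurableSet_uIoc
  · exact Eventually.of_forall fun t ht y hy => hy.2 t (hI ht)
  · exact intervalIntegrable_const
  · exact Eventually.of_forall fun t ht y hy => (hy.1 t (hI ht)).1.hasFDerivAt

variable [CompleteSpace F]

/-- The jets of the integral are the integrals of the jets: differentiation under the integral sign,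
by induction on the order. The set `O` of points that are good for all `t` is open because `[0, 1]`
is compact. -/
theorem JetContAt.intervalIntegral {k : ℕ} {T : ℝ → X → E → F} {a : X} {y : E}
    (h : ∀ t ∈ Icc (0 : ℝ) 1, JetContAt k (fun p : ℝ × X => T p.1 p.2) (t, a) y) :
    JetContAt k (fun b z => ∫ t in (0 : ℝ)..1, T t b z) a y := by
  let O : Set (X × E) :=
    {p | ∀ t ∈ Icc (0 : ℝ) 1, JetContAt k (fun p : ℝ × X => T p.1 p.2) (t, p.1) p.2}
  have hO : ∀ p ∈ O, ∀ᶠ q in 𝓝 p, q ∈ O := by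
    intro p hp
    refine isCompact_Icc.eventually_forall_of_forall_eventually fun t ht => ?_
    exact (Continuous.tendsto' (f := fun q : (X × E) × ℝ => ((q.2, q.1.1), q.1.2)) (by fun_prop)
      (p, t) ((t, p.1), p.2) rfl).eventually (hp t ht).eventually
  have hslice : ∀ p ∈ O, ∀ t ∈ Icc (0 : ℝ) 1, ∀ j ≤ k,
      ContinuousAt (fun q : ℝ × X × E => iteratedFDeriv ℝ j (T q.1 q.2.1) q.2.2) (t, p) := by
    intro p hp t ht j hj
    exact ContinuousAt.comp (f := fun q : ℝ × X × E => ((q.1, q.2.1), q.2.2)) (x := (t, p))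
      ((hp t ht).continuousAt_iteratedFDeriv hj) (by fun_prop)
  have hslice' : ∀ p ∈ O, ∀ j ≤ k, ContinuousOn
      (fun t => iteratedFDeriv ℝ j (T t p.1) p.2) (Icc 0 1) := fun p hp j hj t ht =>
    (ContinuousAt.comp (f := fun t : ℝ => (t, p)) (hslice p hp t ht j hj)
      (by fun_prop)).continuousWithinAt
  have hder : ∀ p ∈ O, ∀ j < k,
      HasFDerivAt (fun z => ∫ t in (0 : ℝ)..1, iteratedFDeriv ℝ j (T t p.1) z)
      (∫ t in (0 : ℝ)..1, _root_.fderiv ℝ (iteratedFDeriv ℝ j (T t p.1)) p.2) p.2 := by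
    intro p hp j hj
    refine hasFDerivAt_intervalIntegral fun t ht => ?_
    have h1 : ∀ᶠ q : ℝ × E in 𝓝 (t, p.2),
        JetContAt k (fun p : ℝ × X => T p.1 p.2) (q.1, p.1) q.2 :=
      (Continuous.tendsto' (f := fun q : ℝ × E => ((q.1, p.1), q.2)) (by fun_prop)
        (t, p.2) ((t, p.1), p.2) rfl).eventually (hp t ht).eventually
    filter_upwards [h1] with q hq
    refine ⟨?_, ?_, ?_⟩
    · exact (hq.contDiffAt.iteratedFDeriv_right (m := 1) (i := j)
        (by exact_mod_cast (by omega))).differentiableAt (by simp)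
    · exact ContinuousAt.comp (f := fun q : ℝ × E => ((q.1, p.1), q.2))
        (hq.continuousAt_iteratedFDeriv hj.le) (by fun_prop)
    · have := ContinuousAt.comp (f := fun q : ℝ × E => ((q.1, p.1), q.2))
        (hq.continuousAt_iteratedFDeriv (j := j + 1) hj) (by fun_prop)
      simp only [iteratedFDeriv_succ_eq_comp_left] at this
      refine ((continuousMultilinearCurryLeftEquiv ℝ (fun _ : Fin (j + 1) => E)
        F).continuous.continuousAt.comp this).congr (Eventually.of_forall fun q => by simp)
  have key : ∀ j ≤ k, ∀ p ∈ O, iteratedFDeriv ℝ j (fun z => ∫ t in (0 : ℝ)..1, T t p.1 z) p.2 =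
      ∫ t in (0 : ℝ)..1, iteratedFDeriv ℝ j (T t p.1) p.2 := by
    intro j
    induction j with
    | zero =>
      intro _ p hp
      simp only [iteratedFDeriv_zero_eq_comp, Function.comp]
      exact ((continuousMultilinearCurryFin0 ℝ E F).symm.toContinuousLinearEquiv.toContinuousLinearMap.intervalIntegral_comp_comm
        (ContinuousOn.intervalIntegrable (by
          rw [uIcc_of_le zero_le_one]
          have := hslice' p hp 0 (Nat.zero_le _)
          simp only [iteratedFDeriv_zero_eq_comp] at this
          exact ((continuousMultilinearCurryFin0 ℝ E F).continuous.comp_continuousOn this).congr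
            fun t _ => by simp))).symm
    | succ j ih =>
      intro hj p hp
      have h1 : iteratedFDeriv ℝ j (fun z => ∫ t in (0 : ℝ)..1, T t p.1 z) =ᶠ[𝓝 p.2]
          fun z => ∫ t in (0 : ℝ)..1, iteratedFDeriv ℝ j (T t p.1) z := by
        filter_upwards [eventually_slice (hO p hp)] with z hz
        exact ih (by omega) (p.1, z) hz
      simp only [iteratedFDeriv_succ_eq_comp_left, Function.comp]
      rw [h1.fderiv_eq, (hder p hp j hj).fderiv]
      let Λ : (E →L[ℝ] E [×j]→L[ℝ] F) →L[ℝ] (E [×(j + 1)]→L[ℝ] F) :=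
        (continuousMultilinearCurryLeftEquiv ℝ (fun _ : Fin (j + 1) =>
          E) F).symm.toContinuousLinearEquiv.toContinuousLinearMap
      refine (ContinuousLinearMap.intervalIntegral_comp_comm (𝕜 := ℝ)
        (E := E →L[ℝ] E [×j]→L[ℝ] F) (F := E [×(j + 1)]→L[ℝ] F) (μ := MeasureTheory.volume) Λ
        (ContinuousOn.intervalIntegrable ?_)).symm
      rw [uIcc_of_le zero_le_one]
      have := hslice' p hp (j + 1) hj
      simp only [iteratedFDeriv_succ_eq_comp_left] at this
      exact ((continuousMultilinearCurryLeftEquiv ℝ (fun _ : Fin (j + 1) => E)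
        F).continuous.comp_continuousOn this).congr fun t _ => by simp
  filter_upwards [hO (a, y) h, eventually_eventually_nhds.2 (hO (a, y) h)] with p hp hp'
  constructor
  · let s : Set E := {z | (p.1, z) ∈ O}
    have hs : IsOpen s := isOpen_iff_mem_nhds.2 fun z hz => eventually_slice (hO (p.1, z) hz)
    have hev : ∀ j ≤ k, ∀ z ∈ s, iteratedFDerivWithin ℝ j
        (fun z => ∫ t in (0 : ℝ)..1, T t p.1 z) s z =
        ∫ t in (0 : ℝ)..1, iteratedFDeriv ℝ j (T t p.1) z := fun j hj z hz =>
      (iteratedFDerivWithin_of_isOpen j hs hz).trans (key j hj (p.1, z) hz)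
    have : ContDiffOn ℝ (k : ℕ∞) (fun z => ∫ t in (0 : ℝ)..1, T t p.1 z) s := by
      refine contDiffOn_of_continuousOn_differentiableOn (fun m hm => ?_) (fun m hm => ?_)
      · have hm : m ≤ k := by exact_mod_cast hm
        refine ContinuousOn.congr ?_ (hev m hm)
        intro z hz
        refine (continuousAt_intervalIntegral (fun t ht => ?_) ?_).continuousWithinAt
        · exact ContinuousAt.comp (f := fun q : ℝ × E => (q.1, p.1, q.2)) (x := (t, z))
            (hslice (p.1, z) hz t ht m hm) (by fun_prop)
        · filter_upwards [hs.mem_nhds hz] with w hw using hslice' (p.1, w) hw m hm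
      · have hm : m < k := by exact_mod_cast hm
        refine DifferentiableOn.congr ?_ (hev m hm.le)
        exact fun z hz => (hder (p.1, z) hz m hm).differentiableAt.differentiableWithinAt
    exact this.contDiffAt (hs.mem_nhds hp)
  · intro j hj
    refine (continuousAt_intervalIntegral (f := fun t (p : X × E) =>
      iteratedFDeriv ℝ j (T t p.1) p.2) (fun t ht => hslice p hp t ht j hj) ?_).congr ?_
    · filter_upwards [hp'] with q hq using hslice' q hq j hj
    · filter_upwards [hp'] with q hq using (key j hj q hq).symm

end Integral

/-! ### Fréchet differentiability from a quadratic remainder. -/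

section TVS

variable {V W : Type*} [AddCommGroup V] [Module ℝ V] [TopologicalSpace V] [AddCommGroup W]
  [Module ℝ W] [TopologicalSpace W] [IsTopologicalAddGroup V] [ContinuousConstSMul ℝ V]

open scoped Pointwise NNReal

/-- A remainder that is quadratic and continuous is `o(χ)`. -/
theorem hasFDerivAt_of_quadratic_remainder {L : V → W} {A : V →L[ℝ] W} {η : V} {R : V → V → W}
    (hL : ∀ᶠ χ in 𝓝 (0 : V), L (η + χ) - L η - A χ = R χ χ)
    (hR : ∀ χ ζ : V, ∀ s : ℝ, R χ (s • ζ) = s ^ 2 • R χ ζ)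
    (hc : Tendsto (fun p : V × V => R p.1 p.2) (𝓝 (0, 0)) (𝓝 0)) : HasFDerivAt L A η := by
  refine ⟨⟨fun U hU => ?_⟩⟩
  have h1 := hc.eventually hU
  rw [nhds_prod_eq] at h1
  -- One neighbourhood `N` serves both arguments and does not depend on `ε`, as little-o in a
  -- topological vector space demands; its gauge plays the role of the seminorm of `χ`.
  obtain ⟨N, hN, hN'⟩ := eventually_prod_self_iff (r := fun χ ζ => R χ ζ ∈ U) |>.1 h1
  refine ⟨N, hN, fun ε hε => ?_⟩
  have h2 : Tendsto (fun p : V × V => p.1 - p.2) (𝓝 η ×ˢ pure η) (𝓝 0) := by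
    rw [prod_pure, tendsto_map'_iff]
    exact Continuous.tendsto' (by fun_prop) _ _ (by simp)
  have h3 : ∀ᶠ p : V × V in 𝓝 η ×ˢ pure η, η = p.2 :=
    tendsto_snd.eventually (eventually_pure.2 rfl)
  have hε' : (ε : ℝ) ≠ 0 := by exact_mod_cast hε
  filter_upwards [h2.eventually hL, h2.eventually hN,
    h2.eventually ((set_smul_mem_nhds_zero_iff hε').2 hN), h3] with p hp1 hp2 hp3 hp4
  obtain ⟨x, y⟩ := p
  simp only at hp1 hp2 hp3 hp4
  subst hp4
  set χ := x - η
  have hx : x = η + χ := by simp [χ]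
  simp only
  rw [hx, hp1]
  have hle : egauge ℝ N χ ≤ ε := by
    refine (egauge_le_of_mem_smul hp3).trans (le_of_eq ?_)
    simp
  -- Write `χ = s • ζ` with `ζ ∈ N` and `|s|` close to the gauge of `χ`; then `R χ χ = s² • R χ ζ`
  -- lies in `s² • U`. One of the two gauge factors is at most `ε`, since `ε • N` is also a
  -- neighbourhood of `0`.
  have hsq : egauge ℝ U (R χ χ) ≤ egauge ℝ N χ * egauge ℝ N χ := by
    refine le_of_forall_gt fun b hb => ?_
    have hex : ∃ c, egauge ℝ N χ < c ∧ c * c < b := by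
      have hcont : ContinuousAt (fun c : ℝ≥0∞ => c ^ 2) (egauge ℝ N χ) :=
        (ENNReal.continuous_pow 2).continuousAt
      have hev := Tendsto.eventually_lt_const (u := b) (by simpa [pow_two] using hb) hcont
      have hne : egauge ℝ N χ ≠ ⊤ := (hle.trans_lt ENNReal.coe_lt_top).ne
      have : (𝓝[>] (egauge ℝ N χ)).NeBot := nhdsGT_neBot_of_exists_gt ⟨⊤, hne.lt_top⟩
      obtain ⟨c, hc1, hc2⟩ := ((hev.filter_mono nhdsWithin_le_nhds).and
        (eventually_mem_nhdsWithin (a := egauge ℝ N χ) (s := Ioi (egauge ℝ N χ)))).exists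
      exact ⟨c, hc2, by rwa [← pow_two]⟩
    obtain ⟨c, hc1, hc2⟩ := hex
    obtain ⟨s, hs1, hs2⟩ := egauge_lt_iff.1 hc1
    obtain ⟨ζ, hζ, hζ'⟩ := hs1
    simp only at hζ'
    have h4 : R χ χ ∈ (s ^ 2) • U := by
      have h5 : R χ (s • ζ) ∈ (s ^ 2) • U := by
        rw [hR]
        exact smul_mem_smul_set (hN' χ hp2 ζ hζ)
      rwa [hζ'] at h5
    refine (egauge_le_of_mem_smul h4).trans_lt (lt_of_le_of_lt ?_ hc2)
    rw [pow_two, enorm_mul]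
    gcongr
  exact hsq.trans (by gcongr)

end TVS

/-! ### The `C^k`-topologies and families with continuous jets on a manifold. -/

section SmoothFunctionSpaces

variable {E : Type*} [NormedAddCommGroup E] [NormedSpace ℝ E]
  {M : Type*} [TopologicalSpace M] [ChartedSpace E M]
  {X : Type*} [TopologicalSpace X]

/-- A function on `M`, read in the chart at `x`. -/
def inChart {F : Type*} (x : M) (f : M → F) : E → F := fun y => f ((chartAt E x).symm y)

theorem tendsto_ckTopology_iff {Y : Type*} {k : ℕ∞} {Λ : Y → SmoothFun E M} {l : Filter Y}
    {f : SmoothFun E M} : Tendsto Λ l (@nhds _ (ckTopology E M k) f) ↔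
      ∀ (x : M) (j : ℕ), (j : ℕ∞) ≤ k → ∀ K : Set E, IsCompact K → K ⊆ (chartAt E x).target →
        TendstoUniformlyOn (fun b => iteratedFDeriv ℝ j (inChart x (Λ b)))
          (iteratedFDeriv ℝ j (inChart x f)) l K := by
  simp only [nhds_iInf, tendsto_iInf, nhds_induced, tendsto_comap_iff,
    UniformOnFun.tendsto_iff_tendstoUniformlyOn]
  exact forall₃_congr fun x j _ =>
    ⟨fun h K hK hK' => h K ⟨hK, hK'⟩, fun h K hK => h K hK.1 hK.2⟩

/-- Joint continuity at every point of a compact set is uniform there in the second variable, which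
is what the topology asks for. -/
theorem tendsto_ckTopology {k : ℕ∞} {Λ : X → SmoothFun E M} {a : X}
    (h : ∀ j : ℕ, (j : ℕ∞) ≤ k → ∀ x : M, ∀ y ∈ (chartAt E x).target,
      ContinuousAt (fun p : X × E => iteratedFDeriv ℝ j (inChart x (Λ p.1)) p.2) (a, y)) :
    Tendsto Λ (𝓝 a) (@nhds _ (ckTopology E M k) (Λ a)) := by
  rw [tendsto_ckTopology_iff]
  intro x j hj K hK hKt
  rw [Metric.tendstoUniformlyOn_iff]
  intro ε hε
  refine hK.eventually_forall_of_forall_eventually fun y hy => ?_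
  have h1 := h j hj x y (hKt hy)
  have h2 : ContinuousAt (fun p : X × E => iteratedFDeriv ℝ j (inChart x (Λ a)) p.2) (a, y) :=
    ContinuousAt.comp (f := fun p : X × E => (a, p.2)) (x := (a, y)) h1 (by fun_prop)
  have h3 := h2.dist h1
  exact h3.eventually_lt_const (u := ε) (by simpa using hε)

/-- A family of smooth functions with jointly continuous jets of order at most `k`. -/
def IsJetFamilyAt (k : ℕ) (Λ : X → SmoothFun E M) (a : X) : Prop :=
  ∀ x : M, ∀ y ∈ (chartAt E x).target, JetContAt k (fun b => inChart x (Λ b)) a y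

theorem IsJetFamilyAt.tendsto {k : ℕ∞} {Λ : X → SmoothFun E M} {a : X}
    (h : ∀ j : ℕ, (j : ℕ∞) ≤ k → IsJetFamilyAt j Λ a) :
    Tendsto Λ (𝓝 a) (@nhds _ (ckTopology E M k) (Λ a)) :=
  tendsto_ckTopology fun j hj x y hy => (h j hj x y hy).continuousAt_iteratedFDeriv le_rfl

theorem IsJetFamilyAt.comp_param {X' : Type*} [TopologicalSpace X'] {k : ℕ}
    {Λ : X → SmoothFun E M} {g : X' → X} {b : X'} (h : IsJetFamilyAt k Λ (g b))
    (hg : ∀ᶠ b' in 𝓝 b, ContinuousAt g b') : IsJetFamilyAt k (fun b => Λ (g b)) b :=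
  fun x y hy => (h x y hy).comp_param rfl hg

theorem IsJetFamilyAt.continuousAt {Λ : X → SmoothFun E M} {a : X}
    (h : ∀ j : ℕ, IsJetFamilyAt j Λ a) : ContinuousAt Λ a :=
  IsJetFamilyAt.tendsto fun j _ => h j

theorem IsJetFamilyAt.add {k : ℕ} {Λ Λ' : X → SmoothFun E M} {a : X} (h : IsJetFamilyAt k Λ a)
    (h' : IsJetFamilyAt k Λ' a) : IsJetFamilyAt k (fun b => Λ b + Λ' b) a :=
  fun x y hy => (h x y hy).add (h' x y hy)

theorem IsJetFamilyAt.smul {k : ℕ} {Λ : X → SmoothFun E M} {a : X} (h : IsJetFamilyAt k Λ a)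
    {c : X → ℝ} (hc : ∀ᶠ b in 𝓝 a, ContinuousAt c b) :
    IsJetFamilyAt k (fun b => c b • Λ b) a :=
  fun x y hy => (JetContAt.const_param c hc).smul (h x y hy)

section Manifold

variable [IsManifold 𝓘(ℝ, E) ∞ M]

theorem contDiffAt_inChart {F : Type*} [NormedAddCommGroup F] [NormedSpace ℝ F] {f : M → F}
    (hf : ContMDiff 𝓘(ℝ, E) 𝓘(ℝ, F) ∞ f) (x : M) {y : E} (hy : y ∈ (chartAt E x).target) :
    ContDiffAt ℝ ∞ (inChart x f) y := by
  have h1 : ContMDiffOn 𝓘(ℝ, E) 𝓘(ℝ, E) ∞ (chartAt E x).symm (chartAt E x).target :=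
    contMDiffOn_chart_symm
  exact ((hf.comp_contMDiffOn h1).contMDiffAt ((chartAt E x).open_target.mem_nhds hy)).contDiffAt

theorem contMDiffAt_of_inChart {F : Type*} [NormedAddCommGroup F] [NormedSpace ℝ F] {f : M → F}
    {p x : M} (hp : p ∈ (chartAt E x).source)
    (hf : ContDiffAt ℝ ∞ (inChart x f) (chartAt E x p)) :
    ContMDiffAt 𝓘(ℝ, E) 𝓘(ℝ, F) ∞ f p := by
  have h1 : ContMDiffAt 𝓘(ℝ, E) 𝓘(ℝ, E) ∞ (chartAt E x) p :=
    (contMDiffOn_chart (I := 𝓘(ℝ, E)) (n := ∞)).contMDiffAt ((chartAt E x).open_source.mem_nhds hp)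
  refine (ContMDiffAt.comp p (hf.contMDiffAt) h1).congr_of_eventuallyEq ?_
  filter_upwards [(chartAt E x).open_source.mem_nhds hp] with q hq
  simp [inChart, (chartAt E x).left_inv hq]

theorem contDiffAt_inChart_coe (f : SmoothFun E M) (x : M) {y : E}
    (hy : y ∈ (chartAt E x).target) : ContDiffAt ℝ ∞ (inChart x f) y :=
  contDiffAt_inChart f.contMDiff x hy

variable (E M) in
/-- The space of smooth functions, with the `C^k`-topology. -/
def CkFun (_ : ℕ∞) : Type _ := SmoothFun E M

instance (k : ℕ∞) : TopologicalSpace (CkFun E M k) := ckTopology E M k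

/-- The identity map, from the space of smooth functions with the `C^k`-topology. -/
def CkFun.toSmoothFun {k : ℕ∞} (f : CkFun E M k) : SmoothFun E M := f

variable [FiniteDimensional ℝ E]

/-- The converse passage, for the tautological family: uniform convergence of a jet on a closed ball
(compact, as the dimension is finite) and continuity of the limit jet give joint continuity.
Operations on functions can then be studied by calculus of jets. -/
theorem isJetFamilyAt_of_ckFun {k : ℕ∞} (a : CkFun E M k) {j : ℕ} (hj : (j : ℕ∞) ≤ k) :
    IsJetFamilyAt j (CkFun.toSmoothFun (E := E) (M := M) (k := k)) a := by
  intro x y hy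
  have hmem : ∀ᶠ p : CkFun E M k × E in 𝓝 (a, y), p.2 ∈ (chartAt E x).target :=
    continuousAt_snd.eventually ((chartAt E x).open_target.mem_nhds hy)
  filter_upwards [hmem] with p hp
  have hcd := fun f : CkFun E M k => contDiffAt_inChart_coe f.toSmoothFun x hp
  refine ⟨(hcd p.1).of_le (by exact_mod_cast le_top), fun i hi => ?_⟩
  have hik : (i : ℕ∞) ≤ k := le_trans (by exact_mod_cast hi) hj
  obtain ⟨r, hr, hr'⟩ := Metric.nhds_basis_closedBall.mem_iff.1
    ((chartAt E x).open_target.mem_nhds hp)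
  have hT : Tendsto (CkFun.toSmoothFun (E := E) (M := M) (k := k)) (𝓝 p.1)
    (@nhds _ (ckTopology E M k) p.1) := tendsto_id
  have h2 := tendsto_ckTopology_iff.1 hT x i hik (Metric.closedBall p.2 r)
    (isCompact_closedBall _ _) hr'
  rw [Metric.tendstoUniformlyOn_iff] at h2
  rw [ContinuousAt, Metric.tendsto_nhds]
  intro ε hε
  have h3 : ContinuousAt (iteratedFDeriv ℝ i (inChart x p.1.toSmoothFun)) p.2 :=
    ((hcd p.1).iteratedFDeriv_right (m := 0) (i := i) (by
      exact_mod_cast le_top)).continuousAt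
  have h4 := (h3.comp (f := fun q : CkFun E M k × E => q.2) continuousAt_snd)
  have h5 := (Metric.tendsto_nhds.1 h4) (ε / 2) (half_pos hε)
  have h6 : ∀ᶠ q : CkFun E M k × E in 𝓝 p, ∀ y ∈ Metric.closedBall p.2 r,
      dist (iteratedFDeriv ℝ i (inChart x p.1.toSmoothFun) y)
        (iteratedFDeriv ℝ i (inChart x q.1.toSmoothFun) y) < ε / 2 := by
    have := h2 (ε / 2) (half_pos hε)
    exact (continuousAt_fst (p := p)).eventually this
  have h7 : ∀ᶠ q : CkFun E M k × E in 𝓝 p, q.2 ∈ Metric.closedBall p.2 r :=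
    continuousAt_snd.eventually (Metric.closedBall_mem_nhds _ hr)
  filter_upwards [h5, h6, h7] with q hq5 hq6 hq7
  have := hq6 q.2 hq7
  rw [dist_comm] at this
  calc _ ≤ _ := dist_triangle _ _ _
    _ < ε / 2 + ε / 2 := add_lt_add this hq5
    _ = ε := add_halves ε

theorem isJetFamilyAt_id (a : SmoothFun E M) (j : ℕ) :
    IsJetFamilyAt j (fun f : SmoothFun E M => f) a :=
  isJetFamilyAt_of_ckFun (k := ⊤) a le_top

/-- Continuity of the operations is read off from the tautological families. -/
instance : IsTopologicalAddGroup (SmoothFun E M) where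
  continuous_add := continuous_iff_continuousAt.2 fun a => IsJetFamilyAt.continuousAt fun j =>
    ((isJetFamilyAt_id a.1 j).comp_param (g := Prod.fst) (b := a)
      (Eventually.of_forall fun _ => continuousAt_fst)).add
    ((isJetFamilyAt_id a.2 j).comp_param (g := Prod.snd) (b := a)
      (Eventually.of_forall fun _ => continuousAt_snd))
  continuous_neg := continuous_iff_continuousAt.2 fun a => IsJetFamilyAt.continuousAt fun j =>
    fun x y hy => (isJetFamilyAt_id a j x y hy).neg

instance : ContinuousSMul ℝ (SmoothFun E M) where
  continuous_smul := continuous_iff_continuousAt.2 fun a => IsJetFamilyAt.continuousAt fun j =>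
    ((isJetFamilyAt_id a.2 j).comp_param (g := Prod.snd) (b := a)
      (Eventually.of_forall fun _ => continuousAt_snd)).smul
      (Eventually.of_forall fun _ => continuousAt_fst)

end Manifold

end SmoothFunctionSpaces

/-! ### Rules for second derivatives. -/

section SecondDerivative

variable {E E' F F' : Type*} [NormedAddCommGroup E] [NormedSpace ℝ E] [NormedAddCommGroup E']
  [NormedSpace ℝ E'] [NormedAddCommGroup F] [NormedSpace ℝ F] [NormedAddCommGroup F']
  [NormedSpace ℝ F']

theorem hasFDerivAt_fderiv_apply {h : E → F} {p : E} (hc : ContDiffAt ℝ 2 h p) (W : E) :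
    HasFDerivAt (fun q => fderiv ℝ h q W) ((fderiv ℝ (fderiv ℝ h) p).flip W) p := by
  have hd : DifferentiableAt ℝ (fderiv ℝ h) p :=
    (hc.fderiv_right (m := 1) (by norm_num)).differentiableAt (by simp)
  have := (ContinuousLinearMap.apply ℝ F W).hasFDerivAt.comp p hd.hasFDerivAt
  exact this.congr_fderiv (by ext; simp)

theorem snd_fderiv_symm {h : E → F} {p : E} (hc : ContDiffAt ℝ 2 h p) (V W : E) :
    fderiv ℝ (fderiv ℝ h) p V W = fderiv ℝ (fderiv ℝ h) p W V :=
  (hc.isSymmSndFDerivAt (by simp)).eq V W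

theorem snd_fderiv_comp_clm {h : E' → F} (A : E →L[ℝ] E') (L : F →L[ℝ] F') {p : E}
    (hc : ContDiffAt ℝ 2 h (A p)) (V W : E) :
    fderiv ℝ (fderiv ℝ (fun q => L (h (A q)))) p V W =
      L (fderiv ℝ (fderiv ℝ h) (A p) (A V) (A W)) := by
  have hev : ∀ᶠ q in 𝓝 p, ContDiffAt ℝ 2 h (A q) :=
    A.continuous.continuousAt.eventually (hc.eventually (by simp))
  have h1 : (fun q => fderiv ℝ (fun q => L (h (A q))) q W) =ᶠ[𝓝 p]
      fun q => L (fderiv ℝ h (A q) (A W)) := by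
    filter_upwards [hev] with q hq
    have : HasFDerivAt (fun q => L (h (A q))) (L ∘L (fderiv ℝ h (A q) ∘L A)) q :=
      L.hasFDerivAt.comp q ((hq.differentiableAt (by simp)).hasFDerivAt.comp q A.hasFDerivAt)
    rw [this.fderiv]
    simp
  have hc' : ContDiffAt ℝ 2 (fun q => L (h (A q))) p :=
    L.contDiff.contDiffAt.comp p (hc.comp p A.contDiff.contDiffAt)
  have h2 := h1.fderiv_eq (𝕜 := ℝ)
  rw [(hasFDerivAt_fderiv_apply hc' W).fderiv] at h2
  have h3 : HasFDerivAt (fun q => L (fderiv ℝ h (A q) (A W)))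
      (L ∘L ((fderiv ℝ (fderiv ℝ h) (A p)).flip (A W) ∘L A)) p :=
    L.hasFDerivAt.comp p
      (HasFDerivAt.comp (f := A) p (hasFDerivAt_fderiv_apply hc (A W)) A.hasFDerivAt)
  rw [h3.fderiv] at h2
  have := congrArg (fun T : E →L[ℝ] F' => T V) h2
  simpa using this

theorem snd_fderiv_add {f g : E → F} {p : E} (hf : ContDiffAt ℝ 2 f p) (hg : ContDiffAt ℝ 2 g p) :
    fderiv ℝ (fderiv ℝ (fun q => f q + g q)) p =
      fderiv ℝ (fderiv ℝ f) p + fderiv ℝ (fderiv ℝ g) p := by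
  have h1 : fderiv ℝ (fun q => f q + g q) =ᶠ[𝓝 p] fun q => fderiv ℝ f q + fderiv ℝ g q := by
    filter_upwards [hf.eventually (by simp), hg.eventually (by simp)] with q h1 h2
    exact fderiv_fun_add (h1.differentiableAt (by simp)) (h2.differentiableAt (by simp))
  rw [h1.fderiv_eq]
  exact fderiv_fun_add ((hf.fderiv_right (m := 1) (by norm_num)).differentiableAt (by simp))
    ((hg.fderiv_right (m := 1) (by norm_num)).differentiableAt (by simp))

theorem snd_fderiv_sub {f g : E → F} {p : E} (hf : ContDiffAt ℝ 2 f p) (hg : ContDiffAt ℝ 2 g p) :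
    fderiv ℝ (fderiv ℝ (fun q => f q - g q)) p =
      fderiv ℝ (fderiv ℝ f) p - fderiv ℝ (fderiv ℝ g) p := by
  have h1 : fderiv ℝ (fun q => f q - g q) =ᶠ[𝓝 p] fun q => fderiv ℝ f q - fderiv ℝ g q := by
    filter_upwards [hf.eventually (by simp), hg.eventually (by simp)] with q h1 h2
    exact fderiv_fun_sub (h1.differentiableAt (by simp)) (h2.differentiableAt (by simp))
  rw [h1.fderiv_eq]
  exact fderiv_fun_sub ((hf.fderiv_right (m := 1) (by norm_num)).differentiableAt (by simp))
    ((hg.fderiv_right (m := 1) (by norm_num)).differentiableAt (by simp))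

end SecondDerivative

/-! ### Functions holomorphic in `z` and antiholomorphic in `w`; the local diastasis. -/

section Sesquiholomorphic

variable {E F : Type*} [NormedAddCommGroup E] [NormedSpace ℂ E] [NormedAddCommGroup F]
  [NormedSpace ℂ F]

/-- The function `h` is holomorphic in the first variable and antiholomorphic in the second one, at
the infinitesimal level, at `p`. -/
structure IsSesquiAt (h : E × E → F) (p : E × E) : Prop where
  differentiableAt : DifferentiableAt ℝ h p
  left : ∀ v : E, fderiv ℝ h p (Complex.I • v, 0) = Complex.I • fderiv ℝ h p (v, 0)
  right : ∀ v : E, fderiv ℝ h p (0, Complex.I • v) = -(Complex.I • fderiv ℝ h p (0, v))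

namespace IsSesquiAt

variable {h h' : E × E → F} {p : E × E}

theorem clm_comp {G : Type*} [NormedAddCommGroup G] [NormedSpace ℂ G] (H : IsSesquiAt h p)
    (L : F →L[ℝ] G) (hL : ∀ v, L (Complex.I • v) = Complex.I • L v) :
    IsSesquiAt (fun q => L (h q)) p := by
  have h1 : fderiv ℝ (fun q => L (h q)) p = L ∘L fderiv ℝ h p :=
    (L.hasFDerivAt.comp p H.differentiableAt.hasFDerivAt).fderiv
  refine ⟨L.differentiableAt.comp p H.differentiableAt, fun v => ?_, fun v => ?_⟩
  · rw [h1]; simp [H.left, hL]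
  · rw [h1]; simp [H.right, hL]

theorem add (H : IsSesquiAt h p) (H' : IsSesquiAt h' p) : IsSesquiAt (fun q => h q + h' q) p := by
  have h1 : fderiv ℝ (fun q => h q + h' q) p = fderiv ℝ h p + fderiv ℝ h' p :=
    fderiv_fun_add H.differentiableAt H'.differentiableAt
  refine ⟨H.differentiableAt.fun_add H'.differentiableAt, fun v => ?_, fun v => ?_⟩
  · rw [h1]; simp [H.left, H'.left]
  · rw [h1]; simp [H.right, H'.right]; abel

theorem sub (H : IsSesquiAt h p) (H' : IsSesquiAt h' p) : IsSesquiAt (fun q => h q - h' q) p := by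
  have h1 : fderiv ℝ (fun q => h q - h' q) p = fderiv ℝ h p - fderiv ℝ h' p :=
    fderiv_fun_sub H.differentiableAt H'.differentiableAt
  refine ⟨H.differentiableAt.fun_sub H'.differentiableAt, fun v => ?_, fun v => ?_⟩
  · rw [h1]; simp [H.left, H'.left, smul_sub]
  · rw [h1]; simp [H.right, H'.right, smul_sub]; abel

/-- Exchanging the variables reverses the type, and conjugation reverses it back. -/
theorem conj_swap {h : E × E → ℂ} (H : IsSesquiAt h p.swap) :
    IsSesquiAt (fun q => starRingEnd ℂ (h q.swap)) p := by
  let S : E × E →L[ℝ] E × E :=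
    (ContinuousLinearMap.snd ℝ E E).prod (ContinuousLinearMap.fst ℝ E E)
  have h0 : HasFDerivAt (fun q : E × E => starRingEnd ℂ (h q.swap))
      ((Complex.conjCLE : ℂ →L[ℝ] ℂ) ∘L (fderiv ℝ h p.swap ∘L S)) p :=
    (Complex.conjCLE : ℂ →L[ℝ] ℂ).hasFDerivAt.comp p
      (HasFDerivAt.comp (f := S) p H.differentiableAt.hasFDerivAt S.hasFDerivAt)
  refine ⟨h0.differentiableAt, fun v => ?_, fun v => ?_⟩
  · rw [h0.fderiv]; simp [S, H.right]
  · rw [h0.fderiv]; simp [S, H.left]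

/-- The two Cauchy-Riemann relations hold near `p`; differentiate them in the direction `V` and
exchange the order of differentiation. -/
theorem fderiv_apply (hc : ContDiffAt ℝ 2 h p) (H : ∀ᶠ q in 𝓝 p, IsSesquiAt h q) (V : E × E) :
    IsSesquiAt (fun q => fderiv ℝ h q V) p := by
  have h1 := fun W => hasFDerivAt_fderiv_apply hc W
  have hs := snd_fderiv_symm hc
  let LI : F →L[ℝ] F := Complex.I • ContinuousLinearMap.id ℝ F
  refine ⟨(h1 V).differentiableAt, fun v => ?_, fun v => ?_⟩
  · rw [(h1 V).fderiv]
    simp only [ContinuousLinearMap.flip_apply]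
    rw [hs, hs (v, 0)]
    have h2 : (fun q => fderiv ℝ h q (Complex.I • v, 0)) =ᶠ[𝓝 p]
        fun q => LI (fderiv ℝ h q (v, 0)) := H.mono fun q hq => hq.left v
    have h3 := h2.fderiv_eq (𝕜 := ℝ)
    have h4 : HasFDerivAt (fun q => LI (fderiv ℝ h q (v, 0)))
        (LI ∘L (fderiv ℝ (fderiv ℝ h) p).flip (v, 0)) p := LI.hasFDerivAt.comp p (h1 (v, 0))
    rw [(h1 _).fderiv, h4.fderiv] at h3
    exact congrArg (fun L : E × E →L[ℝ] F => L V) h3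
  · rw [(h1 V).fderiv]
    simp only [ContinuousLinearMap.flip_apply]
    rw [hs, hs (0, v)]
    have h2 : (fun q => fderiv ℝ h q (0, Complex.I • v)) =ᶠ[𝓝 p]
        fun q => (-LI) (fderiv ℝ h q (0, v)) := H.mono fun q hq => hq.right v
    have h3 := h2.fderiv_eq (𝕜 := ℝ)
    have h4 : HasFDerivAt (fun q => (-LI) (fderiv ℝ h q (0, v)))
        ((-LI) ∘L (fderiv ℝ (fderiv ℝ h) p).flip (0, v)) p := (-LI).hasFDerivAt.comp p (h1 (0, v))
    rw [(h1 _).fderiv, h4.fderiv] at h3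
    exact congrArg (fun L : E × E →L[ℝ] F => L V) h3

/-- A sesquiholomorphic function that vanishes on the diagonal vanishes. -/
theorem eq_zero_of_diagonal [CompleteSpace F] {B : Set E} (hB : Convex ℝ B) (hBo : IsOpen B)
    (H : ∀ p ∈ B ×ˢ B, IsSesquiAt h p) (h0 : ∀ z ∈ B, h (z, z) = 0) :
    ∀ p ∈ B ×ˢ B, h p = 0 := by
  rintro ⟨z, w⟩ ⟨hz, hw⟩
  simp only at hz hw
  -- With this choice `(z, w) = (m + i k, m - i k)`. The curve `γ s = (m + s k, m + s̄ k)` makes `h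
  -- ∘ γ` holomorphic, meets the diagonal for real `s`, and reaches `(z, w)` at `s = i`; the
  -- identity theorem on the convex set `U` concludes.
  let m : E := (1 / 2 : ℝ) • (z + w)
  let k : E := (-(Complex.I / 2)) • (z - w)
  have hIk : Complex.I • k = (1 / 2 : ℝ) • (z - w) := by
    simp only [k, smul_smul]
    rw [show Complex.I * -(Complex.I / 2) = ((1 / 2 : ℝ) : ℂ) by
      push_cast; linear_combination (-1 / 2 : ℂ) * Complex.I_sq]
    exact (RCLike.real_smul_eq_coe_smul (K := ℂ) _ _).symm
  have hz' : m + Complex.I • k = z := by rw [hIk]; simp only [m]; module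
  have hw' : m + (starRingEnd ℂ Complex.I) • k = w := by
    rw [Complex.conj_I, neg_smul, hIk]; simp only [m]; module
  let ℓ : ℂ →L[ℝ] E := (ContinuousLinearMap.toSpanSingleton ℂ k).restrictScalars ℝ
  let γ' : ℂ →L[ℝ] E × E := ℓ.prod (ℓ ∘L (Complex.conjCLE : ℂ →L[ℝ] ℂ))
  let γ : ℂ → E × E := fun s => (m, m) + γ' s
  have hγ : ∀ s, γ s = (m + s • k, m + (starRingEnd ℂ s) • k) := fun s => by simp [γ, γ', ℓ]
  have hγd : ∀ s, HasFDerivAt γ γ' s := fun s => γ'.hasFDerivAt.const_add _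
  have hγc : Continuous γ := by fun_prop
  let U : Set ℂ := γ ⁻¹' (B ×ˢ B)
  have hUo : IsOpen U := (hBo.prod hBo).preimage hγc
  have hUc : Convex ℝ U := by
    have : U = γ' ⁻¹' ((fun x => (m, m) + x) ⁻¹' (B ×ˢ B)) := rfl
    rw [this]
    exact ((hB.prod hB).translate_preimage_right _).linear_preimage γ'.toLinearMap
  have hI : Complex.I ∈ U := by
    simp only [U, mem_preimage, hγ, hz', hw', mem_prod]; exact ⟨hz, hw⟩
  have hm : m ∈ B := by
    have : m = (1 / 2 : ℝ) • z + (1 / 2 : ℝ) • w := by simp only [m, smul_add]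
    rw [this]
    exact hB hz hw (by norm_num) (by norm_num) (by norm_num)
  have h0U : (0 : ℂ) ∈ U := by
    simp only [U, mem_preimage, hγ, zero_smul, add_zero, map_zero, mem_prod]; exact ⟨hm, hm⟩
  have hd : DifferentiableOn ℂ (h ∘ γ) U := by
    intro s hs
    refine DifferentiableAt.differentiableWithinAt ?_
    rw [differentiableAt_complex_iff_differentiableAt_real]
    have H1 := H _ hs
    have h2 := H1.differentiableAt.hasFDerivAt.comp s (hγd s)
    refine ⟨h2.differentiableAt, ?_⟩
    rw [h2.fderiv]
    have e1 : γ' Complex.I = (Complex.I • k, 0) + (0, Complex.I • (-k)) := by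
      simp [γ', ℓ]
    have e2 : γ' 1 = (k, 0) + (0, k) := by simp [γ', ℓ]
    simp only [ContinuousLinearMap.comp_apply, e1, e2, map_add, H1.left, H1.right, smul_add]
    congr 1
    have : ((0 : E), -k) = -((0 : E), k) := by simp
    rw [this, map_neg, smul_neg, neg_neg]
  have hf : ∃ᶠ s in 𝓝[≠] (0 : ℂ), (h ∘ γ) s = 0 := by
    have h1 : ∀ᶠ t : ℝ in 𝓝[≠] 0, (h ∘ γ) (t : ℂ) = 0 := by
      have hc : Continuous fun t : ℝ => γ (t : ℂ) := hγc.comp Complex.continuous_ofReal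
      have h2 : ∀ᶠ t : ℝ in 𝓝 0, γ (t : ℂ) ∈ B ×ˢ B :=
        hc.continuousAt.eventually ((hBo.prod hBo).mem_nhds (by simp only [Complex.ofReal_zero]; exact h0U))
      refine (h2.filter_mono nhdsWithin_le_nhds).mono fun t ht => ?_
      rw [hγ] at ht
      simp only [Function.comp, hγ, Complex.conj_ofReal]
      exact h0 _ ht.1
    have h3 : Tendsto (fun t : ℝ => (t : ℂ)) (𝓝[≠] 0) (𝓝[≠] 0) := by
      refine tendsto_nhdsWithin_iff.2 ⟨?_, ?_⟩
      · exact (Complex.continuous_ofReal.tendsto' 0 0 (by simp)).mono_left nhdsWithin_le_nhds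
      · exact eventually_mem_nhdsWithin.mono fun t ht => by simpa using ht
    exact h3.frequently h1.frequently
  have := (hd.analyticOnNhd hUo).eqOn_zero_of_preconnected_of_frequently_eq_zero
    hUc.isPreconnected h0U hf hI
  rwa [Function.comp, hγ, hz', hw'] at this

end IsSesquiAt

/-- `P` is a (real analytic) polarization of `u` on `B × B`. -/
structure IsLocalPolarization (B : Set E) (u : E → ℝ) (P : E × E → ℂ) : Prop where
  contDiffAt : ∀ p ∈ B ×ˢ B, ContDiffAt ℝ ω P p
  sesqui : ∀ p ∈ B ×ˢ B, IsSesquiAt P p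
  diagonal : ∀ z ∈ B, P (z, z) = u z

/-- The function `u z + u w - 2 Re P (z, w)`. -/
def localDiastasis (u : E → ℝ) (P : E × E → ℂ) (p : E × E) : ℝ :=
  u p.1 + u p.2 - 2 * (P p).re

/-- The (1,1)-form `i∂∂̄u` at a point of `E`. -/
def levi (u : E → ℝ) (x v w : E) : ℝ :=
  (fderiv ℝ (fderiv ℝ u) x (Complex.I • v) w - fderiv ℝ (fderiv ℝ u) x v (Complex.I • w)) / 2

namespace IsLocalPolarization

variable {B : Set E} {u u' : E → ℝ} {P P' : E × E → ℂ}

/-- Both sides have the same type and agree on the diagonal, where `P` is the real function `u`. -/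
theorem conj_symm (H : IsLocalPolarization B u P) (hB : Convex ℝ B) (hBo : IsOpen B) {z w : E}
    (hz : z ∈ B) (hw : w ∈ B) : starRingEnd ℂ (P (w, z)) = P (z, w) := by
  have h1 := IsSesquiAt.eq_zero_of_diagonal (h := fun p => starRingEnd ℂ (P p.swap) - P p) hB hBo
    (fun p hp => (IsSesquiAt.conj_swap (H.sesqui p.swap ⟨hp.2, hp.1⟩)).sub (H.sesqui p hp))
    (fun z hz => by simp [H.diagonal z hz]) (z, w) ⟨hz, hw⟩
  simpa [sub_eq_zero] using h1

theorem localDiastasis_symm (H : IsLocalPolarization B u P) (hB : Convex ℝ B) (hBo : IsOpen B)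
    {z w : E} (hz : z ∈ B) (hw : w ∈ B) : localDiastasis u P (z, w) = localDiastasis u P (w, z) := by
  simp only [localDiastasis]
  rw [← H.conj_symm hB hBo hz hw, Complex.conj_re]
  ring

theorem localDiastasis_self (H : IsLocalPolarization B u P) {z : E} (hz : z ∈ B) :
    localDiastasis u P (z, z) = 0 := by
  simp only [localDiastasis, H.diagonal z hz, Complex.ofReal_re]
  ring

theorem contDiffAt_potential (H : IsLocalPolarization B u P) (hBo : IsOpen B) {z : E}
    (hz : z ∈ B) : ContDiffAt ℝ ω u z := by
  have h1 : ContDiffAt ℝ ω (fun z => (P (z, z)).re) z :=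
    Complex.reCLM.contDiff.contDiffAt.comp z
      ((H.contDiffAt (z, z) ⟨hz, hz⟩).comp (f := fun z => (z, z)) z
        (contDiffAt_id.prodMk contDiffAt_id))
  refine h1.congr_of_eventuallyEq ?_
  filter_upwards [hBo.mem_nhds hz] with w hw
  simp [H.diagonal w hw]

theorem contDiffAt_localDiastasis (H : IsLocalPolarization B u P) (hBo : IsOpen B) {p : E × E}
    (hp : p ∈ B ×ˢ B) : ContDiffAt ℝ ω (localDiastasis u P) p := by
  unfold localDiastasis
  have h1 : ContDiffAt ℝ ω (fun p : E × E => u p.1) p :=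
    (H.contDiffAt_potential hBo hp.1).comp p contDiffAt_fst
  have h2 : ContDiffAt ℝ ω (fun p : E × E => u p.2) p :=
    (H.contDiffAt_potential hBo hp.2).comp p contDiffAt_snd
  have h3 : ContDiffAt ℝ ω (fun p : E × E => (P p).re) p :=
    Complex.reCLM.contDiff.contDiffAt.comp p (H.contDiffAt p hp)
  exact (h1.add h2).sub (contDiffAt_const.mul h3)

/-- The mixed second derivative of the polarization on the diagonal. -/
def mixed (P : E × E → ℂ) (x v w : E) : ℂ := fderiv ℝ (fderiv ℝ P) (x, x) (v, 0) (0, w)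

theorem snd_fderiv_left (H : IsLocalPolarization B u P) (hBo : IsOpen B) {p : E × E}
    (hp : p ∈ B ×ˢ B) (v : E) (V : E × E) :
    fderiv ℝ (fderiv ℝ P) p (Complex.I • v, 0) V =
      Complex.I * fderiv ℝ (fderiv ℝ P) p (v, 0) V := by
  have hc : ContDiffAt ℝ 2 P p := (H.contDiffAt p hp).of_le le_top
  have := (IsSesquiAt.fderiv_apply hc (by
    filter_upwards [(hBo.prod hBo).mem_nhds hp] with q hq using H.sesqui q hq) V).left v
  rwa [(hasFDerivAt_fderiv_apply hc V).fderiv] at this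

theorem snd_fderiv_right (H : IsLocalPolarization B u P) (hBo : IsOpen B) {p : E × E}
    (hp : p ∈ B ×ˢ B) (v : E) (V : E × E) :
    fderiv ℝ (fderiv ℝ P) p (0, Complex.I • v) V =
      -(Complex.I * fderiv ℝ (fderiv ℝ P) p (0, v) V) := by
  have hc : ContDiffAt ℝ 2 P p := (H.contDiffAt p hp).of_le le_top
  have := (IsSesquiAt.fderiv_apply hc (by
    filter_upwards [(hBo.prod hBo).mem_nhds hp] with q hq using H.sesqui q hq) V).right v
  rwa [(hasFDerivAt_fderiv_apply hc V).fderiv] at this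

theorem mixed_I_left (H : IsLocalPolarization B u P) (hBo : IsOpen B) {x : E} (hx : x ∈ B)
    (v w : E) : mixed P x (Complex.I • v) w = Complex.I * mixed P x v w :=
  H.snd_fderiv_left hBo ⟨hx, hx⟩ v (0, w)

theorem mixed_I_right (H : IsLocalPolarization B u P) (hBo : IsOpen B) {x : E} (hx : x ∈ B)
    (v w : E) : mixed P x v (Complex.I • w) = -(Complex.I * mixed P x v w) := by
  have hc : ContDiffAt ℝ 2 P (x, x) := (H.contDiffAt (x, x) ⟨hx, hx⟩).of_le le_top
  rw [mixed, snd_fderiv_symm hc, H.snd_fderiv_right hBo ⟨hx, hx⟩, snd_fderiv_symm hc, mixed]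

theorem mixed_conj (H : IsLocalPolarization B u P) (hB : Convex ℝ B) (hBo : IsOpen B) {x : E}
    (hx : x ∈ B) (v w : E) : mixed P x w v = starRingEnd ℂ (mixed P x v w) := by
  have hc : ContDiffAt ℝ 2 P (x, x) := (H.contDiffAt (x, x) ⟨hx, hx⟩).of_le le_top
  let S : E × E →L[ℝ] E × E :=
    (ContinuousLinearMap.snd ℝ E E).prod (ContinuousLinearMap.fst ℝ E E)
  have h1 : (fun p => (Complex.conjCLE : ℂ →L[ℝ] ℂ) (P (S p))) =ᶠ[𝓝 (x, x)] P := by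
    filter_upwards [(hBo.prod hBo).mem_nhds (show (x, x) ∈ B ×ˢ B from ⟨hx, hx⟩)] with p hp
    exact H.conj_symm hB hBo hp.1 hp.2
  have h2 := (h1.fderiv (𝕜 := ℝ)).fderiv_eq (𝕜 := ℝ)
  have h3 := snd_fderiv_comp_clm S (Complex.conjCLE : ℂ →L[ℝ] ℂ) (p := (x, x)) (h := P) hc
    (0, v) (w, 0)
  rw [h2] at h3
  rw [mixed, snd_fderiv_symm hc (w, 0), snd_fderiv_symm hc (0, v), snd_fderiv_symm hc (w, 0), h3]
  simp [S, mixed]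

theorem snd_fderiv_potential (H : IsLocalPolarization B u P) (hBo : IsOpen B) {x : E}
    (hx : x ∈ B) (v w : E) : fderiv ℝ (fderiv ℝ u) x v w =
      (fderiv ℝ (fderiv ℝ P) (x, x) (v, v) (w, w)).re := by
  have hc : ContDiffAt ℝ 2 P (x, x) := (H.contDiffAt (x, x) ⟨hx, hx⟩).of_le le_top
  let Δ : E →L[ℝ] E × E := (ContinuousLinearMap.id ℝ E).prod (ContinuousLinearMap.id ℝ E)
  have h1 : (fun z => Complex.reCLM (P (Δ z))) =ᶠ[𝓝 x] u := by
    filter_upwards [hBo.mem_nhds hx] with z hz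
    simp [Δ, H.diagonal z hz]
  rw [← (h1.fderiv (𝕜 := ℝ)).fderiv_eq (𝕜 := ℝ)]
  exact snd_fderiv_comp_clm Δ Complex.reCLM (p := x) (h := P) hc v w

/-- In the combination defining `levi`, the (2,0) and (0,2) parts of the second derivative of `P`
cancel, by complex bilinearity and bi-antilinearity. What remains is the mixed part, which is
Hermitian, and only its imaginary part contributes. -/
theorem levi_eq (H : IsLocalPolarization B u P) (hB : Convex ℝ B) (hBo : IsOpen B) {x : E}
    (hx : x ∈ B) (v w : E) : levi u x v w = -2 * (mixed P x v w).im := by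
  have hc : ContDiffAt ℝ 2 P (x, x) := (H.contDiffAt (x, x) ⟨hx, hx⟩).of_le le_top
  have key : ∀ a b : E, fderiv ℝ (fderiv ℝ P) (x, x) (a, a) (b, b) =
      fderiv ℝ (fderiv ℝ P) (x, x) (a, 0) (b, 0) + mixed P x a b + mixed P x b a +
      fderiv ℝ (fderiv ℝ P) (x, x) (0, a) (0, b) := by
    intro a b
    have e : ∀ a : E, ((a, a) : E × E) = (a, 0) + (0, a) := fun a => by simp
    rw [e a, e b]
    simp only [map_add, add_apply]
    rw [snd_fderiv_symm hc (0, a) (b, 0)]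
    simp only [mixed]
    ring
  have hm := congrArg Complex.im (H.mixed_conj hB hBo hx v w)
  have hm2 := congrArg Complex.re (H.mixed_conj hB hBo hx v w)
  rw [levi, H.snd_fderiv_potential hBo hx, H.snd_fderiv_potential hBo hx, key, key,
    H.snd_fderiv_left hBo ⟨hx, hx⟩, H.snd_fderiv_right hBo ⟨hx, hx⟩, H.mixed_I_left hBo hx,
    H.mixed_I_right hBo hx, H.mixed_I_right hBo hx, H.mixed_I_left hBo hx,
    snd_fderiv_symm hc (v, 0) (Complex.I • w, 0), H.snd_fderiv_left hBo ⟨hx, hx⟩,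
    snd_fderiv_symm hc (0, v) (0, Complex.I • w), H.snd_fderiv_right hBo ⟨hx, hx⟩,
    snd_fderiv_symm hc (w, 0) (v, 0), snd_fderiv_symm hc (0, w) (0, v)]
  simp only [Complex.add_re, Complex.mul_re, Complex.neg_re, Complex.I_re, Complex.I_im,
    Complex.conj_im, Complex.conj_re] at hm hm2 ⊢
  rw [hm]
  ring

theorem levi_self (H : IsLocalPolarization B u P) (hB : Convex ℝ B) (hBo : IsOpen B) {x : E}
    (hx : x ∈ B) (v : E) : levi u x v (Complex.I • v) = 2 * (mixed P x v v).re := by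
  rw [H.levi_eq hB hBo hx, H.mixed_I_right hBo hx]
  simp

theorem snd_fderiv_localDiastasis (H : IsLocalPolarization B u P)
    (hBo : IsOpen B) {x : E} (hx : x ∈ B) (a b c d : E) :
    fderiv ℝ (fderiv ℝ (localDiastasis u P)) (x, x) (c, d) (a, b) =
      (fderiv ℝ (fderiv ℝ P) (x, x) (c, c) (a, a)).re +
      (fderiv ℝ (fderiv ℝ P) (x, x) (d, d) (b, b)).re -
      (2 * fderiv ℝ (fderiv ℝ P) (x, x) (c, d) (a, b)).re := by
  have hc : ContDiffAt ℝ 2 P (x, x) := (H.contDiffAt (x, x) ⟨hx, hx⟩).of_le le_top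
  have hu : ContDiffAt ℝ 2 u x := (H.contDiffAt_potential hBo hx).of_le le_top
  have hu1 : ContDiffAt ℝ 2 (fun p : E × E => u p.1) (x, x) :=
    ContDiffAt.comp (x, x) hu contDiffAt_fst
  have hu2 : ContDiffAt ℝ 2 (fun p : E × E => u p.2) (x, x) :=
    ContDiffAt.comp (x, x) hu contDiffAt_snd
  have hP : ContDiffAt ℝ 2 (fun p : E × E => 2 * (P p).re) (x, x) :=
    contDiffAt_const.mul (Complex.reCLM.contDiff.contDiffAt.comp (x, x) hc)
  unfold localDiastasis
  rw [snd_fderiv_sub (hu1.add hu2) hP, snd_fderiv_add hu1 hu2]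
  have e1 := snd_fderiv_comp_clm (ContinuousLinearMap.fst ℝ E E) (ContinuousLinearMap.id ℝ ℝ)
    (p := (x, x)) (h := u) hu (c, d) (a, b)
  have e2 := snd_fderiv_comp_clm (ContinuousLinearMap.snd ℝ E E) (ContinuousLinearMap.id ℝ ℝ)
    (p := (x, x)) (h := u) hu (c, d) (a, b)
  have e3 := snd_fderiv_comp_clm (ContinuousLinearMap.id ℝ (E × E)) ((2 : ℝ) • Complex.reCLM)
    (p := (x, x)) (h := P) hc (c, d) (a, b)
  simp only [ContinuousLinearMap.coe_fst', ContinuousLinearMap.coe_snd',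
    ContinuousLinearMap.id_apply, smul_apply, Complex.reCLM_apply,
    smul_eq_mul] at e1 e2 e3
  simp only [add_apply, sub_apply]
  rw [e1, e2, e3, H.snd_fderiv_potential hBo hx, H.snd_fderiv_potential hBo hx]
  simp

/-- The (2,0) and (0,2) terms from `u z` are cancelled by those from `-2 Re P`; there remains twice
the Hermitian mixed part, that is, the metric. -/
theorem hessian_left (H : IsLocalPolarization B u P) (hB : Convex ℝ B)
    (hBo : IsOpen B) {x : E} (hx : x ∈ B) (v : E) :
    fderiv ℝ (fderiv ℝ (localDiastasis u P)) (x, x) (v, 0) (v, 0) =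
      levi u x v (Complex.I • v) := by
  have hc : ContDiffAt ℝ 2 P (x, x) := (H.contDiffAt (x, x) ⟨hx, hx⟩).of_le le_top
  rw [H.levi_self hB hBo hx, H.snd_fderiv_localDiastasis hBo hx]
  have e : ((v, v) : E × E) = (v, 0) + (0, v) := by simp
  let S : E × E →L[ℝ] E × E :=
    (ContinuousLinearMap.snd ℝ E E).prod (ContinuousLinearMap.fst ℝ E E)
  have h4 : (fun p => (Complex.conjCLE : ℂ →L[ℝ] ℂ) (P (S p))) =ᶠ[𝓝 (x, x)] P := by
    filter_upwards [(hBo.prod hBo).mem_nhds (show (x, x) ∈ B ×ˢ B from ⟨hx, hx⟩)] with p hp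
    exact H.conj_symm hB hBo hp.1 hp.2
  have h5 := (h4.fderiv (𝕜 := ℝ)).fderiv_eq (𝕜 := ℝ)
  have h6 := snd_fderiv_comp_clm S (Complex.conjCLE : ℂ →L[ℝ] ℂ) (p := (x, x)) (h := P) hc
    (0, v) (0, v)
  rw [h5] at h6
  have h7 := congrArg Complex.re h6
  simp only [S, ContinuousLinearMap.prod_apply, ContinuousLinearMap.coe_fst',
    ContinuousLinearMap.coe_snd', ContinuousLinearEquiv.coe_coe, Complex.conjCLE_apply,
    Complex.conj_re] at h7
  rw [e]
  simp only [map_add, add_apply, Complex.add_re, Complex.mul_re,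
    Complex.re_ofNat, Complex.im_ofNat, h7, Prod.mk_zero_zero, map_zero, Complex.zero_re]
  rw [snd_fderiv_symm hc (0, v) (v, 0)]
  simp only [mixed]
  ring

/-- Only the term `-2 Re P` couples the two variables. The sign is what makes the `z`-differential
of the diastasis injective in `w`, and this carries the involution. -/
theorem hessian_mixed (H : IsLocalPolarization B u P) (hB : Convex ℝ B)
    (hBo : IsOpen B) {x : E} (hx : x ∈ B) (v : E) :
    fderiv ℝ (fderiv ℝ (localDiastasis u P)) (x, x) (0, v) (v, 0) =
      -levi u x v (Complex.I • v) := by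
  have hc : ContDiffAt ℝ 2 P (x, x) := (H.contDiffAt (x, x) ⟨hx, hx⟩).of_le le_top
  rw [H.levi_self hB hBo hx, H.snd_fderiv_localDiastasis hBo hx,
    snd_fderiv_symm hc (0, v) (v, 0), show ((0 : E), (0 : E)) = 0 from rfl]
  simp [mixed]

/-- The diastasis does not depend on the choice of the potential. -/
theorem localDiastasis_eq (H : IsLocalPolarization B u P) (H' : IsLocalPolarization B u' P')
    (hB : Convex ℝ B) (hBo : IsOpen B)
    (hl : ∀ x ∈ B, ∀ v w, levi u x v w = levi u' x v w) {z w : E} (hz : z ∈ B) (hw : w ∈ B) :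
    localDiastasis u P (z, w) = localDiastasis u' P' (z, w) := by
  let h : E × E → ℂ := fun p => P p - P' p
  have hcd : ∀ p ∈ B ×ˢ B, ContDiffAt ℝ ω h p := fun p hp =>
    (H.contDiffAt p hp).sub (H'.contDiffAt p hp)
  have hs : ∀ p ∈ B ×ˢ B, IsSesquiAt h p := fun p hp => (H.sesqui p hp).sub (H'.sesqui p hp)
  have h2 : ∀ p ∈ B ×ˢ B, ∀ V W, fderiv ℝ (fderiv ℝ h) p V W =
      fderiv ℝ (fderiv ℝ P) p V W - fderiv ℝ (fderiv ℝ P') p V W := fun p hp V W => by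
    rw [snd_fderiv_sub ((H.contDiffAt p hp).of_le le_top) ((H'.contDiffAt p hp).of_le le_top)]
    rfl
  have hmem : ∀ p ∈ B ×ˢ B, ∀ᶠ q in 𝓝 p, q ∈ B ×ˢ B := fun p hp => (hBo.prod hBo).mem_nhds hp
  -- The forms determine the imaginary part of the mixed derivative; replacing `v` by `i v` recovers
  -- the real part.
  have hdiag : ∀ x ∈ B, ∀ v w, mixed P x v w = mixed P' x v w := by
    intro x hx v w
    have him : ∀ v w, (mixed P x v w).im = (mixed P' x v w).im := fun v w => by
      have := hl x hx v w
      rw [H.levi_eq hB hBo hx, H'.levi_eq hB hBo hx] at this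
      linarith
    refine Complex.ext ?_ (him v w)
    have := him (Complex.I • v) w
    rw [H.mixed_I_left hBo hx, H'.mixed_I_left hBo hx] at this
    simpa using this
  -- The mixed derivative of `h` is itself sesquiholomorphic and vanishes on the diagonal, so it
  -- vanishes everywhere.
  have hzero : ∀ p ∈ B ×ˢ B, ∀ v w, fderiv ℝ (fderiv ℝ h) p (v, 0) (0, w) = 0 := by
    intro p hp v w
    have key := IsSesquiAt.eq_zero_of_diagonal
      (h := fun p => fderiv ℝ (fun q => fderiv ℝ h q (0, w)) p (v, 0)) hB hBo
      (fun p hp => IsSesquiAt.fderiv_apply ?_ ?_ _) (fun x hx => ?_) p hp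
    · rwa [(hasFDerivAt_fderiv_apply ((hcd p hp).of_le le_top) _).fderiv] at key
    · have h3 : ContDiffAt ℝ 2 (fderiv ℝ h) p :=
        ((hcd p hp).of_le (m := 3) le_top).fderiv_right (by norm_num)
      exact (ContinuousLinearMap.apply ℝ ℂ ((0, w) : E × E)).contDiff.contDiffAt.comp p h3
    · filter_upwards [hmem p hp] with q hq
      refine IsSesquiAt.fderiv_apply ((hcd q hq).of_le le_top) ?_ _
      filter_upwards [hmem q hq] with r hr using hs r hr
    · rw [(hasFDerivAt_fderiv_apply ((hcd (x, x) ⟨hx, hx⟩).of_le le_top) _).fderiv]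
      simp only [ContinuousLinearMap.flip_apply]
      rw [h2 _ ⟨hx, hx⟩, sub_eq_zero]
      exact hdiag x hx v w
  have hpre := hB.isPreconnected
  have hconst : ∀ b ∈ B, ∀ v, fderiv ℝ h (z, b) (0, v) = fderiv ℝ h (w, b) (0, v) := by
    intro b hb v
    have hd : ∀ a ∈ B, HasFDerivAt (fun a => fderiv ℝ h (a, b) (0, v))
        (((fderiv ℝ (fderiv ℝ h) (a, b)).flip (0, v)) ∘L (ContinuousLinearMap.inl ℝ E E)) a := by
      intro a ha
      have h1 := hasFDerivAt_fderiv_apply ((hcd (a, b) ⟨ha, hb⟩).of_le le_top) (0, v)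
      exact HasFDerivAt.comp (f := fun a => (a, b)) a h1 (hasFDerivAt_prodMk_left a b)
    refine hBo.is_const_of_fderiv_eq_zero (𝕜 := ℝ) (f := fun a => fderiv ℝ h (a, b) (0, v)) hpre
      (fun a ha => (hd a ha).differentiableAt.differentiableWithinAt) (fun a ha => ?_) hz hw
    rw [(hd a ha).fderiv]
    ext c
    simpa using hzero (a, b) ⟨ha, hb⟩ c v
  -- Thus `h` is a function of `z` plus a function of `w`, which gives `h(z,z) + h(w,w) = h(z,w) +
  -- h(w,z)`. The real part of this identity, with Hermitian symmetry, is the equality of the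
  -- diastases.
  have hfin : h (z, z) - h (w, z) = h (z, w) - h (w, w) := by
    have hd : ∀ a ∈ B, ∀ b ∈ B, HasFDerivAt (fun b => h (a, b))
        (fderiv ℝ h (a, b) ∘L (ContinuousLinearMap.inr ℝ E E)) b := fun a ha b hb =>
      HasFDerivAt.comp (f := fun b => (a, b)) b
        (((hcd (a, b) ⟨ha, hb⟩).differentiableAt (by simp)).hasFDerivAt)
        (hasFDerivAt_prodMk_right a b)
    refine hBo.is_const_of_fderiv_eq_zero (𝕜 := ℝ) (f := fun b => h (z, b) - h (w, b)) hpre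
      (fun b hb => ((hd z hz b hb).sub
        (hd w hw b hb)).differentiableAt.differentiableWithinAt) (fun b hb => ?_) hz hw
    rw [((hd z hz b hb).fun_sub (hd w hw b hb)).fderiv]
    ext v
    simpa [sub_eq_zero] using hconst b hb v
  have hre := congrArg Complex.re hfin
  have s1 := congrArg Complex.re (H.conj_symm hB hBo hz hw)
  have s2 := congrArg Complex.re (H'.conj_symm hB hBo hz hw)
  simp only [h, Complex.sub_re, H.diagonal z hz, H.diagonal w hw, H'.diagonal z hz,
    H'.diagonal w hw, Complex.ofReal_re, Complex.conj_re] at hre s1 s2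
  simp only [localDiastasis]
  linarith

end IsLocalPolarization

end Sesquiholomorphic

/-! ### Power series with modified binomial coefficients. -/

section MixSeries

open scoped NNReal

variable {X Y F : Type*} [NormedAddCommGroup X] [NormedSpace ℝ X] [NormedAddCommGroup Y]
  [NormedSpace ℝ Y] [NormedAddCommGroup F] [NormedSpace ℂ F]

/-- The expansion of `∑ pₙ (A y + t B y)ⁿ`, with the powers `tᵏ` replaced by the coefficients
`c k`. -/
def mixSeries (p : FormalMultilinearSeries ℝ X F) (A B : Y →L[ℝ] X) (c : ℕ → ℂ) :
    FormalMultilinearSeries ℝ Y F := fun n =>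
  ∑ S : Finset (Fin n), c S.card •
    (p n).compContinuousLinearMap (fun i => if i ∈ S then B else A)

variable (p : FormalMultilinearSeries ℝ X F) (A B : Y →L[ℝ] X) (c : ℕ → ℂ)

theorem mixSeries_apply (n : ℕ) (m : Fin n → Y) : mixSeries p A B c n m =
    ∑ S : Finset (Fin n), c S.card • p n (fun i => if i ∈ S then B (m i) else A (m i)) := by
  simp only [mixSeries, sum_apply, smul_apply,
    ContinuousMultilinearMap.compContinuousLinearMap_apply]
  refine Finset.sum_congr rfl fun S _ => ?_
  congr 2
  ext i
  split_ifs <;> rfl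

/-- There are `2 ^ n` subsets, each contributing at most `‖p n‖ * C ^ n`; so the radius of
convergence shrinks only by a bounded factor. -/
theorem norm_mixSeries_le {C : ℝ} (hA : ‖A‖ ≤ C) (hB : ‖B‖ ≤ C) (hc : ∀ k, ‖c k‖ ≤ 1) (n : ℕ) :
    ‖mixSeries p A B c n‖ ≤ ‖p n‖ * (2 * C) ^ n := by
  have hC : 0 ≤ C := (norm_nonneg A).trans hA
  have h1 : ∀ S ∈ (Finset.univ : Finset (Finset (Fin n))), ‖c S.card •
      (p n).compContinuousLinearMap (fun i => if i ∈ S then B else A)‖ ≤ ‖p n‖ * C ^ n := by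
    intro S _
    have h2 : ‖(p n).compContinuousLinearMap (fun i => if i ∈ S then B else A)‖ ≤
        ‖p n‖ * C ^ n := by
      refine (ContinuousMultilinearMap.norm_compContinuousLinearMap_le _ _).trans ?_
      gcongr
      calc ∏ i, ‖if i ∈ S then B else A‖ ≤ ∏ _i : Fin n, C :=
            Finset.prod_le_prod (fun _ _ => norm_nonneg _) fun i _ => by split_ifs <;> assumption
        _ = C ^ n := by simp
    rw [norm_smul]
    calc _ ≤ 1 * (‖p n‖ * C ^ n) := by gcongr; exact hc _
      _ = _ := one_mul _
  refine (norm_sum_le_of_le _ h1).trans_eq ?_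
  simp [mul_pow]
  ring

variable {p A B c}

theorem radius_mixSeries_pos (hp : 0 < p.radius) (hc : ∀ k, ‖c k‖ ≤ 1) :
    0 < (mixSeries p A B c).radius := by
  obtain ⟨ρ, hρ, hρ'⟩ := ENNReal.lt_iff_exists_nnreal_btwn.1 hp
  have hρ0 : 0 < ρ := by exact_mod_cast hρ
  obtain ⟨K, hK, hK'⟩ := p.norm_mul_pow_le_of_lt_radius hρ'
  let C : ℝ≥0 := ‖A‖₊ + ‖B‖₊ + 1
  have hC : 0 < 2 * C := by positivity
  have h := (mixSeries p A B c).le_radius_of_bound (r := ρ / (2 * C)) K fun n => ?_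
  · refine lt_of_lt_of_le ?_ h
    exact_mod_cast div_pos hρ0 hC
  · have h1 : ‖A‖ ≤ (C : ℝ) := by simp only [C]; push_cast; linarith [norm_nonneg B]
    have h2 : ‖B‖ ≤ (C : ℝ) := by simp only [C]; push_cast; linarith [norm_nonneg A]
    refine le_trans ?_ (hK' n)
    calc _ ≤ ‖p n‖ * (2 * C) ^ n * ((ρ / (2 * C) : ℝ≥0) : ℝ) ^ n := by
          gcongr; exact norm_mixSeries_le p A B c h1 h2 hc n
      _ = ‖p n‖ * (ρ : ℝ) ^ n := by
          rw [mul_assoc, ← mul_pow]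
          congr 2
          push_cast
          have : (2 * (C : ℝ)) ≠ 0 := by exact_mod_cast hC.ne'
          exact mul_div_cancel₀ _ this
      _ ≤ _ := le_rfl

theorem hasFPowerSeriesOnBall_mixSeries [CompleteSpace F] (hp : 0 < p.radius)
    (hc : ∀ k, ‖c k‖ ≤ 1) :
    HasFPowerSeriesOnBall (mixSeries p A B c).sum (mixSeries p A B c) 0
      (mixSeries p A B c).radius :=
  FormalMultilinearSeries.hasFPowerSeriesOnBall _ (radius_mixSeries_pos hp hc)

/-- The binomial expansion of `p n` at `A y + t • B y`, sorted by the slots that receive `t • B y`.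
-/
theorem mixSeries_pow_diag (t : ℝ) (n : ℕ) (y : Y) :
    mixSeries p A B (fun k => (t : ℂ) ^ k) n (fun _ => y) = p n (fun _ => A y + t • B y) := by
  have h1 : (fun _ : Fin n => A y + t • B y) =
      (fun _ : Fin n => t • B y) + (fun _ : Fin n => A y) := by ext; simp [add_comm]
  rw [mixSeries_apply, h1, ContinuousMultilinearMap.map_add_univ]
  refine Finset.sum_congr rfl fun S _ => ?_
  have h2 : (S.piecewise (fun _ : Fin n => t • B y) fun _ => A y) =
      S.piecewise (fun i => (fun _ => t) i • (S.piecewise (fun _ : Fin n => B y) fun _ => A y) i)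
        (S.piecewise (fun _ : Fin n => B y) fun _ => A y) := by
    ext i
    by_cases hi : i ∈ S <;> simp [hi]
  rw [h2, ContinuousMultilinearMap.map_piecewise_smul, Finset.prod_const]
  have h3 : (fun i => if i ∈ S then B y else A y) =
      S.piecewise (fun _ : Fin n => B y) fun _ => A y := rfl
  rw [h3, ← Complex.ofReal_pow]
  exact (RCLike.real_smul_eq_coe_smul (K := ℂ) _ _).symm

theorem mixSeries_diag_of_eq_zero (n : ℕ) {y : Y} (hy : B y = 0) (hc : c 0 = 1) :
    mixSeries p A B c n (fun _ => y) = p n (fun _ => A y) := by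
  rw [mixSeries_apply, Finset.sum_eq_single ∅]
  · simp [hc]
  · intro S _ hS
    obtain ⟨i, hi⟩ := Finset.nonempty_iff_ne_empty.2 hS
    rw [(p n).map_coord_zero i (by simp [hi, hy]), smul_zero]
  · simp

theorem eventually_sum_eq {f : X → F} (hf : HasFPowerSeriesAt f p 0) :
    ∀ᶠ x in 𝓝 (0 : X), HasSum (fun n => p n (fun _ => x)) (f x) := by
  obtain ⟨r, hr⟩ := hf
  filter_upwards [Metric.eball_mem_nhds (0 : X) hr.r_pos] with x hx
  simpa using hr.hasSum hx

variable [CompleteSpace F]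

/-- The coefficients are `∫ tᵏ dt = 1 / (k + 1)`, and dominated convergence exchanges sum and
integral. The left side displays the integral as an analytic function of `y`. -/
theorem mixSeries_sum_eq_integral {f : X → F} (hf : HasFPowerSeriesAt f p 0) :
    ∀ᶠ y in 𝓝 (0 : Y), (mixSeries p A B (fun k => ((k : ℂ) + 1)⁻¹)).sum y =
      ∫ t in (0 : ℝ)..1, f (A y + t • B y) := by
  have hp : 0 < p.radius := by
    obtain ⟨r, hr⟩ := hf
    exact hr.r_pos.trans_le hr.r_le
  have hc : ∀ k : ℕ, ‖((k : ℂ) + 1)⁻¹‖ ≤ 1 := fun k => by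
    rw [norm_inv]
    refine inv_le_one_of_one_le₀ ?_
    have : ((k : ℂ) + 1) = ((k + 1 : ℝ) : ℂ) := by push_cast; rfl
    rw [this, Complex.norm_real, Real.norm_eq_abs, abs_of_pos (by positivity)]
    have : (0 : ℝ) ≤ k := by positivity
    linarith
  obtain ⟨ρ, hρ, hρ'⟩ := ENNReal.lt_iff_exists_nnreal_btwn.1 hp
  have hρ0 : 0 < ρ := by exact_mod_cast hρ
  have hsum := p.summable_norm_mul_pow hρ'
  let C : ℝ := ‖A‖ + ‖B‖ + 1
  have hC : 0 < C := by positivity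
  have hCA : ‖A‖ ≤ C := by simp only [C]; linarith [norm_nonneg B]
  have hCB : ‖B‖ ≤ C := by simp only [C]; linarith [norm_nonneg A]
  have hball : ∀ᶠ y in 𝓝 (0 : Y), ‖y‖ < ρ / (2 * C) := by
    have := Metric.ball_mem_nhds (0 : Y) (show 0 < (ρ : ℝ) / (2 * C) by positivity)
    filter_upwards [this] with y hy using by simpa using hy
  have hall : ∀ᶠ y in 𝓝 (0 : Y), ∀ t ∈ Icc (0 : ℝ) 1,
      HasSum (fun n => p n (fun _ => A y + t • B y)) (f (A y + t • B y)) := by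
    refine isCompact_Icc.eventually_forall_of_forall_eventually fun t _ => ?_
    have hcont : Continuous fun q : Y × ℝ => A q.1 + q.2 • B q.1 := by fun_prop
    exact (hcont.tendsto' (0, t) 0 (by simp)).eventually (eventually_sum_eq hf)
  have hs := (hasFPowerSeriesOnBall_mixSeries (A := A) (B := B) hp hc)
  filter_upwards [hball, hall, eventually_sum_eq ⟨_, hs⟩] with y hy hall hsy
  refine hsy.unique ?_
  have hterm : ∀ n, mixSeries p A B (fun k => ((k : ℂ) + 1)⁻¹) n (fun _ => y) =
      ∫ t in (0 : ℝ)..1, mixSeries p A B (fun k => (t : ℂ) ^ k) n (fun _ => y) := by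
    intro n
    simp only [mixSeries_apply]
    rw [intervalIntegral.integral_finsetSum]
    · refine Finset.sum_congr rfl fun S _ => ?_
      rw [intervalIntegral.integral_smul_const]
      congr 1
      have : ∫ t in (0 : ℝ)..1, (t : ℂ) ^ S.card = ((∫ t in (0 : ℝ)..1, t ^ S.card : ℝ) : ℂ) := by
        rw [← intervalIntegral.integral_ofReal]
        simp
      rw [this, integral_pow]
      push_cast
      simp
    · intro S _
      exact Continuous.intervalIntegrable (by fun_prop) _ _
  simp only [hterm]
  refine intervalIntegral.hasSum_integral_of_dominated_convergence
    (fun n _ => ‖p n‖ * (ρ : ℝ) ^ n) (fun n => ?_) (fun n => ?_) ?_ ?_ ?_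
  · simp only [mixSeries_pow_diag]
    refine Continuous.aestronglyMeasurable ?_
    exact (p n).cont.comp (by fun_prop)
  · refine Eventually.of_forall fun t ht => ?_
    rw [uIoc_of_le zero_le_one] at ht
    refine (ContinuousMultilinearMap.le_opNorm _ _).trans ?_
    have h1 := norm_mixSeries_le p A B (fun k => (t : ℂ) ^ k) hCA hCB (fun k => by
      rw [norm_pow, Complex.norm_real, Real.norm_eq_abs, abs_of_pos ht.1]
      exact pow_le_one₀ ht.1.le ht.2) n
    calc _ ≤ ‖p n‖ * (2 * C) ^ n * (ρ / (2 * C)) ^ n := by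
          simp only [Finset.prod_const, Finset.card_univ, Fintype.card_fin]
          gcongr
      _ = ‖p n‖ * (ρ : ℝ) ^ n := by
          rw [mul_assoc, ← mul_pow]
          congr 2
          field_simp
  · exact Eventually.of_forall fun t _ => hsum
  · exact intervalIntegrable_const
  · refine Eventually.of_forall fun t ht => ?_
    rw [uIoc_of_le zero_le_one] at ht
    simp only [mixSeries_pow_diag]
    exact hall t ⟨ht.1.le, ht.2⟩

end MixSeries

/-! ### Polarization of real-analytic functions. -/

section Polarization

variable {X Y F : Type*} [NormedAddCommGroup X] [NormedSpace ℝ X] [NormedAddCommGroup Y]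
  [NormedSpace ℝ Y] [NormedAddCommGroup F] [NormedSpace ℂ F]

/-- Moving the slot `j` in or out of `S` changes the weight by a factor `i` or its inverse. The
relations between `k` and `k'` convert this into complex linearity of the series in that slot. -/
theorem mixSeries_update {p : FormalMultilinearSeries ℝ X F} {A B : Y →L[ℝ] X} {k k' : Y}
    (h1 : A k' = -B k) (h2 : B k' = A k) (n : ℕ) (m : Fin n → Y) (j : Fin n) :
    mixSeries p A B (fun k => Complex.I ^ k) n (Function.update m j k') =
      Complex.I • mixSeries p A B (fun k => Complex.I ^ k) n (Function.update m j k) := by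
  simp only [mixSeries_apply, Finset.smul_sum]
  let σ : Finset (Fin n) → Finset (Fin n) := fun S => if j ∈ S then S.erase j else insert j S
  have hσ : Function.Involutive σ := by
    intro S
    by_cases hj : j ∈ S <;> simp [σ, hj, Finset.insert_erase]
  have hup : ∀ (S : Finset (Fin n)) (x : Y),
      (fun i => if i ∈ S then B (Function.update m j x i) else A (Function.update m j x i)) =
      Function.update (fun i => if i ∈ S then B (m i) else A (m i)) j
        (if j ∈ S then B x else A x) := by
    intro S x
    ext i
    by_cases hi : i = j
    · subst hi; simp
    · simp [hi]
  refine Fintype.sum_equiv hσ.toPerm _ _ fun S => ?_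
  rw [Function.Involutive.coe_toPerm, hup S k', hup (σ S) k]
  have hoff : ∀ x : X, Function.update (fun i => if i ∈ σ S then B (m i) else A (m i)) j x =
      Function.update (fun i => if i ∈ S then B (m i) else A (m i)) j x := by
    intro x
    ext i
    by_cases hi : i = j
    · subst hi; simp
    · by_cases hj : j ∈ S <;> simp [σ, hj, hi]
  rw [hoff]
  by_cases hj : j ∈ S
  · have h3 : j ∉ σ S := by simp [σ, hj]
    have h4 : S.card = (σ S).card + 1 := by
      simp only [σ, hj, if_true]
      exact (Finset.card_erase_add_one hj).symm
    rw [if_pos hj, if_neg h3, h2, h4, pow_succ, smul_smul, mul_comm]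
  · have h3 : j ∈ σ S := by simp [σ, hj]
    have h4 : (σ S).card = S.card + 1 := by simp [σ, hj]
    rw [if_neg hj, if_pos h3, h1, h4, pow_succ,
      ← ContinuousMultilinearMap.coe_coe, MultilinearMap.map_update_neg, smul_smul,
      smul_neg, ← neg_smul]
    congr 1
    linear_combination (-Complex.I ^ S.card) * Complex.I_sq

/-- Each term of the derivative series puts the direction into exactly one slot, so a relation valid
slot by slot passes to the derivative. -/
theorem derivSeries_apply_of_update {q : FormalMultilinearSeries ℝ Y F} {k k' : Y} {c : ℂ}
    (h : ∀ (n : ℕ) (m : Fin n → Y) (j : Fin n),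
      q n (Function.update m j k') = c • q n (Function.update m j k)) (n : ℕ) (y : Y) :
    q.derivSeries n (fun _ => y) k' = c • q.derivSeries n (fun _ => y) k := by
  have h1 : ∀ v : Y, q.derivSeries n (fun _ => y) v = ∑ s : { s : Finset (Fin (1 + n)) //
      s.card = n }, q (1 + n) ((s : Finset (Fin (1 + n))).piecewise (fun _ => y) fun _ => v) := by
    intro v
    simp only [FormalMultilinearSeries.derivSeries,
      ContinuousLinearMap.compFormalMultilinearSeries_apply,
      FormalMultilinearSeries.changeOriginSeries,
      ContinuousLinearMap.compContinuousMultilinearMap_coe, Function.comp_apply, sum_apply, map_sum]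
    refine Finset.sum_congr rfl fun s _ => ?_
    exact q.changeOriginSeriesTerm_apply 1 n s s.2 y v
  rw [h1, h1, Finset.smul_sum]
  refine Finset.sum_congr rfl fun s _ => ?_
  obtain ⟨s, hs⟩ := s
  have hcard : sᶜ.card = 1 := by rw [Finset.card_compl, hs]; simp
  obtain ⟨j, hj⟩ := Finset.card_eq_one.1 hcard
  have h2 : ∀ v : Y, (s.piecewise (fun _ => y) fun _ => v) =
      Function.update (fun _ : Fin (1 + n) => y) j v := by
    intro v
    ext i
    have hi : i ∉ s ↔ i = j := by rw [← Finset.mem_compl, hj, Finset.mem_singleton]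
    by_cases h : i = j
    · rw [Finset.piecewise_eq_of_notMem _ _ _ (hi.2 h), h, Function.update_self]
    · rw [Finset.piecewise_eq_of_mem _ _ _ (by by_contra h'; exact h (hi.1 h')),
        Function.update_of_ne h]
  simp only [h2, h]

variable {E : Type*} [NormedAddCommGroup E] [NormedSpace ℂ E] [CompleteSpace F]

/-- A real analytic function is the restriction to the diagonal of a function that is holomorphic
in the first variable and antiholomorphic in the second one. -/
theorem exists_polarization {f : E → F} (hf : AnalyticAt ℝ f 0) :
    ∃ Q : E × E → F, AnalyticAt ℝ Q 0 ∧ (∀ᶠ p in 𝓝 0, IsSesquiAt Q p) ∧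
      ∀ᶠ x in 𝓝 0, Q (x, x) = f x := by
  obtain ⟨p, hp⟩ := hf
  have hpr : 0 < p.radius := by
    obtain ⟨r, hr⟩ := hp
    exact hr.r_pos.trans_le hr.r_le
  let J : E →L[ℝ] E := (Complex.I • ContinuousLinearMap.id ℂ E).restrictScalars ℝ
  have hJ : ∀ v, J v = Complex.I • v := fun v => rfl
  -- Formally `Q (z, w)` is the power series of `f` at `(z + w)/2 + t J(w - z)/2` with the scalar
  -- `t` replaced by `i`, kept distinct from the complex structure `J` of `E`. On the diagonal `B`
  -- vanishes and `f` is recovered.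
  let A : E × E →L[ℝ] E :=
    (1 / 2 : ℝ) • (ContinuousLinearMap.fst ℝ E E + ContinuousLinearMap.snd ℝ E E)
  let B : E × E →L[ℝ] E :=
    (1 / 2 : ℝ) • (J ∘L (ContinuousLinearMap.snd ℝ E E - ContinuousLinearMap.fst ℝ E E))
  let q := mixSeries p A B (fun k => Complex.I ^ k)
  have hII : ∀ v : E, Complex.I • Complex.I • v = -v := fun v => by
    rw [smul_smul, Complex.I_mul_I, neg_one_smul]
  have hq := hasFPowerSeriesOnBall_mixSeries (A := A) (B := B) (c := fun k => Complex.I ^ k) hpr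
    (fun k => by simp)
  have hupd1 : ∀ (v : E) (n : ℕ) (m : Fin n → E × E) (j : Fin n),
      q n (Function.update m j (Complex.I • v, 0)) =
        Complex.I • q n (Function.update m j (v, 0)) := by
    intro v n m j
    refine mixSeries_update ?_ ?_ n m j
    · simp [A, B, hJ]
    · simp [A, B, hJ, hII]
  have hupd2 : ∀ (v : E) (n : ℕ) (m : Fin n → E × E) (j : Fin n),
      q n (Function.update m j (0, Complex.I • v)) =
        (-Complex.I) • q n (Function.update m j (0, v)) := by
    intro v n m j
    have h1 := mixSeries_update (p := p) (A := A) (B := B) (k := (0, v))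
      (k' := (0, -(Complex.I • v))) (by simp [A, B, hJ]) (by simp [A, B, hJ, hII]) n m j
    have h2 : ((0 : E), -(Complex.I • v)) = -((0 : E), Complex.I • v) := by simp
    rw [h2, ← ContinuousMultilinearMap.coe_coe, MultilinearMap.map_update_neg,
      ContinuousMultilinearMap.coe_coe] at h1
    rw [neg_smul, ← h1, neg_neg]
  refine ⟨q.sum, ⟨q, _, hq⟩, ?_, ?_⟩
  · filter_upwards [Metric.eball_mem_nhds (0 : E × E) hq.r_pos] with y hy
    have h1 := hq.fderiv.hasSum hy
    rw [zero_add] at h1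
    have h2 : ∀ v, HasSum (fun n => q.derivSeries n (fun _ => y) v) (fderiv ℝ q.sum y v) :=
      fun v => h1.mapL (ContinuousLinearMap.apply ℝ F v)
    refine ⟨(hq.differentiableOn y hy).differentiableAt (Metric.isOpen_eball.mem_nhds hy),
      fun v => ?_, fun v => ?_⟩
    · refine (h2 _).unique ?_
      simp only [derivSeries_apply_of_update (hupd1 v)]
      exact (h2 _).const_smul _
    · refine (h2 _).unique ?_
      simp only [derivSeries_apply_of_update (hupd2 v)]
      rw [← neg_smul]
      exact (h2 _).const_smul _
  · have hΔ : Tendsto (fun x : E => (x, x)) (𝓝 0) (𝓝 0) :=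
      Continuous.tendsto' (by fun_prop) _ _ rfl
    filter_upwards [hΔ.eventually (eventually_sum_eq ⟨_, hq⟩), eventually_sum_eq hp] with x h1 h2
    refine h1.unique (h2.congr_fun ?_)
    intro n
    rw [mixSeries_diag_of_eq_zero n (by simp [B]) (by simp)]
    congr 1
    ext
    simp only [A, smul_apply, add_apply, ContinuousLinearMap.coe_fst', ContinuousLinearMap.coe_snd']
    module

end Polarization

/-! ### The Poincaré lemma with analytic parameters. -/

section PartialPrimitive

variable {Z W F : Type*} [NormedAddCommGroup Z] [NormedSpace ℝ Z] [NormedAddCommGroup W]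
  [NormedSpace ℝ W] [NormedAddCommGroup F] [NormedSpace ℂ F] [CompleteSpace F]

/-- An analytic family of closed 1-forms has an analytic family of primitives. -/
theorem exists_partial_primitive {α : Z × W → W →L[ℝ] F} (hα : AnalyticAt ℝ α 0)
    (hcl : ∀ᶠ p in 𝓝 0, ∀ v w : W, fderiv ℝ α p (0, v) w = fderiv ℝ α p (0, w) v) :
    ∃ β : Z × W → F, AnalyticAt ℝ β 0 ∧ (∀ z, β (z, 0) = 0) ∧
      ∀ᶠ p in 𝓝 0, ∀ w, fderiv ℝ β p (0, w) = α p w := by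
  obtain ⟨p, hp⟩ := hα
  have hpr : 0 < p.radius := by
    obtain ⟨r, hr⟩ := hp
    exact hr.r_pos.trans_le hr.r_le
  -- `A + t • B` sends `(z, w)` to `(z, t w)`; so `q.sum (z, w) w` is the homotopy integral `∫ α (z,
  -- t w) w dt`, visibly analytic.
  let A : Z × W →L[ℝ] Z × W := ContinuousLinearMap.inl ℝ Z W ∘L ContinuousLinearMap.fst ℝ Z W
  let B : Z × W →L[ℝ] Z × W := ContinuousLinearMap.inr ℝ Z W ∘L ContinuousLinearMap.snd ℝ Z W
  let q := mixSeries p A B (fun k => ((k : ℂ) + 1)⁻¹)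
  have hc : ∀ k : ℕ, ‖((k : ℂ) + 1)⁻¹‖ ≤ 1 := fun k => by
    rw [norm_inv]
    refine inv_le_one_of_one_le₀ ?_
    have : ((k : ℂ) + 1) = ((k + 1 : ℝ) : ℂ) := by push_cast; rfl
    rw [this, Complex.norm_real, Real.norm_eq_abs, abs_of_pos (by positivity)]
    have : (0 : ℝ) ≤ k := by positivity
    linarith
  have hq : AnalyticAt ℝ q.sum 0 := ⟨q, _, hasFPowerSeriesOnBall_mixSeries hpr hc⟩
  have hβ : AnalyticAt ℝ (fun y : Z × W => q.sum y y.2) 0 := by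
    exact ((hq.contDiffAt (n := ω)).clm_apply contDiffAt_snd).analyticAt
  refine ⟨fun y => q.sum y y.2, hβ, fun z => by simp, ?_⟩
  have hαan := (show AnalyticAt ℝ α 0 from ⟨p, hp⟩).eventually_analyticAt
  have hev := (mixSeries_sum_eq_integral (A := A) (B := B) hp).and
    (hcl.and (hαan.and hβ.eventually_analyticAt))
  obtain ⟨r, hr, hball⟩ := Metric.eventually_nhds_iff_ball.1 hev
  have hprod : Metric.ball (0 : Z × W) r = Metric.ball 0 r ×ˢ Metric.ball 0 r :=
    (ball_prod_same _ _ _).symm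
  filter_upwards [Metric.ball_mem_nhds (0 : Z × W) hr] with y hy
  obtain ⟨z, w⟩ := y
  rw [hprod] at hy hball
  have hmem : ∀ w' ∈ Metric.ball (0 : W) r, (z, w') ∈ Metric.ball (0 : Z) r ×ˢ Metric.ball 0 r :=
    fun w' hw' => ⟨hy.1, hw'⟩
  have hd : ∀ w' ∈ Metric.ball (0 : W) r, HasFDerivAt (fun w' => α (z, w'))
      (fderiv ℝ α (z, w') ∘L ContinuousLinearMap.inr ℝ Z W) w' := fun w' hw' =>
    HasFDerivAt.comp (f := fun w' => (z, w')) w'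
      (hball _ (hmem w' hw')).2.2.1.differentiableAt.hasFDerivAt (hasFDerivAt_prodMk_right z w')
  -- On a fixed slice the closed form has some primitive `f`. Integration along rays identifies the
  -- analytic candidate with `f - f 0`, which gives its derivative without differentiating the
  -- integral.
  obtain ⟨f, hf⟩ := (convex_ball (0 : W) r).exists_forall_hasFDerivAt_of_fderiv_symmetric
    Metric.isOpen_ball (show DifferentiableOn ℝ (fun w' => α (z, w')) _ from
      fun w' hw' => (hd w' hw').differentiableAt.differentiableWithinAt) (fun w' hw' x y => by
      rw [(hd w' hw').fderiv]
      simpa using (hball _ (hmem w' hw')).2.1 x y)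
  have hβf : ∀ w' ∈ Metric.ball (0 : W) r, q.sum (z, w') w' = f w' - f 0 := by
    intro w' hw'
    have h1 := (hball _ (hmem w' hw')).1
    have hA : ∀ t : ℝ, A (z, w') + t • B (z, w') = (z, t • w') := fun t => by simp [A, B]
    simp only [hA] at h1
    have hseg : ∀ t ∈ Icc (0 : ℝ) 1, t • w' ∈ Metric.ball (0 : W) r := fun t ht => by
      have := (convex_ball (0 : W) r).smul_mem_of_zero_mem (by simpa using hr) hw' ht
      exact this
    have hcont : ContinuousOn (fun t : ℝ => α (z, t • w')) (Icc 0 1) := fun t ht =>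
      ContinuousAt.continuousWithinAt (ContinuousAt.comp (f := fun t : ℝ => t • w')
        (hd _ (hseg t ht)).continuousAt (by fun_prop))
    have hint : IntervalIntegrable (fun t : ℝ => α (z, t • w')) MeasureTheory.volume 0 1 :=
      ContinuousOn.intervalIntegrable (by rwa [uIcc_of_le zero_le_one])
    have h2 : q.sum (z, w') w' = ∫ t in (0 : ℝ)..1, α (z, t • w') w' := by
      rw [show q.sum (z, w') = ∫ t in (0 : ℝ)..1, α (z, t • w') from h1]
      exact (ContinuousLinearMap.intervalIntegral_apply hint w')
    rw [h2]
    have hint' : IntervalIntegrable (fun t : ℝ => α (z, t • w') w') MeasureTheory.volume 0 1 :=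
      ContinuousOn.intervalIntegrable (by
        rw [uIcc_of_le zero_le_one]; exact hcont.clm_apply continuousOn_const)
    rw [intervalIntegral.integral_eq_sub_of_hasDerivAt (f := fun t : ℝ => f (t • w')) ?_ hint']
    · simp
    · intro t ht
      rw [uIcc_of_le zero_le_one] at ht
      have := (hf _ (hseg t ht)).comp_hasDerivAt t
        ((hasDerivAt_id t).smul_const w')
      simpa [Function.comp_def] using this
  intro v
  have hw : w ∈ Metric.ball (0 : W) r := hy.2
  have h3 : HasFDerivAt (fun w' => q.sum (z, w') w') (α (z, w)) w := by
    refine ((hf w hw).sub_const (f 0)).congr_of_eventuallyEq ?_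
    filter_upwards [Metric.isOpen_ball.mem_nhds hw] with w' hw' using hβf w' hw'
  have h4 : HasFDerivAt (fun w' => q.sum (z, w') w')
      (fderiv ℝ (fun y : Z × W => q.sum y y.2) (z, w) ∘L ContinuousLinearMap.inr ℝ Z W) w :=
    HasFDerivAt.comp (f := fun w' => (z, w')) (g := fun y : Z × W => q.sum y y.2) w
      (hball _ (hmem w hw)).2.2.2.differentiableAt.hasFDerivAt (hasFDerivAt_prodMk_right z w)
  rw [← h4.unique h3]
  simp

end PartialPrimitive

set_option maxSynthPendingDepth 3

/-! ### Propagation of identities from the slice `w = 0`. -/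

section Partial

variable {Z W F : Type*} [NormedAddCommGroup Z] [NormedSpace ℝ Z] [NormedAddCommGroup W]
  [NormedSpace ℝ W] [NormedAddCommGroup F] [NormedSpace ℝ F]

theorem fderiv_fderiv_apply_comm {h k : Z → F} {p U V : Z} (hc : ContDiffAt ℝ 2 h p)
    (hk : (fun q => fderiv ℝ h q V) =ᶠ[𝓝 p] k) :
    fderiv ℝ (fun q => fderiv ℝ h q U) p V = fderiv ℝ k p U := by
  rw [← hk.fderiv_eq, (hasFDerivAt_fderiv_apply hc U).fderiv, (hasFDerivAt_fderiv_apply hc V).fderiv,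
    ContinuousLinearMap.flip_apply, ContinuousLinearMap.flip_apply, snd_fderiv_symm hc]

/-- Used to propagate identities for primitives normalized by `β (z, 0) = 0`: they are clear for `w
= 0` and their `w`-derivative is an identity for the integrand. -/
theorem eq_zero_of_fderiv_right {h : Z × W → F} {r : ℝ}
    (hd : ∀ p ∈ Metric.ball (0 : Z × W) r, DifferentiableAt ℝ h p)
    (h0 : ∀ p ∈ Metric.ball (0 : Z × W) r, ∀ w, fderiv ℝ h p (0, w) = 0)
    (hz : ∀ z ∈ Metric.ball (0 : Z) r, h (z, 0) = 0) : ∀ p ∈ Metric.ball (0 : Z × W) r, h p = 0 := by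
  rintro ⟨z, w⟩ hp
  have hball : ∀ w' : W, w' ∈ Metric.ball (0 : W) r → (z, w') ∈ Metric.ball (0 : Z × W) r := by
    intro w' hw'
    simp only [mem_ball_zero_iff, Prod.norm_def, max_lt_iff] at hp hw' ⊢
    exact ⟨hp.1, hw'⟩
  have hwr : w ∈ Metric.ball (0 : W) r := by
    simp only [mem_ball_zero_iff, Prod.norm_def, max_lt_iff] at hp ⊢
    exact hp.2
  have hzr : z ∈ Metric.ball (0 : Z) r := by
    simp only [mem_ball_zero_iff, Prod.norm_def, max_lt_iff] at hp ⊢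
    exact hp.1
  have hder : ∀ w' ∈ Metric.ball (0 : W) r, HasFDerivAt (fun w' => h (z, w')) (0 : W →L[ℝ] F) w' := by
    intro w' hw'
    have h1 := (hd _ (hball w' hw')).hasFDerivAt.comp w' (hasFDerivAt_prodMk_right z w')
    refine h1.congr_fderiv ?_
    ext v
    simpa using h0 _ (hball w' hw') v
  have := (convex_ball (0 : W) r).is_const_of_fderivWithin_eq_zero (𝕜 := ℝ)
    (f := fun w' => h (z, w')) (fun w' hw' => (hder w' hw').differentiableAt.differentiableWithinAt)
    (fun w' hw' => by
      rw [(hder w' hw').hasFDerivWithinAt.fderivWithin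
        (Metric.isOpen_ball.uniqueDiffWithinAt hw')]) hwr
    (Metric.mem_ball_self (Metric.pos_of_mem_ball hwr))
  simpa [hz z hzr] using this

end Partial

/-! ### Polarization and double integration of closed (1,1)-forms. -/

section Kahler

variable {E : Type*} [NormedAddCommGroup E] [NormedSpace ℂ E]

/-- The Hermitian form with imaginary part `-T / 2`. -/
def hermitianPart : (E →L[ℝ] E →L[ℝ] ℝ) →L[ℝ] (E →L[ℝ] E →L[ℝ] ℂ) :=
  let mulI : E →L[ℝ] E := Complex.I • ContinuousLinearMap.id ℝ E
  let post : ℂ → (E →L[ℝ] E →L[ℝ] ℝ) →L[ℝ] (E →L[ℝ] E →L[ℝ] ℂ) := fun a =>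
    ContinuousLinearMap.compL ℝ E (E →L[ℝ] ℝ) (E →L[ℝ] ℂ)
      (ContinuousLinearMap.compL ℝ E ℝ ℂ (ContinuousLinearMap.toSpanSingleton ℝ a))
  let pre : (E →L[ℝ] E →L[ℝ] ℝ) →L[ℝ] (E →L[ℝ] E →L[ℝ] ℝ) :=
    ContinuousLinearMap.compL ℝ E (E →L[ℝ] ℝ) (E →L[ℝ] ℝ)
      ((ContinuousLinearMap.compL ℝ E E ℝ).flip mulI)
  post (1 / 2) ∘L pre + post (-(Complex.I / 2))

theorem hermitianPart_apply (T : E →L[ℝ] E →L[ℝ] ℝ) (v w : E) :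
    hermitianPart T v w = (T v (Complex.I • w) - Complex.I * T v w) / 2 := by
  simp [hermitianPart]
  ring

/-- Evaluation of a bilinear map. -/
def evalBilin (b c : E) : (E →L[ℝ] E →L[ℝ] ℂ) →L[ℝ] ℂ :=
  ContinuousLinearMap.apply ℝ ℂ c ∘L ContinuousLinearMap.apply ℝ (E →L[ℝ] ℂ) b

@[simp] theorem evalBilin_apply (b c : E) (T : E →L[ℝ] E →L[ℝ] ℂ) : evalBilin b c T = T b c := rfl

theorem fderiv_evalBilin {Z : Type*} [NormedAddCommGroup Z] [NormedSpace ℝ Z]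
    {Q : Z → E →L[ℝ] E →L[ℝ] ℂ} {p : Z} (h : DifferentiableAt ℝ Q p) (b c : E) (V : Z) :
    fderiv ℝ (fun q => Q q b c) p V = fderiv ℝ Q p V b c := by
  have : HasFDerivAt (fun q => Q q b c) (evalBilin b c ∘L fderiv ℝ Q p) p :=
    (evalBilin b c).hasFDerivAt.comp p h.hasFDerivAt
  rw [this.fderiv]
  rfl

theorem IsSesquiAt.evalBilin {Q : E × E → E →L[ℝ] E →L[ℝ] ℂ} {p : E × E} (H : IsSesquiAt Q p)
    (b c : E) : IsSesquiAt (fun q => Q q b c) p :=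
  H.clm_comp (ComplexLegendre.evalBilin b c) (fun v => by simp)

theorem IsSesquiAt.smul {h : E × E → ℂ} {p : E × E} (H : IsSesquiAt h p) (a : ℂ) :
    IsSesquiAt (fun q => a * h q) p :=
  H.clm_comp (a • ContinuousLinearMap.id ℝ ℂ) (fun v => by simp; ring)

theorem IsSesquiAt.fderiv_evalBilin {Q : E × E → E →L[ℝ] E →L[ℝ] ℂ} {p : E × E}
    (hc : ContDiffAt ℝ 2 Q p) (H : ∀ᶠ q in 𝓝 p, IsSesquiAt Q q) (b c : E) (V : E × E) :
    IsSesquiAt (fun q => fderiv ℝ Q q V b c) p := by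
  exact (IsSesquiAt.fderiv_apply hc H V).evalBilin b c

/-- The derivative of the restriction to the diagonal is the sum of the two partial derivatives; one
is complex linear and the other antilinear, so they are its `∂` and `∂̄` parts. -/
theorem fderiv_diagonal {h : E × E → ℂ} {g : E → ℂ} {x : E} (H : IsSesquiAt h (x, x))
    (hg : (fun y => h (y, y)) =ᶠ[𝓝 x] g) (a : E) :
    fderiv ℝ h (x, x) (a, 0) = (fderiv ℝ g x a - Complex.I * fderiv ℝ g x (Complex.I • a)) / 2 ∧
    fderiv ℝ h (x, x) (0, a) = (fderiv ℝ g x a + Complex.I * fderiv ℝ g x (Complex.I • a)) / 2 := by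
  have h1 : ∀ b : E, fderiv ℝ g x b = fderiv ℝ h (x, x) (b, 0) + fderiv ℝ h (x, x) (0, b) := by
    intro b
    have : HasFDerivAt (fun y => h (y, y)) (fderiv ℝ h (x, x) ∘L
        ((ContinuousLinearMap.id ℝ E).prod (ContinuousLinearMap.id ℝ E))) x :=
      HasFDerivAt.comp x H.differentiableAt.hasFDerivAt
        ((hasFDerivAt_id x).prodMk (hasFDerivAt_id x))
    rw [← hg.fderiv_eq, this.fderiv, ← map_add]
    simp
  have h2 := H.left a
  have h3 := H.right a
  rw [h1, h1, h2, h3]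
  simp only [smul_eq_mul]
  constructor
  · linear_combination ((fderiv ℝ h (x, x) (a, 0) - fderiv ℝ h (x, x) (0, a)) / 2) * Complex.I_sq
  · linear_combination (-(fderiv ℝ h (x, x) (a, 0) - fderiv ℝ h (x, x) (0, a)) / 2) * Complex.I_sq

/-- The polarization of the coefficients of a closed (1,1)-form. -/
theorem exists_polarization_closed [FiniteDimensional ℂ E] {G : E → E →L[ℝ] E →L[ℝ] ℂ}
    (hG : AnalyticAt ℝ G 0)
    (hl : ∀ᶠ x in 𝓝 0, ∀ b c, G x (Complex.I • b) c = Complex.I * G x b c)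
    (hr : ∀ᶠ x in 𝓝 0, ∀ b c, G x b (Complex.I • c) = -(Complex.I * G x b c))
    (hz : ∀ᶠ x in 𝓝 0, ∀ a b c,
      fderiv ℝ G x a b c - Complex.I * fderiv ℝ G x (Complex.I • a) b c =
      fderiv ℝ G x b a c - Complex.I * fderiv ℝ G x (Complex.I • b) a c)
    (hw : ∀ᶠ x in 𝓝 0, ∀ a b c,
      fderiv ℝ G x a b c + Complex.I * fderiv ℝ G x (Complex.I • a) b c =
      fderiv ℝ G x c b a + Complex.I * fderiv ℝ G x (Complex.I • c) b a) :
    ∃ Q : E × E → E →L[ℝ] E →L[ℝ] ℂ, AnalyticAt ℝ Q 0 ∧ (∀ᶠ x in 𝓝 0, Q (x, x) = G x) ∧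
      ∀ᶠ p in 𝓝 0,
        (∀ b c, Q p (Complex.I • b) c = Complex.I * Q p b c) ∧
        (∀ b c, Q p b (Complex.I • c) = -(Complex.I * Q p b c)) ∧
        (∀ a b c, fderiv ℝ Q p (a, 0) b c = fderiv ℝ Q p (b, 0) a c) ∧
        (∀ a b c, fderiv ℝ Q p (0, a) b c = fderiv ℝ Q p (0, c) b a) := by
  obtain ⟨Q, hQ, hQs, hQG⟩ := exists_polarization hG
  have hQG' := hQG.eventually_nhds
  have hGd : ∀ᶠ x in 𝓝 (0 : E), DifferentiableAt ℝ G x :=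
    hG.eventually_analyticAt.mono fun x hx => hx.differentiableAt
  have hQc : ∀ᶠ p in 𝓝 (0 : E × E), ContDiffAt ℝ 2 Q p :=
    hQ.eventually_analyticAt.mono fun x hx => hx.contDiffAt
  have hQs' : ∀ᶠ x in 𝓝 (0 : E), IsSesquiAt Q (x, x) :=
    ((continuous_id.prodMk continuous_id).tendsto' (0 : E) (0 : E × E) rfl).eventually hQs
  have hdiag : ∀ᶠ x in 𝓝 (0 : E), ∀ a b c,
      fderiv ℝ Q (x, x) (a, 0) b c =
        (fderiv ℝ G x a b c - Complex.I * fderiv ℝ G x (Complex.I • a) b c) / 2 ∧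
      fderiv ℝ Q (x, x) (0, a) b c =
        (fderiv ℝ G x a b c + Complex.I * fderiv ℝ G x (Complex.I • a) b c) / 2 := by
    filter_upwards [hQs', hQG', hGd] with x h1 h2 h3 a b c
    have h4 := fderiv_diagonal (h1.evalBilin b c) (g := fun y => G y b c)
      (h2.mono fun y hy => by simp only [hy]) a
    simpa only [fderiv_evalBilin h3, fderiv_evalBilin h1.differentiableAt] using h4
  have hder : ∀ᶠ p in 𝓝 (0 : E × E), ∀ (b c : E) (V : E × E),
      IsSesquiAt (fun q => fderiv ℝ Q q V b c) p := by
    filter_upwards [hQc, hQs.eventually_nhds] with p h1 h2 b c V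
    exact IsSesquiAt.fderiv_evalBilin h1 h2 b c V
  obtain ⟨r1, hr1, H1⟩ := Metric.eventually_nhds_iff_ball.1 (hQs.and hder)
  obtain ⟨r2, hr2, H2⟩ := Metric.eventually_nhds_iff_ball.1
    ((hl.and hr).and ((hz.and hw).and (hdiag.and hQG)))
  -- All four identities compare functions of the same sesquiholomorphic type, so it suffices to
  -- check them on the diagonal, where they are the hypotheses on `G`.
  have key : ∀ h : E × E → ℂ, (∀ p ∈ Metric.ball (0 : E × E) r1, IsSesquiAt h p) →
      (∀ z ∈ Metric.ball (0 : E) r2, h (z, z) = 0) →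
      ∀ p ∈ Metric.ball (0 : E × E) (min r1 r2), h p = 0 := by
    intro h h1 h2 p hp
    rw [show (0 : E × E) = (0, 0) from rfl, ← ball_prod_same] at hp
    refine IsSesquiAt.eq_zero_of_diagonal (h := h) (convex_ball (0 : E) (min r1 r2))
      Metric.isOpen_ball (fun q hq => ?_) (fun z hz => h2 z ?_) p hp
    · rw [ball_prod_same] at hq
      exact h1 q (Metric.ball_subset_ball (min_le_left _ _) hq)
    · exact Metric.ball_subset_ball (min_le_right _ _) hz
  refine ⟨Q, hQ, hQG, ?_⟩
  filter_upwards [Metric.ball_mem_nhds (0 : E × E) (lt_min hr1 hr2)] with p hp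
  refine ⟨fun b c => ?_, fun b c => ?_, fun a b c => ?_, fun a b c => ?_⟩
  · refine sub_eq_zero.1 (key (fun q => Q q (Complex.I • b) c - Complex.I * Q q b c)
      (fun q hq => ?_) (fun z hz => ?_) p hp)
    · exact ((H1 q hq).1.evalBilin _ _).sub (((H1 q hq).1.evalBilin _ _).smul _)
    · obtain ⟨⟨h1, h2⟩, ⟨h3, h4⟩, h5, h6⟩ := H2 z hz
      simp only [h6, h1, sub_self]
  · refine sub_eq_zero.1 (key (fun q => Q q b (Complex.I • c) - -(Complex.I * Q q b c))
      (fun q hq => ?_) (fun z hz => ?_) p hp)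
    · have := ((H1 q hq).1.evalBilin b c).smul (-Complex.I)
      simp only [neg_mul] at this
      exact ((H1 q hq).1.evalBilin _ _).sub this
    · obtain ⟨⟨h1, h2⟩, ⟨h3, h4⟩, h5, h6⟩ := H2 z hz
      simp only [h6, h2, sub_self]
  · refine sub_eq_zero.1 (key (fun q => fderiv ℝ Q q (a, 0) b c - fderiv ℝ Q q (b, 0) a c)
      (fun q hq => ?_) (fun z hz => ?_) p hp)
    · exact ((H1 q hq).2 _ _ _).sub ((H1 q hq).2 _ _ _)
    · obtain ⟨⟨h1, h2⟩, ⟨h3, h4⟩, h5, h6⟩ := H2 z hz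
      simp only [(h5 _ _ _).1, h3 a b c, sub_self]
  · refine sub_eq_zero.1 (key (fun q => fderiv ℝ Q q (0, a) b c - fderiv ℝ Q q (0, c) b a)
      (fun q hq => ?_) (fun z hz => ?_) p hp)
    · exact ((H1 q hq).2 _ _ _).sub ((H1 q hq).2 _ _ _)
    · obtain ⟨⟨h1, h2⟩, ⟨h3, h4⟩, h5, h6⟩ := H2 z hz
      simp only [(h5 _ _ _).2, h4 a b c, sub_self]

theorem fderiv_apply_apply {Z : Type*} [NormedAddCommGroup Z] [NormedSpace ℝ Z]
    {β : Z → E →L[ℝ] ℂ} {p : Z} (h : DifferentiableAt ℝ β p) (b : E) (V : Z) :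
    fderiv ℝ (fun q => β q b) p V = fderiv ℝ β p V b := by
  have : HasFDerivAt (fun q => β q b) ((ContinuousLinearMap.apply ℝ ℂ b) ∘L fderiv ℝ β p) p :=
    (ContinuousLinearMap.apply ℝ ℂ b).hasFDerivAt.comp p h.hasFDerivAt
  rw [this.fderiv]
  rfl

/-- Integration of a closed form of bidegree (1,1) on a product, in the second variable. -/
theorem exists_primitive_right [FiniteDimensional ℂ E] {Q : E × E → E →L[ℝ] E →L[ℝ] ℂ}
    (hQ : AnalyticAt ℝ Q 0)
    (hQ' : ∀ᶠ p in 𝓝 0,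
        (∀ b c, Q p (Complex.I • b) c = Complex.I * Q p b c) ∧
        (∀ b c, Q p b (Complex.I • c) = -(Complex.I * Q p b c)) ∧
        (∀ a b c, fderiv ℝ Q p (a, 0) b c = fderiv ℝ Q p (b, 0) a c) ∧
        (∀ a b c, fderiv ℝ Q p (0, a) b c = fderiv ℝ Q p (0, c) b a)) :
    ∃ β : E × E → E →L[ℝ] ℂ, AnalyticAt ℝ β 0 ∧ ∀ᶠ p in 𝓝 0,
      (∀ b c, fderiv ℝ β p (0, c) b = Q p b c) ∧
      (∀ b, β p (Complex.I • b) = Complex.I * β p b) ∧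
      (∀ a b, fderiv ℝ β p (a, 0) b = fderiv ℝ β p (b, 0) a) := by
  let fl : (E →L[ℝ] E →L[ℝ] ℂ) →L[ℝ] (E →L[ℝ] E →L[ℝ] ℂ) :=
    (ContinuousLinearMap.flipₗᵢ ℝ E E ℂ).toContinuousLinearEquiv.toContinuousLinearMap
  have hfl : ∀ T b c, fl T b c = T c b := fun T b c => rfl
  have hα : AnalyticAt ℝ (fun p => fl (Q p)) 0 := (fl.analyticAt _).comp hQ
  have hQd : ∀ᶠ p in 𝓝 (0 : E × E), DifferentiableAt ℝ Q p :=
    hQ.eventually_analyticAt.mono fun x hx => hx.differentiableAt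
  obtain ⟨β, hβ, hβ0, hβw⟩ := exists_partial_primitive hα (by
    filter_upwards [hQ', hQd] with p h1 h2 v w
    have h3 : HasFDerivAt (fun p => fl (Q p)) (fl ∘L fderiv ℝ Q p) p :=
      fl.hasFDerivAt.comp p h2.hasFDerivAt
    ext b
    rw [h3.fderiv]
    exact h1.2.2.2 v b w)
  have hβc : ∀ᶠ p in 𝓝 (0 : E × E), ContDiffAt ℝ 2 β p :=
    hβ.eventually_analyticAt.mono fun x hx => hx.contDiffAt
  obtain ⟨r, hr, H⟩ := Metric.eventually_nhds_iff_ball.1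
    ((hQ'.and hQd).and (hβc.and hβw.eventually_nhds))
  have hd : ∀ q ∈ Metric.ball (0 : E × E) r, DifferentiableAt ℝ β q := fun q hq =>
    (H q hq).2.1.differentiableAt (by simp)
  have h0 : ∀ z ∈ Metric.ball (0 : E) r, ∀ a, fderiv ℝ β (z, 0) (a, 0) = 0 := by
    intro z hz a
    have h1 : (z, (0 : E)) ∈ Metric.ball (0 : E × E) r := by
      simpa [Prod.norm_def] using hz
    have h2 := (hd _ h1).hasFDerivAt.comp z (hasFDerivAt_prodMk_left (𝕜 := ℝ) z (0 : E))
    have h3 : (β ∘ fun z => (z, (0 : E))) = fun _ => 0 := funext hβ0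
    rw [h3] at h2
    have := h2.unique (hasFDerivAt_const _ _)
    simpa using congrArg (fun T => T a) this
  have hw : ∀ q ∈ Metric.ball (0 : E × E) r, ∀ b c, fderiv ℝ β q (0, c) b = Q q b c := by
    intro q hq b c
    rw [(H q hq).2.2.self_of_nhds c, hfl]
  refine ⟨β, hβ, ?_⟩
  filter_upwards [Metric.ball_mem_nhds (0 : E × E) hr] with p hp
  refine ⟨hw p hp, fun b => ?_, fun a b => ?_⟩
  -- Linearity in `b`, and in the next bullet closedness in `z`, hold at `w = 0` because `β`
  -- vanishes there; their `w`-derivatives are the corresponding properties of `Q`.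
  · refine sub_eq_zero.1 (eq_zero_of_fderiv_right
      (h := fun q => β q (Complex.I • b) - Complex.I * β q b) (r := r)
      (fun q hq => ?_) (fun q hq c => ?_) (fun z _ => by simp [hβ0]) p hp)
    · exact ((hd q hq).clm_apply (differentiableAt_const _)).sub
        (((hd q hq).clm_apply (differentiableAt_const _)).const_mul _)
    · have e1 : DifferentiableAt ℝ (fun q => β q b) q :=
        (hd q hq).clm_apply (differentiableAt_const _)
      have e2 : DifferentiableAt ℝ (fun q => β q (Complex.I • b)) q :=
        (hd q hq).clm_apply (differentiableAt_const _)
      rw [fderiv_fun_sub e2 (e1.const_mul _), fderiv_const_mul e1, sub_apply, smul_apply,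
        fderiv_apply_apply (hd q hq), fderiv_apply_apply (hd q hq), hw q hq, hw q hq,
        (H q hq).1.1.1, smul_eq_mul, sub_self]
  · have hc2 : ∀ q ∈ Metric.ball (0 : E × E) r, ∀ a, DifferentiableAt ℝ
        (fun q => fderiv ℝ β q (a, 0)) q := fun q hq a =>
      (hasFDerivAt_fderiv_apply (H q hq).2.1 _).differentiableAt
    refine sub_eq_zero.1 (eq_zero_of_fderiv_right
      (h := fun q => fderiv ℝ β q (a, 0) b - fderiv ℝ β q (b, 0) a) (r := r)
      (fun q hq => ?_) (fun q hq c => ?_) (fun z hz => by simp [h0 z hz]) p hp)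
    · exact ((hc2 q hq a).clm_apply (differentiableAt_const _)).sub
        ((hc2 q hq b).clm_apply (differentiableAt_const _))
    · rw [fderiv_fun_sub ((hc2 q hq a).clm_apply (differentiableAt_const _))
        ((hc2 q hq b).clm_apply (differentiableAt_const _)), sub_apply,
        fderiv_apply_apply (hc2 q hq a), fderiv_apply_apply (hc2 q hq b)]
      have key : ∀ a b, fderiv ℝ (fun q => fderiv ℝ β q (a, 0)) q (0, c) b =
          fderiv ℝ Q q (a, 0) b c := by
        intro a b
        rw [fderiv_fderiv_apply_comm (H q hq).2.1 (k := fun q => fl (Q q) c)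
          ((H q hq).2.2.mono fun q' hq' => hq' c)]
        have h3 : HasFDerivAt (fun q => fl (Q q) c)
            (ContinuousLinearMap.apply ℝ (E →L[ℝ] ℂ) c ∘L (fl ∘L fderiv ℝ Q q)) q :=
          (ContinuousLinearMap.apply ℝ (E →L[ℝ] ℂ) c).hasFDerivAt.comp q
            (fl.hasFDerivAt.comp q (H q hq).1.2.hasFDerivAt)
        rw [h3.fderiv]
        rfl
      rw [key, key, (H q hq).1.1.2.2.1, sub_self]

theorem DifferentiableAt.comp_swap {F : Type*} [NormedAddCommGroup F] [NormedSpace ℝ F]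
    {β : E × E → F} {p : E × E} (h : DifferentiableAt ℝ β p.swap) :
    HasFDerivAt (fun q : E × E => β q.swap) (fderiv ℝ β p.swap ∘L
      ((ContinuousLinearMap.snd ℝ E E).prod (ContinuousLinearMap.fst ℝ E E))) p :=
  HasFDerivAt.comp p h.hasFDerivAt
    ((ContinuousLinearMap.snd ℝ E E).prod (ContinuousLinearMap.fst ℝ E E)).hasFDerivAt

/-- Integration of a closed form of bidegree (1,1) on a product, in both variables. -/
theorem exists_primitive [FiniteDimensional ℂ E] {Q : E × E → E →L[ℝ] E →L[ℝ] ℂ}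
    (hQ : AnalyticAt ℝ Q 0)
    (hQ' : ∀ᶠ p in 𝓝 0,
        (∀ b c, Q p (Complex.I • b) c = Complex.I * Q p b c) ∧
        (∀ b c, Q p b (Complex.I • c) = -(Complex.I * Q p b c)) ∧
        (∀ a b c, fderiv ℝ Q p (a, 0) b c = fderiv ℝ Q p (b, 0) a c) ∧
        (∀ a b c, fderiv ℝ Q p (0, a) b c = fderiv ℝ Q p (0, c) b a)) :
    ∃ P : E × E → ℂ, AnalyticAt ℝ P 0 ∧ ∀ᶠ p in 𝓝 0,
      IsSesquiAt P p ∧ ∀ b c, fderiv ℝ (fderiv ℝ P) p (b, 0) (0, c) = Q p b c := by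
  obtain ⟨β, hβ, hβ'⟩ := exists_primitive_right hQ hQ'
  have hswap : Tendsto (Prod.swap : E × E → E × E) (𝓝 0) (𝓝 0) :=
    continuous_swap.tendsto' _ _ rfl
  have hβd : ∀ᶠ p in 𝓝 (0 : E × E), DifferentiableAt ℝ β p :=
    hβ.eventually_analyticAt.mono fun x hx => hx.differentiableAt
  have hα : AnalyticAt ℝ (fun p : E × E => β p.swap) 0 :=
    AnalyticAt.comp (f := Prod.swap) hβ (analyticAt_snd.prod analyticAt_fst)
  -- The variables are exchanged, so that the primitive is taken in the holomorphic variable; `S`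
  -- takes the pair `(w, z)`.
  obtain ⟨S, hS, hS0, hSw⟩ := exists_partial_primitive hα (by
    filter_upwards [hswap.eventually hβ', hswap.eventually hβd] with p h1 h2 v w
    rw [(DifferentiableAt.comp_swap h2).fderiv]
    exact h1.2.2 v w)
  have hSc : ∀ᶠ p in 𝓝 (0 : E × E), ContDiffAt ℝ 2 S p :=
    hS.eventually_analyticAt.mono fun x hx => hx.contDiffAt
  obtain ⟨r, hr, H⟩ := Metric.eventually_nhds_iff_ball.1
    (((hswap.eventually hQ').and (hswap.eventually hβ')).and
      ((hswap.eventually hβd).and (hSc.and hSw.eventually_nhds)))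
  have hc2 : ∀ q ∈ Metric.ball (0 : E × E) r, ∀ U, DifferentiableAt ℝ
      (fun q => fderiv ℝ S q U) q := fun q hq U =>
    (hasFDerivAt_fderiv_apply (H q hq).2.2.1 _).differentiableAt
  have hmix : ∀ q ∈ Metric.ball (0 : E × E) r, ∀ a v,
      fderiv ℝ (fun q => fderiv ℝ S q (a, 0)) q (0, v) = Q q.swap v a := by
    intro q hq a v
    rw [fderiv_fderiv_apply_comm (H q hq).2.2.1 (k := fun q => β q.swap v)
      ((H q hq).2.2.2.mono fun q' hq' => hq' v)]
    have h1 := DifferentiableAt.comp_swap (H q hq).2.1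
    rw [fderiv_apply_apply h1.differentiableAt, h1.fderiv]
    exact (H q hq).1.2.1 v a
  have h0 : ∀ z ∈ Metric.ball (0 : E) r, ∀ a, fderiv ℝ S (z, 0) (a, 0) = 0 := by
    intro z hz a
    have h1 : (z, (0 : E)) ∈ Metric.ball (0 : E × E) r := by
      simpa [Prod.norm_def] using hz
    have h2 := ((H _ h1).2.2.1.differentiableAt (by simp)).hasFDerivAt.comp z
      (hasFDerivAt_prodMk_left (𝕜 := ℝ) z (0 : E))
    have h3 : (S ∘ fun z => (z, (0 : E))) = fun _ => 0 := funext hS0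
    rw [h3] at h2
    have := h2.unique (hasFDerivAt_const _ _)
    simpa using congrArg (fun T => T a) this
  -- Antiholomorphy in `w`: true on the slice `z = 0`, where `S` vanishes, and propagated in `z` by
  -- the antilinearity of `Q` in its second argument.
  have hleft : ∀ q ∈ Metric.ball (0 : E × E) r, ∀ a,
      fderiv ℝ S q (Complex.I • a, 0) = -(Complex.I * fderiv ℝ S q (a, 0)) := by
    intro q hq a
    refine eq_neg_of_add_eq_zero_left (eq_zero_of_fderiv_right
      (h := fun q => fderiv ℝ S q (Complex.I • a, 0) + Complex.I * fderiv ℝ S q (a, 0)) (r := r)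
      (fun q hq => ?_) (fun q hq c => ?_) (fun z hz => by simp [h0 z hz]) q hq)
    · exact (hc2 q hq _).add ((hc2 q hq _).const_mul _)
    · rw [fderiv_fun_add (hc2 q hq _) ((hc2 q hq _).const_mul _), fderiv_const_mul (hc2 q hq _),
        add_apply, smul_apply, hmix q hq, hmix q hq, (H q hq).1.1.2.1]
      simp
  have hswr : ∀ q ∈ Metric.ball (0 : E × E) r, q.swap ∈ Metric.ball (0 : E × E) r := by
    intro q hq
    simpa [Prod.norm_def, max_comm, and_comm] using hq
  let σ : E × E →L[ℝ] E × E :=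
    (ContinuousLinearMap.snd ℝ E E).prod (ContinuousLinearMap.fst ℝ E E)
  refine ⟨fun p => S p.swap, AnalyticAt.comp (f := Prod.swap) hS
    (analyticAt_snd.prod analyticAt_fst), ?_⟩
  filter_upwards [Metric.ball_mem_nhds (0 : E × E) hr] with p hp
  have hp' := hswr p hp
  have hd := DifferentiableAt.comp_swap ((H _ hp').2.2.1.differentiableAt (by simp))
  refine ⟨⟨hd.differentiableAt, fun v => ?_, fun v => ?_⟩, fun b c => ?_⟩
  · rw [hd.fderiv]
    have e1 := (H _ hp').2.2.2.self_of_nhds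
    change fderiv ℝ S p.swap (0, Complex.I • v) = Complex.I • fderiv ℝ S p.swap (0, v)
    rw [e1, e1, (H _ hp').1.2.2.1, smul_eq_mul]
  · rw [hd.fderiv]
    exact hleft _ hp' v
  · have e2 := snd_fderiv_comp_clm σ (ContinuousLinearMap.id ℝ ℂ) (h := S) (p := p)
      (H _ hp').2.2.1 (b, 0) (0, c)
    have e3 := hmix _ hp' c b
    rw [(hasFDerivAt_fderiv_apply (H _ hp').2.2.1 _).fderiv] at e3
    exact e2.trans e3

/-- Closedness of a (1,1)-form splits by type: the two conclusions are the vanishing of its `∂` and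
`∂̄` parts, for the Hermitian matrix of coefficients. -/
theorem hermitianPart_closed {Θ : E → E →L[ℝ] E →L[ℝ] ℝ} {x : E} (hd : DifferentiableAt ℝ Θ x)
    (hJ : ∀ᶠ y in 𝓝 x, ∀ v w, Θ y (Complex.I • v) (Complex.I • w) = Θ y v w)
    (hA : ∀ᶠ y in 𝓝 x, ∀ v w, Θ y v w = -Θ y w v)
    (hc : ∀ a b c, fderiv ℝ Θ x a b c + fderiv ℝ Θ x b c a + fderiv ℝ Θ x c a b = 0) (a b c : E) :
    (fderiv ℝ (fun y => hermitianPart (Θ y)) x a b c -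
        Complex.I * fderiv ℝ (fun y => hermitianPart (Θ y)) x (Complex.I • a) b c =
      fderiv ℝ (fun y => hermitianPart (Θ y)) x b a c -
        Complex.I * fderiv ℝ (fun y => hermitianPart (Θ y)) x (Complex.I • b) a c) ∧
    (fderiv ℝ (fun y => hermitianPart (Θ y)) x a b c +
        Complex.I * fderiv ℝ (fun y => hermitianPart (Θ y)) x (Complex.I • a) b c =
      fderiv ℝ (fun y => hermitianPart (Θ y)) x c b a +
        Complex.I * fderiv ℝ (fun y => hermitianPart (Θ y)) x (Complex.I • c) b a) := by
  have h1 : HasFDerivAt (fun y => hermitianPart (Θ y)) (hermitianPart ∘L fderiv ℝ Θ x) x :=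
    hermitianPart.hasFDerivAt.comp x hd.hasFDerivAt
  have hev : ∀ v w u, fderiv ℝ (fun y => Θ y v w) x u = fderiv ℝ Θ x u v w := by
    intro v w u
    have : HasFDerivAt (fun y => Θ y v w) ((ContinuousLinearMap.apply ℝ ℝ w ∘L
        ContinuousLinearMap.apply ℝ (E →L[ℝ] ℝ) v) ∘L fderiv ℝ Θ x) x :=
      (ContinuousLinearMap.apply ℝ ℝ w ∘L
        ContinuousLinearMap.apply ℝ (E →L[ℝ] ℝ) v).hasFDerivAt.comp x hd.hasFDerivAt
    rw [this.fderiv]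
    rfl
  set T := fderiv ℝ Θ x with hT
  have TJ : ∀ u v w, T u (Complex.I • v) (Complex.I • w) = T u v w := by
    intro u v w
    rw [← hev, ← hev]
    exact congrArg (fun L => L u) (Filter.EventuallyEq.fderiv_eq (𝕜 := ℝ)
      (hJ.mono fun y hy => hy v w))
  have TA : ∀ u v w, T u v w = -T u w v := by
    intro u v w
    rw [← hev, ← hev]
    have := congrArg (fun L => L u) (Filter.EventuallyEq.fderiv_eq (𝕜 := ℝ) (x := x)
      (hA.mono fun y hy => hy v w))
    simpa [fderiv_fun_neg] using this
  have hII : ∀ v : E, Complex.I • Complex.I • v = -v := fun v => by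
    rw [smul_smul, Complex.I_mul_I, neg_one_smul]
  have TJ' : ∀ u v w, T u (Complex.I • v) w = -T u v (Complex.I • w) := by
    intro u v w
    rw [← TJ u (Complex.I • v) w, hII]
    simp
  -- The type is separated by combining closedness on `(a, b, Ic)` with closedness on `(Ia, Ib,
  -- Ic)`; in `W1` the second triple is `(Ia, b, c)`.
  have R1 : ∀ a b c, T a b (Complex.I • c) - T (Complex.I • a) b c =
      T b a (Complex.I • c) - T (Complex.I • b) a c := by
    intro a b c
    have e1 := hc a b (Complex.I • c)
    have e2 := hc (Complex.I • a) (Complex.I • b) (Complex.I • c)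
    rw [TJ, TJ, TJ] at e2
    linarith [TA b a (Complex.I • c), TA (Complex.I • b) a c]
  have W1 : ∀ a b c, T a b (Complex.I • c) + T (Complex.I • a) b c =
      T c b (Complex.I • a) + T (Complex.I • c) b a := by
    intro a b c
    have e1 := hc a b (Complex.I • c)
    have e2 := hc (Complex.I • a) b c
    rw [TJ'] at e1
    linarith [TA (Complex.I • c) b a, TA c b (Complex.I • a)]
  have r1 := congrArg (fun t : ℝ => (t : ℂ)) (R1 a b c)
  have r2 := congrArg (fun t : ℝ => (t : ℂ)) (R1 a b (Complex.I • c))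
  have w1 := congrArg (fun t : ℝ => (t : ℂ)) (W1 a b c)
  have w2 := congrArg (fun t : ℝ => (t : ℂ)) (W1 a b (Complex.I • c))
  simp only [hII, map_neg, Complex.ofReal_sub, Complex.ofReal_add, Complex.ofReal_neg,
    neg_apply] at r1 r2 w1 w2
  rw [h1.fderiv]
  simp only [ContinuousLinearMap.comp_apply, hermitianPart_apply]
  constructor
  · linear_combination (1 / 2) * r1 + (Complex.I / 2) * r2 +
      (((T (Complex.I • a) b c : ℂ) - (T (Complex.I • b) a c : ℂ)) / 2) * Complex.I_sq
  · linear_combination (1 / 2) * w1 + (Complex.I / 2) * w2 -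
      (((T (Complex.I • a) b c : ℂ) - (T (Complex.I • c) b a : ℂ)) / 2) * Complex.I_sq

end Kahler

/-! ### The local `i∂∂̄`-lemma, with a polarization. -/

section Kahler

variable {E : Type*} [NormedAddCommGroup E] [NormedSpace ℂ E]

theorem levi_comp_sub (u : E → ℝ) (a x v w : E) :
    levi (fun z => u (z - a)) x v w = levi u (x - a) v w := by
  have : fderiv ℝ (fun z => u (z - a)) = fun z => fderiv ℝ u (z - a) := by
    ext1 z
    exact fderiv_comp_sub a
  simp only [levi, this, fderiv_comp_sub]

variable [FiniteDimensional ℂ E]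

/-- Polarize the Hermitian form attached to `Θ` and integrate twice. The potential is read on the
diagonal, and `levi_eq` returns `Θ` as minus twice the imaginary part of the mixed derivative. -/
theorem exists_isLocalPolarization_zero {Θ : E → E →L[ℝ] E →L[ℝ] ℝ} (hΘ : AnalyticAt ℝ Θ 0)
    (hJ : ∀ᶠ y in 𝓝 0, ∀ v w, Θ y (Complex.I • v) (Complex.I • w) = Θ y v w)
    (hA : ∀ᶠ y in 𝓝 0, ∀ v w, Θ y v w = -Θ y w v)
    (hc : ∀ᶠ y in 𝓝 0, ∀ a b c,
      fderiv ℝ Θ y a b c + fderiv ℝ Θ y b c a + fderiv ℝ Θ y c a b = 0) :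
    ∃ r > 0, ∃ (u : E → ℝ) (P : E × E → ℂ), IsLocalPolarization (Metric.ball 0 r) u P ∧
      ∀ x ∈ Metric.ball (0 : E) r, ∀ v w, levi u x v w = Θ x v w := by
  have hII : ∀ v : E, Complex.I • Complex.I • v = -v := fun v => by
    rw [smul_smul, Complex.I_mul_I, neg_one_smul]
  have hJ' : ∀ᶠ y in 𝓝 0, ∀ v w, Θ y (Complex.I • v) w = -Θ y v (Complex.I • w) := by
    filter_upwards [hJ] with y h v w
    rw [← h (Complex.I • v) w, hII]
    simp
  have hΘd : ∀ᶠ y in 𝓝 0, DifferentiableAt ℝ Θ y :=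
    hΘ.eventually_analyticAt.mono fun x hx => hx.differentiableAt
  obtain ⟨Q, hQ, hQG, hQ'⟩ := exists_polarization_closed (G := fun y => hermitianPart (Θ y))
    (AnalyticAt.comp (hermitianPart.analyticAt _) hΘ)
    (by
      filter_upwards [hJ, hJ'] with x h1 h2 b c
      simp only [hermitianPart_apply, h1, h2]
      push_cast
      linear_combination ((Θ x b c : ℂ) / 2) * Complex.I_sq)
    (by
      filter_upwards with x b c
      simp only [hermitianPart_apply, hII, map_neg]
      push_cast
      linear_combination (-(Θ x b c : ℂ) / 2) * Complex.I_sq)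
    (by
      filter_upwards [hΘd, hJ.eventually_nhds, hA.eventually_nhds, hc] with x h1 h2 h3 h4 a b c
      exact (hermitianPart_closed h1 h2 h3 h4 a b c).1)
    (by
      filter_upwards [hΘd, hJ.eventually_nhds, hA.eventually_nhds, hc] with x h1 h2 h3 h4 a b c
      exact (hermitianPart_closed h1 h2 h3 h4 a b c).2)
  obtain ⟨P₀, hP₀, hP₀'⟩ := exists_primitive hQ hQ'
  have hP₀a := hP₀.eventually_analyticAt
  obtain ⟨r1, hr1, H1⟩ := Metric.eventually_nhds_iff_ball.1 (hP₀'.and hP₀a)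
  obtain ⟨r2, hr2, H2⟩ := Metric.eventually_nhds_iff_ball.1 ((hQG.and hA).and (hJ.and hJ'))
  let r := min r1 r2
  have hr : 0 < r := lt_min hr1 hr2
  have hball : ∀ p ∈ Metric.ball (0 : E) r ×ˢ Metric.ball (0 : E) r,
      p ∈ Metric.ball (0 : E × E) r1 := by
    intro p hp
    rw [ball_prod_same] at hp
    exact Metric.ball_subset_ball (min_le_left _ _) hp
  -- Averaging with the conjugate of the exchanged function makes `P` real on the diagonal and keeps
  -- its type.
  let P : E × E → ℂ := fun p => (1 / 2 : ℂ) * (P₀ p + starRingEnd ℂ (P₀ p.swap))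
  let u : E → ℝ := fun z => (P (z, z)).re
  let σ : E × E →L[ℝ] E × E :=
    (ContinuousLinearMap.snd ℝ E E).prod (ContinuousLinearMap.fst ℝ E E)
  let half : ℂ →L[ℝ] ℂ := (1 / 2 : ℂ) • ContinuousLinearMap.id ℝ ℂ
  have hcd : ∀ p ∈ Metric.ball (0 : E) r ×ˢ Metric.ball (0 : E) r, ContDiffAt ℝ ω P₀ p :=
    fun p hp => (H1 p (hball p hp)).2.contDiffAt
  have hcd' : ∀ p ∈ Metric.ball (0 : E) r ×ˢ Metric.ball (0 : E) r,
      ContDiffAt ℝ ω (fun p => (Complex.conjCLE : ℂ →L[ℝ] ℂ) (P₀ (σ p))) p := fun p hp =>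
    (Complex.conjCLE : ℂ →L[ℝ] ℂ).contDiff.contDiffAt.comp p
      ((hcd p.swap ⟨hp.2, hp.1⟩).comp (f := σ) p σ.contDiff.contDiffAt)
  have hpol : IsLocalPolarization (Metric.ball (0 : E) r) u P := by
    refine ⟨fun p hp => ?_, fun p hp => ?_, fun z hz => ?_⟩
    · exact contDiffAt_const.mul ((hcd p hp).add (hcd' p hp))
    · exact (((H1 p (hball p hp)).1.1.add (IsSesquiAt.conj_swap
        (H1 p.swap (hball p.swap ⟨hp.2, hp.1⟩)).1.1))).smul (1 / 2)
    · simp only [u, P, Prod.swap_prod_mk]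
      apply Complex.ext <;> simp
  refine ⟨r, hr, u, P, hpol, fun x hx v w => ?_⟩
  have hxx : (x, x) ∈ Metric.ball (0 : E) r ×ˢ Metric.ball (0 : E) r := ⟨hx, hx⟩
  rw [hpol.levi_eq (convex_ball _ _) Metric.isOpen_ball hx]
  obtain ⟨⟨hQx, hAx⟩, hJx, hJx'⟩ := H2 x (Metric.ball_subset_ball (min_le_right _ _) hx)
  have h1 := (H1 (x, x) (hball _ hxx)).1.2
  have c1 : ContDiffAt ℝ 2 P₀ (x, x) := (hcd _ hxx).of_le le_top
  have c2 : ContDiffAt ℝ 2 (fun p => (Complex.conjCLE : ℂ →L[ℝ] ℂ) (P₀ (σ p))) (x, x) :=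
    (hcd' _ hxx).of_le le_top
  have h2 := snd_fderiv_comp_clm (ContinuousLinearMap.id ℝ (E × E)) half
    (h := fun p => P₀ p + (Complex.conjCLE : ℂ →L[ℝ] ℂ) (P₀ (σ p))) (p := (x, x))
    (c1.add c2) (v, 0) (0, w)
  have h3 := snd_fderiv_comp_clm σ (Complex.conjCLE : ℂ →L[ℝ] ℂ) (h := P₀) (p := (x, x))
    c1 (v, 0) (0, w)
  have h4 : IsLocalPolarization.mixed P x v w = (1 / 2 : ℂ) * (fderiv ℝ (fderiv ℝ P₀) (x, x) (v, 0) (0, w) +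
      starRingEnd ℂ (fderiv ℝ (fderiv ℝ P₀) (x, x) (0, v) (w, 0))) := by
    refine h2.trans ?_
    simp only [ContinuousLinearMap.id_apply]
    rw [snd_fderiv_add c1 c2, add_apply, add_apply, h3]
    rfl
  rw [h4, snd_fderiv_symm c1 (0, v), h1, h1, hQx]
  simp only [hermitianPart_apply]
  have e1 : Θ x w v = -Θ x v w := hAx w v
  have e2 : Θ x w (Complex.I • v) = Θ x v (Complex.I • w) := by
    rw [hAx, hJx', neg_neg]
  rw [e1, e2]
  have h5 : ∀ A B : ℂ, -2 * ((1 / 2 : ℂ) * (A + starRingEnd ℂ B)).im = B.im - A.im := by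
    intro A B
    simp
    ring
  rw [h5]
  simp
  ring

/-- Local existence of a potential with a polarization for a closed, real analytic (1,1)-form. -/
theorem exists_isLocalPolarization {Θ : E → E →L[ℝ] E →L[ℝ] ℝ} {a : E} (hΘ : AnalyticAt ℝ Θ a)
    (hJ : ∀ᶠ y in 𝓝 a, ∀ v w, Θ y (Complex.I • v) (Complex.I • w) = Θ y v w)
    (hA : ∀ᶠ y in 𝓝 a, ∀ v w, Θ y v w = -Θ y w v)
    (hc : ∀ᶠ y in 𝓝 a, ∀ e b c,
      fderiv ℝ Θ y e b c + fderiv ℝ Θ y b c e + fderiv ℝ Θ y c e b = 0) :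
    ∃ r > 0, ∃ (u : E → ℝ) (P : E × E → ℂ), IsLocalPolarization (Metric.ball a r) u P ∧
      ∀ x ∈ Metric.ball a r, ∀ v w, levi u x v w = Θ x v w := by
  have ht : Tendsto (fun z : E => z + a) (𝓝 0) (𝓝 a) :=
    (continuous_id.add continuous_const).tendsto' _ _ (zero_add a)
  obtain ⟨r, hr, u, P, hP, hu⟩ := exists_isLocalPolarization_zero (Θ := fun z => Θ (z + a))
    (AnalyticAt.comp (f := fun z => z + a) (by simpa using hΘ) (by fun_prop))
    (ht.eventually hJ) (ht.eventually hA) ((ht.eventually hc).mono fun y hy => by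
      simpa only [fderiv_comp_add_right] using hy)
  have hmem : ∀ z ∈ Metric.ball a r, z - a ∈ Metric.ball (0 : E) r := fun z hz => by
    simpa [dist_eq_norm] using hz
  refine ⟨r, hr, fun z => u (z - a), fun p => P (p.1 - a, p.2 - a), ⟨fun p hp => ?_, fun p hp => ?_,
    fun z hz => hP.diagonal _ (hmem z hz)⟩, fun x hx v w => ?_⟩
  · exact (hP.contDiffAt _ ⟨hmem _ hp.1, hmem _ hp.2⟩).comp (f := fun p : E × E => (p.1 - a, p.2 - a)) p
      (by fun_prop)
  · have h1 := hP.sesqui (p - (a, a)) ⟨hmem _ hp.1, hmem _ hp.2⟩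
    have h2 : fderiv ℝ (fun p : E × E => P (p - (a, a))) p = fderiv ℝ P (p - (a, a)) :=
      fderiv_comp_sub _
    refine ⟨(differentiableAt_comp_sub (a := (a, a))).2 h1.differentiableAt, ?_, ?_⟩
    · exact h2 ▸ h1.left
    · exact h2 ▸ h1.right
  · rw [levi_comp_sub, hu _ (hmem x hx), sub_add_cancel]

end Kahler

/-! ### Naturality of `i∂∂̄` under holomorphic maps. -/

section Levi

variable {E : Type*} [NormedAddCommGroup E] [NormedSpace ℂ E]

theorem levi_congr {u u' : E → ℝ} {x : E} (h : u =ᶠ[𝓝 x] u') (v w : E) :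
    levi u x v w = levi u' x v w := by
  have h1 : fderiv ℝ u =ᶠ[𝓝 x] fderiv ℝ u' := h.fderiv (𝕜 := ℝ)
  simp only [levi, h1.fderiv_eq]

/-- The form `i∂∂̄u` is natural under holomorphic maps. -/
theorem levi_comp {f : E → ℝ} {τ : E → E} {y : E} (hf : ContDiffAt ℝ 2 f (τ y))
    (hτ : ContDiffAt ℝ 2 τ y)
    (hτI : ∀ᶠ z in 𝓝 y, ∀ v, fderiv ℝ τ z (Complex.I • v) = Complex.I • fderiv ℝ τ z v) (v w : E) :
    levi (fun z => f (τ z)) y v w = levi f (τ y) (fderiv ℝ τ y v) (fderiv ℝ τ y w) := by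
  have h1 : fderiv ℝ (fun z => f (τ z)) =ᶠ[𝓝 y] fun z => (fderiv ℝ f (τ z)) ∘L fderiv ℝ τ z := by
    filter_upwards [hτ.eventually (by simp), hτ.continuousAt.eventually (hf.eventually (by simp))]
      with z h1 h2
    exact ((h2.differentiableAt (by simp)).hasFDerivAt.comp z
      (h1.differentiableAt (by simp)).hasFDerivAt).fderiv
  have hfd : HasFDerivAt (fderiv ℝ f) (fderiv ℝ (fderiv ℝ f) (τ y)) (τ y) :=
    ((hf.fderiv_right (m := 1) (by norm_num)).differentiableAt (by simp)).hasFDerivAt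
  have hτd : HasFDerivAt (fderiv ℝ τ) (fderiv ℝ (fderiv ℝ τ) y) y :=
    ((hτ.fderiv_right (m := 1) (by norm_num)).differentiableAt (by simp)).hasFDerivAt
  have h2 : ∀ a b, fderiv ℝ (fderiv ℝ (fun z => f (τ z))) y a b =
      fderiv ℝ (fderiv ℝ f) (τ y) (fderiv ℝ τ y a) (fderiv ℝ τ y b) +
      fderiv ℝ f (τ y) (fderiv ℝ (fderiv ℝ τ) y a b) := by
    intro a b
    have h3 := (hfd.comp y (hτ.differentiableAt (by simp)).hasFDerivAt).clm_comp hτd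
    have h4 : fderiv ℝ (fderiv ℝ (fun z => f (τ z))) y = _ := h1.fderiv_eq.trans h3.fderiv
    rw [h4]
    simp [add_comm]
  have h5 : ∀ a b, fderiv ℝ (fderiv ℝ τ) y a (Complex.I • b) =
      Complex.I • fderiv ℝ (fderiv ℝ τ) y a b := by
    intro a b
    have e1 := hasFDerivAt_fderiv_apply hτ b
    have e2 := hasFDerivAt_fderiv_apply hτ (Complex.I • b)
    have e3 : (fun z => fderiv ℝ τ z (Complex.I • b)) =ᶠ[𝓝 y]
        fun z => (Complex.I • ContinuousLinearMap.id ℝ E) (fderiv ℝ τ z b) :=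
      hτI.mono fun z hz => by simp [hz]
    have e4 : HasFDerivAt (fun z => (Complex.I • ContinuousLinearMap.id ℝ E) (fderiv ℝ τ z b)) _ y :=
      (Complex.I • ContinuousLinearMap.id ℝ E).hasFDerivAt.comp y e1
    have e5 := e2.unique (e4.congr_of_eventuallyEq e3)
    simpa using congrArg (fun T => T a) e5
  -- The second derivative of a holomorphic map is complex bilinear, so its contribution cancels
  -- between the two terms of `levi`.
  have h6 : fderiv ℝ (fderiv ℝ τ) y (Complex.I • v) w = fderiv ℝ (fderiv ℝ τ) y v (Complex.I • w) := by
    rw [snd_fderiv_symm hτ, h5, h5, snd_fderiv_symm hτ]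
  have h7 := hτI.self_of_nhds
  simp only [levi, h2, h6, h7]
  ring

end Levi

/-! ### Alternating 2-forms as bilinear forms. -/

section Bilinear

variable {E : Type*} [NormedAddCommGroup E] [NormedSpace ℝ E]

/-- The bilinear map underlying an alternating map in two variables. -/
def alternatingToBilin : (E [⋀^Fin 2]→L[ℝ] ℝ) →L[ℝ] (E →L[ℝ] E →L[ℝ] ℝ) :=
  (ContinuousLinearMap.compL ℝ E (ContinuousMultilinearMap ℝ (fun _ : Fin 1 => E) ℝ) (E →L[ℝ] ℝ)
    (continuousMultilinearCurryFin1 ℝ E ℝ).toContinuousLinearEquiv.toContinuousLinearMap) ∘L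
  (continuousMultilinearCurryLeftEquiv ℝ (fun _ : Fin 2 => E) ℝ
    ).toContinuousLinearEquiv.toContinuousLinearMap ∘L
  ContinuousAlternatingMap.toContinuousMultilinearMapCLM ℝ

theorem alternatingToBilin_apply (T : E [⋀^Fin 2]→L[ℝ] ℝ) (v w : E) :
    alternatingToBilin T v w = T ![v, w] := by
  have : (![v, w] : Fin 2 → E) = Fin.cons v (Fin.snoc 0 w) := by
    ext i
    fin_cases i <;> simp
  rw [this]
  rfl

theorem alternatingToBilin_closed {Ψ : E → E [⋀^Fin 2]→L[ℝ] ℝ} {y : E}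
    (hd : DifferentiableAt ℝ Ψ y) (hc : extDeriv Ψ y = 0) (a b c : E) :
    fderiv ℝ (fun z => alternatingToBilin (Ψ z)) y a b c +
      fderiv ℝ (fun z => alternatingToBilin (Ψ z)) y b c a +
      fderiv ℝ (fun z => alternatingToBilin (Ψ z)) y c a b = 0 := by
  have h1 : HasFDerivAt (fun z => alternatingToBilin (Ψ z)) (alternatingToBilin ∘L fderiv ℝ Ψ y) y :=
    alternatingToBilin.hasFDerivAt.comp y hd.hasFDerivAt
  have h2 : ∀ (m : Fin 2 → E) (v : E), fderiv ℝ (fun z => Ψ z m) y v = fderiv ℝ Ψ y v m := by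
    intro m v
    have : HasFDerivAt (fun z => Ψ z m)
        ((ContinuousAlternatingMap.apply ℝ E ℝ m) ∘L fderiv ℝ Ψ y) y :=
      (ContinuousAlternatingMap.apply ℝ E ℝ m).hasFDerivAt.comp y hd.hasFDerivAt
    rw [this.fderiv]
    rfl
  have h3 := congrArg (fun T => T ![a, b, c]) hc
  simp only [extDeriv_apply hd, h2] at h3
  erw [Fin.sum_univ_three] at h3
  have r0 : (0 : Fin 3).removeNth ![a, b, c] = ![b, c] := by
    ext i; fin_cases i <;> rfl
  have r1 : (1 : Fin 3).removeNth ![a, b, c] = ![a, c] := by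
    ext i; fin_cases i <;> rfl
  have r2 : (2 : Fin 3).removeNth ![a, b, c] = ![a, b] := by
    ext i; fin_cases i <;> rfl
  rw [r0, r1, r2] at h3
  have h4 : ∀ (T : E [⋀^Fin 2]→L[ℝ] ℝ) (v w : E), T ![v, w] = -T ![w, v] := by
    intro T v w
    have : T (![w, v] ∘ Equiv.swap 0 1) = -T ![w, v] :=
      T.toAlternatingMap.map_swap ![w, v] (i := 0) (j := 1) (by decide)
    rw [← this]
    congr 1
    ext i; fin_cases i <;> rfl
  rw [h1.fderiv]
  simp only [ContinuousLinearMap.comp_apply, alternatingToBilin_apply]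
  rw [h4 _ c a]
  simp at h3
  linarith

end Bilinear

/-! ### The underlying real manifold and the differentials of the charts. -/

section Manifold

variable {E : Type*} [NormedAddCommGroup E] [NormedSpace ℂ E]
  {M : Type*} [TopologicalSpace M] [ChartedSpace E M]

variable (E M) in
theorem isManifold_real [IsManifold 𝓘(ℂ, E) ω M] : IsManifold 𝓘(ℝ, E) ω M := by
  refine isManifold_of_contDiffOn _ _ _ fun e e' he he' => ?_
  have h := (contDiffGroupoid ω 𝓘(ℂ, E)).compatible he he'
  have h2 := (contMDiffOn_of_mem_contDiffGroupoid h).contDiffOn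
  simpa using h2.restrict_scalars ℝ

theorem HasMFDerivAt.restrictScalars_real {N F : Type*} [NormedAddCommGroup F] [NormedSpace ℂ F]
    [TopologicalSpace N] [ChartedSpace F N] {f : M → N} {x : M}
    {f' : TangentSpace 𝓘(ℂ, E) x →L[ℂ] TangentSpace 𝓘(ℂ, F) (f x)}
    (h : HasMFDerivAt 𝓘(ℂ, E) 𝓘(ℂ, F) f x f') :
    HasMFDerivAt 𝓘(ℝ, E) 𝓘(ℝ, F) f x ((f' : E →L[ℂ] F).restrictScalars ℝ : E →L[ℝ] F) :=
  ⟨h.1, by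
    have h1 : HasFDerivWithinAt (writtenInExtChartAt 𝓘(ℂ, E) 𝓘(ℂ, F) x f : E → F)
        (f' : E →L[ℂ] F) (range (𝓘(ℂ, E) : E → E)) (extChartAt 𝓘(ℂ, E) x x) := h.2
    exact HasFDerivWithinAt.restrictScalars ℝ h1⟩

/-- The differential of the inverse chart at `x`, as a map from the model space to the tangent space
(which is also the model space). -/
def symmDeriv (x : M) (y : E) : E →L[ℝ] E :=
  (mfderiv 𝓘(ℝ, E) 𝓘(ℝ, E) (chartAt E x).symm y : E →L[ℝ] E)

variable [IsManifold 𝓘(ℂ, E) ω M] {x : M} {y : E}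

theorem symmDeriv_I (hy : y ∈ (chartAt E x).target) (v : E) :
    symmDeriv x y (Complex.I • v) = Complex.I • symmDeriv x y v := by
  have : IsManifold 𝓘(ℂ, E) 1 M := .of_le (n := ω) le_top
  have h1 := (mdifferentiableAt_atlas_symm (I := 𝓘(ℂ, E)) (chart_mem_atlas E x) hy).hasMFDerivAt
  have h2 := HasMFDerivAt.restrictScalars_real h1
  have h3 : symmDeriv x y = _ := h2.mfderiv
  rw [h3]
  exact ContinuousLinearMap.map_smul (mfderiv 𝓘(ℂ, E) 𝓘(ℂ, E) (chartAt E x).symm y : E →L[ℂ] E)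
    Complex.I v

theorem hasMFDerivAt_symm (hy : y ∈ (chartAt E x).target) :
    HasMFDerivAt 𝓘(ℝ, E) 𝓘(ℝ, E) (chartAt E x).symm y (symmDeriv (E := E) x y) := by
  have : IsManifold 𝓘(ℝ, E) ω M := isManifold_real E M
  have : IsManifold 𝓘(ℝ, E) 1 M := .of_le (n := ω) le_top
  exact (mdifferentiableAt_atlas_symm (I := 𝓘(ℝ, E)) (chart_mem_atlas E x) hy).hasMFDerivAt

/-- Tangent vectors at a point are identified with vectors of `E` by the chart centred at that
point. So `symmDeriv x y` is the derivative at `y` of the transition into that chart; this links an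
arbitrary chart with `ddbar`. -/
theorem hasFDerivAt_transition (hy : y ∈ (chartAt E x).target) :
    HasFDerivAt (chartAt E ((chartAt E x).symm y) ∘ (chartAt E x).symm) (symmDeriv x y) y := by
  have h : HasFDerivWithinAt (chartAt E ((chartAt E x).symm y) ∘ (chartAt E x).symm ∘ id : E → E)
    (symmDeriv x y) (range (id : E → E)) y := (hasMFDerivAt_symm hy).2
  rwa [range_id, hasFDerivWithinAt_univ] at h

theorem injective_symmDeriv (hy : y ∈ (chartAt E x).target) :
    Function.Injective (symmDeriv x y) := by
  have : IsManifold 𝓘(ℝ, E) ω M := isManifold_real E M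
  have : IsManifold 𝓘(ℝ, E) 1 M := .of_le (n := ω) le_top
  have h2 := (mdifferentiableAt_atlas (I := 𝓘(ℝ, E)) (chart_mem_atlas E x)
    ((chartAt E x).map_target hy)).hasMFDerivAt
  have h3 := h2.comp y (hasMFDerivAt_symm hy)
  have h4 : HasMFDerivAt 𝓘(ℝ, E) 𝓘(ℝ, E) ((chartAt E x) ∘ (chartAt E x).symm) y
      (ContinuousLinearMap.id ℝ (TangentSpace 𝓘(ℝ, E) y)) := by
    refine (hasMFDerivAt_id y).congr_of_eventuallyEq ?_
    filter_upwards [(chartAt E x).open_target.mem_nhds hy] with z hz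
    exact (chartAt E x).right_inv hz
  have h5 := hasMFDerivAt_unique h3 h4
  refine Function.LeftInverse.injective (g := (mfderiv 𝓘(ℝ, E) 𝓘(ℝ, E) (chartAt E x)
    ((chartAt E x).symm y) : E →L[ℝ] E)) fun v => ?_
  exact congrArg (fun T => T v) h5

/-- The form `i∂∂̄u`, in an arbitrary chart. -/
theorem levi_inChart {u : M → ℝ} (hy : y ∈ (chartAt E x).target)
    (hu : ContDiffAt ℝ 2 (u ∘ (chartAt E ((chartAt E x).symm y)).symm)
      (chartAt E ((chartAt E x).symm y) ((chartAt E x).symm y))) (v w : E) :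
    levi (inChart x u) y v w =
      ddbar u ((chartAt E x).symm y) (symmDeriv x y v) (symmDeriv x y w) := by
  set p := (chartAt E x).symm y with hp
  let τ : E → E := chartAt E p ∘ (chartAt E x).symm
  have hR : IsManifold 𝓘(ℝ, E) ω M := isManifold_real E M
  have hyS : y ∈ ((chartAt E x).symm ≫ₕ chartAt E p).source := by
    simp [hy, ← hp, mem_chart_source]
  have hC : ∀ z ∈ ((chartAt E x).symm ≫ₕ chartAt E p).source, ContDiffAt ℂ ω τ z := by
    intro z hz
    have h := (contDiffGroupoid ω 𝓘(ℂ, E)).compatible (chart_mem_atlas E x) (chart_mem_atlas E p)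
    exact (contMDiffOn_of_mem_contDiffGroupoid h).contDiffOn.contDiffAt
      (((chartAt E x).symm ≫ₕ chartAt E p).open_source.mem_nhds hz)
  have h1 : inChart x u =ᶠ[𝓝 y] fun z => (u ∘ (chartAt E p).symm) (τ z) := by
    filter_upwards [((chartAt E x).symm ≫ₕ chartAt E p).open_source.mem_nhds hyS] with z hz
    have hz' : (chartAt E x).symm z ∈ (chartAt E p).source := by simpa using hz.2
    simp [inChart, τ, (chartAt E p).left_inv hz']
  have hτ : ContDiffAt ℝ 2 τ y := ((hC y hyS).restrict_scalars ℝ).of_le le_top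
  have hτI : ∀ᶠ z in 𝓝 y, ∀ v, fderiv ℝ τ z (Complex.I • v) = Complex.I • fderiv ℝ τ z v := by
    filter_upwards [((chartAt E x).symm ≫ₕ chartAt E p).open_source.mem_nhds hyS] with z hz v
    have h3 := ((hC z hz).differentiableAt (by simp)).fderiv_restrictScalars ℝ
    rw [h3]
    simp
  have hd : fderiv ℝ τ y = symmDeriv x y := (hasFDerivAt_transition hy).fderiv
  rw [levi_congr h1, levi_comp hu hτ hτI, hd]
  rfl

end Manifold

/-! ### Kähler form, potentials and polarizations read in charts. -/

section Manifold

variable {E : Type*} [NormedAddCommGroup E] [NormedSpace ℂ E]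
  {M : Type*} [TopologicalSpace M] [ChartedSpace E M]

/-- The form `Ω` in the chart at `x`, as a bilinear form. -/
def chartForm (Ω : TwoForm E M) (x : M) (y : E) : E →L[ℝ] E →L[ℝ] ℝ :=
  alternatingToBilin (formInChart Ω x y)

theorem chartForm_apply (Ω : TwoForm E M) (x : M) (y v w : E) :
    chartForm Ω x y v w = Ω ((chartAt E x).symm y)
      ![(symmDeriv x y v : E), (symmDeriv x y w : E)] := by
  rw [chartForm, alternatingToBilin_apply]
  refine congrArg (Ω ((chartAt E x).symm y)) ?_
  ext i
  fin_cases i <;> rfl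

theorem chartForm_neg (Ω : TwoForm E M) (x : M) (y v w : E) :
    chartForm Ω x y v w = -chartForm Ω x y w v := by
  rw [chartForm, alternatingToBilin_apply, alternatingToBilin_apply]
  have : formInChart Ω x y (![w, v] ∘ Equiv.swap 0 1) = -formInChart Ω x y ![w, v] :=
    (formInChart Ω x y).toAlternatingMap.map_swap ![w, v] (i := 0) (j := 1) (by decide)
  rw [← this]
  congr 1
  ext i; fin_cases i <;> rfl

variable {Ω : TwoForm E M} {x : M} {y : E}

theorem analyticAt_chartForm (hΩ : IsAnalyticKahlerForm Ω) (hy : y ∈ (chartAt E x).target) :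
    AnalyticAt ℝ (chartForm Ω x) y :=
  ((alternatingToBilin (E := E)).analyticAt (formInChart Ω x y)).comp (hΩ.analytic x y hy)

theorem chartForm_closed (hΩ : IsAnalyticKahlerForm Ω) (hy : y ∈ (chartAt E x).target) (a b c : E) :
    fderiv ℝ (chartForm Ω x) y a b c + fderiv ℝ (chartForm Ω x) y b c a +
      fderiv ℝ (chartForm Ω x) y c a b = 0 :=
  alternatingToBilin_closed (hΩ.analytic x y hy).differentiableAt (hΩ.closed x y hy) a b c

variable [IsManifold 𝓘(ℂ, E) ω M]

theorem chartForm_I (hΩ : IsAnalyticKahlerForm Ω) (hy : y ∈ (chartAt E x).target) (v w : E) :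
    chartForm Ω x y (Complex.I • v) (Complex.I • w) = chartForm Ω x y v w := by
  rw [chartForm_apply, chartForm_apply, symmDeriv_I hy, symmDeriv_I hy]
  exact hΩ.type_one_one _ _ _

theorem chartForm_pos (hΩ : IsAnalyticKahlerForm Ω) (hy : y ∈ (chartAt E x).target) {v : E}
    (hv : v ≠ 0) : 0 < chartForm Ω x y v (Complex.I • v) := by
  rw [chartForm_apply, symmDeriv_I hy]
  refine hΩ.pos _ _ fun h => hv ?_
  exact injective_symmDeriv hy (h.trans (map_zero _).symm)

theorem levi_inChart_of_isPotentialOn {u : M → ℝ} {W : Set M} (hu : IsPotentialOn Ω u W)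
    (hW : IsOpen W) (hy : y ∈ (chartAt E x).target) (hyW : (chartAt E x).symm y ∈ W) (v w : E) :
    levi (inChart x u) y v w = chartForm Ω x y v w := by
  have hR : IsManifold 𝓘(ℝ, E) ω M := isManifold_real E M
  rw [levi_inChart hy, chartForm_apply]
  · exact (hu.eq_ddbar _ hyW _ _).symm
  · set p := (chartAt E x).symm y
    have h1 : ContMDiffAt 𝓘(ℝ, E) 𝓘(ℝ, ℝ) ω u p := hu.analytic.contMDiffAt (hW.mem_nhds hyW)
    have h2 : ContMDiffAt 𝓘(ℝ, E) 𝓘(ℝ, E) ω (chartAt E p).symm (chartAt E p p) :=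
      (contMDiffOn_chart_symm (I := 𝓘(ℝ, E)) (n := ω)).contMDiffAt
        ((chartAt E p).open_target.mem_nhds (mem_chart_target E p))
    rw [← (chartAt E p).left_inv (mem_chart_source E p)] at h1
    exact (h1.comp _ h2).contDiffAt.of_le le_top

theorem mdifferentiableAt_chart_symm (hy : y ∈ (chartAt E x).target) :
    MDifferentiableAt 𝓘(ℂ, E) 𝓘(ℂ, E) (chartAt E x).symm y := by
  have : IsManifold 𝓘(ℂ, E) 1 M := .of_le (n := ω) le_top
  exact mdifferentiableAt_atlas_symm (chart_mem_atlas E x) hy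

/-- Joint real differentiability together with holomorphy in each variable separately gives the
infinitesimal relations, since the complex derivatives must be the partial derivatives. -/
theorem isLocalPolarization_inChart {u : M → ℝ} {P : M → M → ℂ} {W : Set M} {B : Set E}
    (hP : IsPolarizationOn E u P W) (hW : IsOpen W) (hB : B ⊆ (chartAt E x).target)
    (hBW : ∀ y ∈ B, (chartAt E x).symm y ∈ W) :
    IsLocalPolarization B (inChart x u)
      (fun p => P ((chartAt E x).symm p.1) ((chartAt E x).symm p.2)) := by
  have hR : IsManifold 𝓘(ℝ, E) ω M := isManifold_real E M
  have hcd : ∀ p ∈ B ×ˢ B, ContDiffAt ℝ ω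
      (fun p : E × E => P ((chartAt E x).symm p.1) ((chartAt E x).symm p.2)) p := by
    rintro ⟨a, b⟩ ⟨ha, hb⟩
    have h1 := hP.analytic.contMDiffAt ((hW.prod hW).mem_nhds (show ((chartAt E x).symm a,
      (chartAt E x).symm b) ∈ W ×ˢ W from ⟨hBW a ha, hBW b hb⟩))
    have h2 : ∀ c ∈ B, ContMDiffAt 𝓘(ℝ, E) 𝓘(ℝ, E) ω (chartAt E x).symm c := fun c hc =>
      (contMDiffOn_chart_symm (I := 𝓘(ℝ, E)) (n := ω)).contMDiffAt
        ((chartAt E x).open_target.mem_nhds (hB hc))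
    have h3 : ContMDiffAt 𝓘(ℝ, E × E) 𝓘(ℝ, E) ω (fun p : E × E => (chartAt E x).symm p.1) (a, b) :=
      (h2 a ha).comp (a, b) contDiffAt_fst.contMDiffAt
    have h4 : ContMDiffAt 𝓘(ℝ, E × E) 𝓘(ℝ, E) ω (fun p : E × E => (chartAt E x).symm p.2) (a, b) :=
      (h2 b hb).comp (a, b) contDiffAt_snd.contMDiffAt
    exact (ContMDiffAt.comp (a, b) h1 (h3.prodMk h4)).contDiffAt
  refine ⟨hcd, ?_, fun z hz => hP.diagonal _ (hBW z hz)⟩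
  rintro ⟨a, b⟩ hab
  have hd := (hcd _ hab).differentiableAt (by simp)
  have hl : DifferentiableAt ℂ (fun z => P ((chartAt E x).symm z) ((chartAt E x).symm b)) a := by
    have h1 := (hP.holomorphic_left _ (hBW b hab.2)).mdifferentiableAt
      (hW.mem_nhds (hBW a hab.1))
    exact (h1.comp a (mdifferentiableAt_chart_symm (hB hab.1))).differentiableAt
  have hr : DifferentiableAt ℂ
      (fun w => starRingEnd ℂ (P ((chartAt E x).symm a) ((chartAt E x).symm w))) b := by
    have h1 := (hP.antiholomorphic_right _ (hBW a hab.1)).mdifferentiableAt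
      (hW.mem_nhds (hBW b hab.2))
    exact (h1.comp b (mdifferentiableAt_chart_symm (hB hab.2))).differentiableAt
  refine ⟨hd, fun v => ?_, fun v => ?_⟩
  · have h1 : HasFDerivAt (fun z => P ((chartAt E x).symm z) ((chartAt E x).symm b)) _ a :=
      HasFDerivAt.comp (f := fun z => (z, b)) a hd.hasFDerivAt
        (hasFDerivAt_prodMk_left (𝕜 := ℝ) a b)
    have h2 := h1.unique (hl.hasFDerivAt.restrictScalars ℝ)
    have h3 := congrArg (fun T => T v) h2
    have h4 := congrArg (fun T => T (Complex.I • v)) h2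
    simp only [ContinuousLinearMap.comp_apply, ContinuousLinearMap.inl_apply,
      ContinuousLinearMap.coe_restrictScalars', map_smul] at h3 h4
    rw [h3, h4]
  · have h1 : HasFDerivAt
        (fun w => starRingEnd ℂ (P ((chartAt E x).symm a) ((chartAt E x).symm w))) _ b :=
      (Complex.conjCLE : ℂ →L[ℝ] ℂ).hasFDerivAt.comp b
        (HasFDerivAt.comp (f := fun w => (a, w)) b hd.hasFDerivAt
          (hasFDerivAt_prodMk_right (𝕜 := ℝ) a b))
    have h2 := h1.unique (hr.hasFDerivAt.restrictScalars ℝ)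
    have h3 := congrArg (fun T => T v) h2
    have h4 := congrArg (fun T => T (Complex.I • v)) h2
    simp only [ContinuousLinearMap.comp_apply, ContinuousLinearMap.inr_apply,
      ContinuousLinearMap.coe_restrictScalars', map_smul] at h3 h4
    rw [← h3] at h4
    have h5 := congrArg (starRingEnd ℂ) h4
    simpa using h5

/-- The equation is needed in the chart centred at each point, not in the chart at `x`; as
`symmDeriv` is surjective (injective in finite dimension), naturality of `i∂∂̄` transports it. -/
theorem isPotentialOn_of_isLocalPolarization {u : E → ℝ} {P : E × E → ℂ} {B : Set E}
    (hP : IsLocalPolarization B u P) (hBo : IsOpen B) (hB : B ⊆ (chartAt E x).target)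
    (hl : ∀ y ∈ B, ∀ v w, levi u y v w = chartForm Ω x y v w)
    [FiniteDimensional ℂ E] :
    IsPotentialOn Ω (fun p => u (chartAt E x p)) ((chartAt E x).source ∩ chartAt E x ⁻¹' B) := by
  have hR : IsManifold 𝓘(ℝ, E) ω M := isManifold_real E M
  have hcm : ∀ p ∈ (chartAt E x).source ∩ chartAt E x ⁻¹' B,
      ContMDiffAt 𝓘(ℝ, E) 𝓘(ℝ, ℝ) ω (fun p => u (chartAt E x p)) p := fun p hp =>
    ContMDiffAt.comp p (hP.contDiffAt_potential hBo hp.2).contMDiffAt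
      ((contMDiffOn_chart (I := 𝓘(ℝ, E)) (n := ω)).contMDiffAt
        ((chartAt E x).open_source.mem_nhds hp.1))
  refine ⟨fun p hp => (hcm p hp).contMDiffWithinAt, ?_⟩
  rintro p ⟨hps, hpB⟩ v w
  obtain ⟨y, hyB, rfl⟩ : ∃ y ∈ B, (chartAt E x).symm y = p :=
    ⟨chartAt E x p, hpB, (chartAt E x).left_inv hps⟩
  have hy := hB hyB
  have hsurj : Function.Surjective (symmDeriv x y) := by
    have : Function.Injective (symmDeriv x y : E →ₗ[ℝ] E) := injective_symmDeriv hy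
    exact LinearMap.injective_iff_surjective.1 this
  obtain ⟨v', rfl⟩ := hsurj v
  obtain ⟨w', rfl⟩ := hsurj w
  have h1 := chartForm_apply Ω x y v' w'
  rw [← hl y hyB] at h1
  rw [← h1]
  rw [← levi_inChart hy]
  · refine levi_congr ?_ v' w'
    filter_upwards [hBo.mem_nhds hyB] with z hz
    simp [inChart, (chartAt E x).right_inv (hB hz)]
  · set p := (chartAt E x).symm y
    have h1 := hcm p ⟨hps, hpB⟩
    have h2 : ContMDiffAt 𝓘(ℝ, E) 𝓘(ℝ, E) ω (chartAt E p).symm (chartAt E p p) :=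
      (contMDiffOn_chart_symm (I := 𝓘(ℝ, E)) (n := ω)).contMDiffAt
        ((chartAt E p).open_target.mem_nhds (mem_chart_target E p))
    rw [← (chartAt E p).left_inv (mem_chart_source E p)] at h1
    exact (h1.comp _ h2).contDiffAt.of_le le_top

theorem differentiableAt_complex_of_fderiv {F : Type*} [NormedAddCommGroup F] [NormedSpace ℂ F]
    {f : E → F} {a : E} (hd : DifferentiableAt ℝ f a)
    (hI : ∀ v, fderiv ℝ f a (Complex.I • v) = Complex.I • fderiv ℝ f a v) :
    DifferentiableAt ℂ f a := by
  let T : E →L[ℂ] F :=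
    { toFun := fderiv ℝ f a
      map_add' := map_add _
      map_smul' := fun c v => by
        rw [RingHom.id_apply, ← Complex.re_add_im c, add_smul, add_smul, map_add, mul_smul, mul_smul,
          ← smul_assoc, ← smul_assoc]
        simp [hI, mul_smul, Complex.coe_smul]
      cont := (fderiv ℝ f a).cont }
  exact (hasFDerivAt_of_restrictScalars ℝ (f' := T) hd.hasFDerivAt rfl).differentiableAt

theorem isPolarizationOn_of_isLocalPolarization {u : E → ℝ} {P : E × E → ℂ} {B : Set E}
    (hP : IsLocalPolarization B u P) :
    IsPolarizationOn E (fun p : M => u (chartAt E x p))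
      (fun p q : M => P (chartAt E x p, chartAt E x q))
      ((chartAt E x).source ∩ chartAt E x ⁻¹' B) := by
  have hR : IsManifold 𝓘(ℝ, E) ω M := isManifold_real E M
  have hC1 : IsManifold 𝓘(ℂ, E) 1 M := .of_le (n := ω) le_top
  have hm : ∀ p ∈ (chartAt E x).source, ContMDiffAt 𝓘(ℝ, E) 𝓘(ℝ, E) ω (chartAt E x) p := fun p hp =>
    (contMDiffOn_chart (I := 𝓘(ℝ, E)) (n := ω)).contMDiffAt
      ((chartAt E x).open_source.mem_nhds hp)
  refine ⟨?_, ?_, ?_, fun z hz => hP.diagonal _ hz.2⟩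
  · rintro ⟨p, q⟩ ⟨⟨hp, hpB⟩, ⟨hq, hqB⟩⟩
    have h1 := (hP.contDiffAt (chartAt E x p, chartAt E x q) ⟨hpB, hqB⟩).contMDiffAt
    have h2 : ContMDiffAt (𝓘(ℝ, E).prod 𝓘(ℝ, E)) 𝓘(ℝ, E) ω
        (fun z : M × M => chartAt E x z.1) (p, q) :=
      ContMDiffAt.comp (p, q) (hm p hp) contMDiffAt_fst
    have h3 : ContMDiffAt (𝓘(ℝ, E).prod 𝓘(ℝ, E)) 𝓘(ℝ, E) ω
        (fun z : M × M => chartAt E x z.2) (p, q) :=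
      ContMDiffAt.comp (p, q) (hm q hq) contMDiffAt_snd
    exact (ContMDiffAt.comp (p, q) h1 (h2.prodMk_space h3)).contMDiffWithinAt
  · rintro q ⟨hq, hqB⟩ p ⟨hp, hpB⟩
    have hs := hP.sesqui (chartAt E x p, chartAt E x q) ⟨hpB, hqB⟩
    have h1 : HasFDerivAt (fun z => P (z, chartAt E x q)) _ (chartAt E x p) :=
      HasFDerivAt.comp (f := fun z => (z, chartAt E x q)) _ hs.differentiableAt.hasFDerivAt
        (hasFDerivAt_prodMk_left (𝕜 := ℝ) (chartAt E x p) (chartAt E x q))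
    have h2 : DifferentiableAt ℂ (fun z => P (z, chartAt E x q)) (chartAt E x p) := by
      refine differentiableAt_complex_of_fderiv h1.differentiableAt fun v => ?_
      rw [h1.fderiv]
      exact hs.left v
    exact (h2.mdifferentiableAt.comp p
      (mdifferentiableAt_atlas (chart_mem_atlas E x) hp)).mdifferentiableWithinAt
  · rintro p ⟨hp, hpB⟩ q ⟨hq, hqB⟩
    have hs := hP.sesqui (chartAt E x p, chartAt E x q) ⟨hpB, hqB⟩
    have h1 : HasFDerivAt (fun w => starRingEnd ℂ (P (chartAt E x p, w))) _ (chartAt E x q) :=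
      (Complex.conjCLE : ℂ →L[ℝ] ℂ).hasFDerivAt.comp _ (HasFDerivAt.comp
        (f := fun w => (chartAt E x p, w)) _ hs.differentiableAt.hasFDerivAt
        (hasFDerivAt_prodMk_right (𝕜 := ℝ) (chartAt E x p) (chartAt E x q)))
    have h2 : DifferentiableAt ℂ (fun w => starRingEnd ℂ (P (chartAt E x p, w)))
        (chartAt E x q) := by
      refine differentiableAt_complex_of_fderiv h1.differentiableAt fun v => ?_
      rw [h1.fderiv]
      simp [hs.right]
    exact (h2.mdifferentiableAt.comp q
      (mdifferentiableAt_atlas (chart_mem_atlas E x) hq)).mdifferentiableWithinAt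

/-- Every point has a neighbourhood on which the form has a potential with a polarization. -/
theorem exists_isLocalPolarization_chart [FiniteDimensional ℂ E] (hΩ : IsAnalyticKahlerForm Ω)
    (hy : y ∈ (chartAt E x).target) :
    ∃ r > 0, Metric.ball y r ⊆ (chartAt E x).target ∧ ∃ (u : E → ℝ) (P : E × E → ℂ),
      IsLocalPolarization (Metric.ball y r) u P ∧
      ∀ z ∈ Metric.ball y r, ∀ v w, levi u z v w = chartForm Ω x z v w := by
  have ht := (chartAt E x).open_target.mem_nhds hy
  obtain ⟨r, hr, u, P, hP, hu⟩ := exists_isLocalPolarization (analyticAt_chartForm hΩ hy)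
    (by filter_upwards [ht] with z hz using chartForm_I hΩ hz)
    (Eventually.of_forall fun z => chartForm_neg Ω x z)
    (by filter_upwards [ht] with z hz using chartForm_closed hΩ hz)
  obtain ⟨r', hr', hr''⟩ := Metric.mem_nhds_iff.1 ht
  have hb : Metric.ball y (min r r') ⊆ Metric.ball y r := Metric.ball_subset_ball (min_le_left _ _)
  exact ⟨min r r', lt_min hr hr', (Metric.ball_subset_ball (min_le_right _ _)).trans hr'', u, P,
    ⟨fun p hp => hP.contDiffAt p ⟨hb hp.1, hb hp.2⟩, fun p hp => hP.sesqui p ⟨hb hp.1, hb hp.2⟩,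
      fun z hz => hP.diagonal z (hb hz)⟩, fun z hz => hu z (hb hz)⟩

end Manifold

/-! ### Comparison of the Kähler distance with the norm of a chart. -/

section Distance

open MeasureTheory

variable {E : Type*} [NormedAddCommGroup E] [NormedSpace ℂ E]
  {M : Type*} [TopologicalSpace M] [ChartedSpace E M]

theorem bilin_smul_I_smul (T : E →L[ℝ] E →L[ℝ] ℝ) (c : ℝ) (v : E) :
    T (c • v) (Complex.I • c • v) = c ^ 2 * T v (Complex.I • v) := by
  have : Complex.I • c • v = c • Complex.I • v := smul_comm _ _ _
  rw [this, (T (c • v)).map_smul, T.map_smul, smul_apply, smul_eq_mul, smul_eq_mul]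
  ring

/-- The square of the length of a tangent vector. -/
def kahlerSq (Ω : TwoForm E M) (p : M) (v : E) : ℝ :=
  Ω p ![(v : TangentSpace 𝓘(ℝ, E) p), J p v]

theorem kahlerSq_smul (Ω : TwoForm E M) (p : M) (c : ℝ) (v : E) :
    kahlerSq Ω p (c • v) = c ^ 2 * kahlerSq Ω p v := by
  have h : ∀ v : E, kahlerSq Ω p v =
      alternatingToBilin (Ω p : E [⋀^Fin 2]→L[ℝ] ℝ) v (Complex.I • v) := fun v =>
    (alternatingToBilin_apply (E := E) _ _ _).symm
  rw [h, h]
  exact bilin_smul_I_smul _ c v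

/-- The length of a tangent vector. -/
@[reducible] def kahlerENorm (Ω : TwoForm E M) (p : M) : ENorm (TangentSpace 𝓘(ℝ, E) p) :=
  ⟨fun v => ENNReal.ofReal (Real.sqrt (kahlerSq Ω p v))⟩

theorem kahlerENorm_smulClass (Ω : TwoForm E M) (p : M) :
    @ENormSMulClass ℝ (TangentSpace 𝓘(ℝ, E) p) _ (kahlerENorm Ω p) _ := by
  let _ := kahlerENorm Ω
  refine ⟨fun c v => ?_⟩
  have h : kahlerSq Ω p (c • v : TangentSpace 𝓘(ℝ, E) p) = c ^ 2 * kahlerSq Ω p v :=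
    kahlerSq_smul Ω p c v
  refine (congrArg (fun s => ENNReal.ofReal (Real.sqrt s)) h).trans ?_
  change _ = ‖c‖ₑ * ENNReal.ofReal (Real.sqrt (kahlerSq Ω p v))
  rw [Real.sqrt_mul (sq_nonneg c), Real.sqrt_sq_eq_abs,
    ENNReal.ofReal_mul (abs_nonneg c), ← Real.norm_eq_abs, ofReal_norm]

theorem kahlerEDist_eq (Ω : TwoForm E M) (p q : M) :
    kahlerEDist Ω p q =
      @Manifold.riemannianEDist E _ _ E _ 𝓘(ℝ, E) M _ _ (kahlerENorm Ω) p q := rfl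

variable [IsManifold 𝓘(ℂ, E) ω M] {Ω : TwoForm E M} {x : M}

theorem chartForm_I_eq_kahlerSq {y : E} (hy : y ∈ (chartAt E x).target) (v : E) :
    chartForm Ω x y v (Complex.I • v) = kahlerSq Ω ((chartAt E x).symm y) (symmDeriv x y v) := by
  rw [chartForm_apply, symmDeriv_I hy]
  rfl

/-- Extrema over the compact product of `K` with the unit sphere, extended by homogeneity. -/
theorem exists_chartForm_bounds [FiniteDimensional ℂ E] (hΩ : IsAnalyticKahlerForm Ω) {K : Set E}
    (hK : IsCompact K) (hKt : K ⊆ (chartAt E x).target) :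
    ∃ c C : ℝ, 0 < c ∧ 0 < C ∧ ∀ y ∈ K, ∀ v : E,
      c ^ 2 * ‖v‖ ^ 2 ≤ chartForm Ω x y v (Complex.I • v) ∧
      chartForm Ω x y v (Complex.I • v) ≤ C ^ 2 * ‖v‖ ^ 2 := by
  have hcont : ContinuousOn (fun p : E × E => chartForm Ω x p.1 p.2 (Complex.I • p.2))
      (K ×ˢ Metric.sphere 0 1) := by
    rintro ⟨y, v⟩ ⟨hy, hv⟩
    have h1 : ContinuousAt (fun p : E × E => chartForm Ω x p.1) (y, v) :=
      ContinuousAt.comp (f := Prod.fst) (analyticAt_chartForm hΩ (hKt hy)).continuousAt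
        continuousAt_fst
    exact ((h1.clm_apply continuousAt_snd).clm_apply
      (continuousAt_snd.const_smul _)).continuousWithinAt
  have hcomp : IsCompact (K ×ˢ Metric.sphere (0 : E) 1) := hK.prod (isCompact_sphere _ _)
  have hpos : ∀ p ∈ K ×ˢ Metric.sphere (0 : E) 1,
      0 < chartForm Ω x p.1 p.2 (Complex.I • p.2) := fun p hp =>
    chartForm_pos hΩ (hKt hp.1) (ne_zero_of_mem_unit_sphere ⟨p.2, hp.2⟩)
  obtain ⟨a, b, ha, hb, hab⟩ : ∃ a b : ℝ, 0 < a ∧ 0 < b ∧ ∀ p ∈ K ×ˢ Metric.sphere (0 : E) 1,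
      a ≤ chartForm Ω x p.1 p.2 (Complex.I • p.2) ∧
      chartForm Ω x p.1 p.2 (Complex.I • p.2) ≤ b := by
    rcases (K ×ˢ Metric.sphere (0 : E) 1).eq_empty_or_nonempty with h | h
    · exact ⟨1, 1, one_pos, one_pos, fun p hp => by simp [h] at hp⟩
    · obtain ⟨p, hp, hp'⟩ := hcomp.exists_isMinOn h hcont
      obtain ⟨q, hq, hq'⟩ := hcomp.exists_isMaxOn h hcont
      exact ⟨_, _, hpos p hp, hpos q hq, fun z hz => ⟨hp' hz, hq' hz⟩⟩
  refine ⟨Real.sqrt a, Real.sqrt b, Real.sqrt_pos.2 ha, Real.sqrt_pos.2 hb, fun y hy v => ?_⟩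
  rw [Real.sq_sqrt ha.le, Real.sq_sqrt hb.le]
  rcases eq_or_ne v 0 with rfl | hv
  · simp
  have hn : 0 < ‖v‖ := norm_pos_iff.2 hv
  have h1 := hab (y, ‖v‖⁻¹ • v) ⟨hy, by simp [norm_smul, hn.ne']⟩
  have h2 : chartForm Ω x y v (Complex.I • v) =
      ‖v‖ ^ 2 * chartForm Ω x y (‖v‖⁻¹ • v) (Complex.I • ‖v‖⁻¹ • v) := by
    rw [bilin_smul_I_smul]
    field_simp
  rw [h2]
  constructor <;> nlinarith [h1.1, h1.2, sq_nonneg ‖v‖]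

theorem kahlerSq_mfderiv {γ : ℝ → M} {t : ℝ} (hγ : MDifferentiableAt 𝓘(ℝ, ℝ) 𝓘(ℝ, E) γ t)
    (hs : γ t ∈ (chartAt E x).source) :
    DifferentiableAt ℝ (fun s => chartAt E x (γ s)) t ∧
    kahlerSq Ω (γ t) (mfderiv 𝓘(ℝ, ℝ) 𝓘(ℝ, E) γ t (1 : ℝ)) =
      chartForm Ω x (chartAt E x (γ t)) (deriv (fun s => chartAt E x (γ s)) t)
        (Complex.I • deriv (fun s => chartAt E x (γ s)) t) := by
  have hR : IsManifold 𝓘(ℝ, E) ω M := isManifold_real E M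
  have hR1 : IsManifold 𝓘(ℝ, E) 1 M := .of_le (n := ω) le_top
  have hf : MDifferentiableAt 𝓘(ℝ, ℝ) 𝓘(ℝ, E) (fun s => chartAt E x (γ s)) t :=
    (mdifferentiableAt_atlas (I := 𝓘(ℝ, E)) (chart_mem_atlas E x) hs).comp t hγ
  have hfd := hf.differentiableAt
  refine ⟨hfd, ?_⟩
  have ht : chartAt E x (γ t) ∈ (chartAt E x).target := (chartAt E x).map_source hs
  have h1 : HasMFDerivAt 𝓘(ℝ, ℝ) 𝓘(ℝ, E) ((chartAt E x).symm ∘ fun s => chartAt E x (γ s)) t _ :=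
    (hasMFDerivAt_symm ht).comp t hfd.hasFDerivAt.hasMFDerivAt
  have h2 : γ =ᶠ[𝓝 t] (chartAt E x).symm ∘ fun s => chartAt E x (γ s) := by
    filter_upwards [hγ.continuousAt.preimage_mem_nhds
      ((chartAt E x).open_source.mem_nhds hs)] with s hs'
    exact ((chartAt E x).left_inv hs').symm
  have h3 := (h1.congr_of_eventuallyEq h2).mfderiv
  rw [chartForm_I_eq_kahlerSq ht]
  have h4 : (mfderiv 𝓘(ℝ, ℝ) 𝓘(ℝ, E) γ t (1 : ℝ) : E) =
      symmDeriv x (chartAt E x (γ t)) (deriv (fun s => chartAt E x (γ s)) t) :=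
    congrArg (fun T : ℝ →L[ℝ] E => T 1) h3
  rw [← h4, (chartAt E x).left_inv hs]

/-- The straight segment in the chart is a competing path, of speed at most `C * ‖y₂ - y₁‖`. -/
theorem kahlerEDist_le {K : Set E} (hK : Convex ℝ K) (hKt : K ⊆ (chartAt E x).target) {C : ℝ}
    (hC : 0 ≤ C) (hb : ∀ y ∈ K, ∀ v : E, chartForm Ω x y v (Complex.I • v) ≤ C ^ 2 * ‖v‖ ^ 2)
    {y₁ y₂ : E} (h₁ : y₁ ∈ K) (h₂ : y₂ ∈ K) :
    kahlerEDist Ω ((chartAt E x).symm y₁) ((chartAt E x).symm y₂) ≤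
      ENNReal.ofReal (C * ‖y₂ - y₁‖) := by
  have hR : IsManifold 𝓘(ℝ, E) ω M := isManifold_real E M
  let _ := kahlerENorm Ω
  have _ := kahlerENorm_smulClass Ω
  let η : ℝ → E := fun t => y₁ + t • (y₂ - y₁)
  have hη : ∀ t, HasDerivAt η (y₂ - y₁) t := fun t => by
    have h := ((hasDerivAt_id t).smul_const (y₂ - y₁)).const_add y₁
    rw [one_smul] at h
    exact h
  have hηK : ∀ t ∈ Icc (0 : ℝ) 1, η t ∈ K := fun t ht => by
    have := hK.add_smul_sub_mem h₁ h₂ ht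
    exact this
  let γ : ℝ → M := fun t => (chartAt E x).symm (η t)
  have hγ : ∀ t ∈ Icc (0 : ℝ) 1, ContMDiffAt 𝓘(ℝ, ℝ) 𝓘(ℝ, E) 1 γ t := fun t ht => by
    have h1 : ContMDiffAt 𝓘(ℝ, E) 𝓘(ℝ, E) 1 (chartAt E x).symm (η t) :=
      ((contMDiffOn_chart_symm (I := 𝓘(ℝ, E)) (n := ω)).contMDiffAt
        ((chartAt E x).open_target.mem_nhds (hKt (hηK t ht)))).of_le le_top
    have h2 : ContDiffAt ℝ 1 η t := by
      simp only [η]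
      fun_prop
    exact h1.comp t h2.contMDiffAt
  have h3 : Manifold.riemannianEDist 𝓘(ℝ, E) ((chartAt E x).symm y₁) ((chartAt E x).symm y₂) ≤
      Manifold.pathELength 𝓘(ℝ, E) γ 0 1 :=
    Manifold.riemannianEDist_le_pathELength (fun t ht => (hγ t ht).contMDiffWithinAt)
      (by simp [γ, η]) (by simp [γ, η]) zero_le_one
  rw [kahlerEDist_eq]
  refine h3.trans ?_
  rw [Manifold.pathELength_eq_lintegral_mfderiv_Icc]
  have h4 : ∀ t ∈ Icc (0 : ℝ) 1, ‖mfderiv 𝓘(ℝ, ℝ) 𝓘(ℝ, E) γ t (1 : ℝ)‖ₑ ≤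
      ENNReal.ofReal (C * ‖y₂ - y₁‖) := by
    intro t ht
    have hmem : η t ∈ (chartAt E x).target := hKt (hηK t ht)
    have h5 := (kahlerSq_mfderiv (Ω := Ω) (x := x) ((hγ t ht).mdifferentiableAt (by simp))
      ((chartAt E x).map_target hmem)).2
    have h6 : (fun s => chartAt E x (γ s)) =ᶠ[𝓝 t] η := by
      filter_upwards [(hη t).continuousAt.preimage_mem_nhds
        ((chartAt E x).open_target.mem_nhds hmem)] with s hs
      exact (chartAt E x).right_inv hs
    have h7 : chartAt E x (γ t) = η t := h6.self_of_nhds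
    have h8 := h5.trans (by rw [h6.deriv_eq, (hη t).deriv, h7])
    refine (congrArg (fun s => ENNReal.ofReal (Real.sqrt s)) h8).trans_le ?_
    refine ENNReal.ofReal_le_ofReal (Real.sqrt_le_iff.2 ⟨by positivity, ?_⟩)
    rw [mul_pow]
    exact hb _ (hηK t ht) _
  calc _ ≤ ∫⁻ _t in Icc (0 : ℝ) 1, ENNReal.ofReal (C * ‖y₂ - y₁‖) :=
        setLIntegral_mono measurable_const h4
    _ = _ := by simp

/-- A path of length less than `c * r` from the centre moves by less than `r` in the chart as long
as it stays in the ball, so it cannot leave it. -/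
theorem exists_of_kahlerEDist_lt [FiniteDimensional ℂ E] [T2Space M] {y₁ : E} {r c : ℝ}
    (hr : 0 < r) (hc : 0 < c) (hB : Metric.ball y₁ r ⊆ (chartAt E x).target)
    (hb : ∀ y ∈ Metric.ball y₁ r, ∀ v : E, c ^ 2 * ‖v‖ ^ 2 ≤ chartForm Ω x y v (Complex.I • v))
    {q : M} (hq : kahlerEDist Ω ((chartAt E x).symm y₁) q < ENNReal.ofReal (c * r)) :
    ∃ y₂ ∈ Metric.ball y₁ r, (chartAt E x).symm y₂ = q := by
  have hR : IsManifold 𝓘(ℝ, E) ω M := isManifold_real E M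
  let _ := kahlerENorm Ω
  have _ := kahlerENorm_smulClass Ω
  rw [kahlerEDist_eq] at hq
  obtain ⟨γ, h0, h1, hγ, hlen⟩ := Manifold.exists_lt_of_riemannianEDist_lt hq
  set φ := chartAt E x with hφ
  set R := (Manifold.pathELength 𝓘(ℝ, E) γ 0 1).toReal with hRdef
  have hfin : Manifold.pathELength 𝓘(ℝ, E) γ 0 1 ≠ ⊤ := hlen.ne_top
  have hRr : R < c * r := by
    rw [hRdef]
    exact (ENNReal.lt_ofReal_iff_toReal_lt hfin).1 hlen
  have hRc : R / c < r := by
    rw [div_lt_iff₀ hc]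
    linarith
  let U : Set M := φ.source ∩ φ ⁻¹' Metric.ball y₁ r
  have hU : IsOpen U := φ.isOpen_inter_preimage Metric.isOpen_ball
  have hy₁ : y₁ ∈ φ.target := hB (Metric.mem_ball_self hr)
  by_contra hcon
  have hqU : q ∉ U := fun h => hcon ⟨φ q, h.2, φ.left_inv h.1⟩
  have hγc : ContinuousOn γ (Icc 0 1) := hγ.continuousOn
  have hS : IsCompact (Icc (0 : ℝ) 1 ∩ γ ⁻¹' Uᶜ) :=
    isCompact_Icc.of_isClosed_subset (hγc.preimage_isClosed_of_isClosed isClosed_Icc hU.isClosed_compl)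
      inter_subset_left
  -- The first exit time from the chart ball.
  obtain ⟨T, ⟨hT, hTU⟩, hTmin⟩ := hS.exists_isLeast
    ⟨1, right_mem_Icc.2 zero_le_one, by simpa [h1] using hqU⟩
  have hlt : ∀ t, 0 ≤ t → t < T → γ t ∈ U := by
    intro t ht htT
    by_contra h
    exact absurd (hTmin ⟨⟨ht, htT.le.trans hT.2⟩, h⟩) (not_le.2 htT)
  have hT0 : 0 < T := by
    rcases hT.1.eq_or_lt with h | h
    · exfalso
      apply hTU
      rw [← h, h0]
      exact ⟨φ.map_target hy₁, by
        rw [mem_preimage, φ.right_inv hy₁]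
        exact Metric.mem_ball_self hr⟩
    · exact h
  have hbound : ∀ t, 0 ≤ t → t < T → φ (γ t) ∈ Metric.closedBall y₁ (R / c) := by
    intro t ht htT
    have hsub : Icc 0 t ⊆ Icc (0 : ℝ) 1 := Icc_subset_Icc le_rfl (htT.le.trans hT.2)
    have hf : ContDiffOn ℝ 1 (fun s => φ (γ s)) (Icc 0 t) := by
      have h2 : ContMDiffOn 𝓘(ℝ, E) 𝓘(ℝ, E) 1 φ φ.source :=
        (contMDiffOn_chart (I := 𝓘(ℝ, E)) (n := ω)).of_le le_top
      exact (h2.comp (hγ.mono hsub) fun s hs => (hlt s hs.1 (hs.2.trans_lt htT)).1).contDiffOn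
    have h3 := enorm_sub_le_lintegral_derivWithin_Icc_of_contDiffOn_Icc hf ht
    have h4 : ENNReal.ofReal c * ‖φ (γ t) - φ (γ 0)‖ₑ ≤ Manifold.pathELength 𝓘(ℝ, E) γ 0 1 := by
      refine (mul_le_mul_right h3 _).trans ?_
      rw [← lintegral_const_mul' _ _ ENNReal.ofReal_ne_top,
        Manifold.pathELength_eq_lintegral_mfderiv_Icc, ← restrict_Ioo_eq_restrict_Icc]
      refine le_trans (lintegral_mono_ae ?_)
        (lintegral_mono_set (Ioo_subset_Icc_self.trans hsub))
      refine (ae_restrict_iff' measurableSet_Ioo).2 (Eventually.of_forall fun s hs => ?_)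
      have hsU := hlt s hs.1.le (hs.2.trans htT)
      have hmd : MDifferentiableAt 𝓘(ℝ, ℝ) 𝓘(ℝ, E) γ s :=
        ((hγ s (hsub ⟨hs.1.le, hs.2.le⟩)).contMDiffAt
          (Icc_mem_nhds hs.1 (hs.2.trans (htT.trans_le hT.2)))).mdifferentiableAt (by simp)
      have h5 := (kahlerSq_mfderiv (Ω := Ω) (x := x) hmd hsU.1).2
      rw [derivWithin_of_mem_nhds (Icc_mem_nhds hs.1 hs.2)]
      refine le_of_le_of_eq ?_ (congrArg (fun s => ENNReal.ofReal (Real.sqrt s)) h5).symm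
      rw [← ofReal_norm, ← ENNReal.ofReal_mul hc.le]
      refine ENNReal.ofReal_le_ofReal (Real.le_sqrt_of_sq_le ?_)
      rw [mul_pow]
      exact hb _ hsU.2 _
    rw [h0, φ.right_inv hy₁, ← ofReal_norm, ← ENNReal.ofReal_mul hc.le,
      ENNReal.ofReal_le_iff_le_toReal hfin, ← hRdef] at h4
    rw [Metric.mem_closedBall, dist_eq_norm, le_div_iff₀ hc]
    linarith
  -- Before `T` the path stays in a smaller closed ball, whose image is compact, hence closed as `M`
  -- is Hausdorff. So `γ T` is still inside, against the choice of `T`.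
  have hF : IsClosed (φ.symm '' Metric.closedBall y₁ (R / c)) := by
    refine ((isCompact_closedBall _ _).image_of_continuousOn ?_).isClosed
    exact φ.continuousOn_symm.mono ((Metric.closedBall_subset_ball hRc).trans hB)
  have hTF : γ T ∈ φ.symm '' Metric.closedBall y₁ (R / c) := by
    have h2 : Tendsto γ (𝓝[Ico 0 T] T) (𝓝 (γ T)) :=
      (hγc T hT).mono_left (nhdsWithin_mono _ fun s hs => ⟨hs.1, hs.2.le.trans hT.2⟩)
    have h3 : (𝓝[Ico 0 T] T).NeBot := by
      rw [← mem_closure_iff_nhdsWithin_neBot, closure_Ico hT0.ne]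
      exact right_mem_Icc.2 hT0.le
    refine hF.mem_of_tendsto h2 (eventually_mem_nhdsWithin.mono fun s hs => ?_)
    exact ⟨φ (γ s), hbound s hs.1 hs.2, φ.left_inv (hlt s hs.1 hs.2).1⟩
  apply hTU
  obtain ⟨z, hz, hz'⟩ := hTF
  have hzr := Metric.closedBall_subset_ball hRc hz
  rw [← hz']
  exact ⟨φ.map_target (hB hzr), by rwa [mem_preimage, φ.right_inv (hB hzr)]⟩

/-- A Lebesgue number argument: by compactness of `M` every neighbourhood of the diagonal contains a
uniform one for the Kähler distance. -/
theorem exists_kahlerEDist_lt_imp [FiniteDimensional ℂ E] [T2Space M] [CompactSpace M]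
    (hΩ : IsAnalyticKahlerForm Ω) {O : Set (M × M)} (hO : IsOpen O) (hd : ∀ p, (p, p) ∈ O) :
    ∃ δ : ℝ, 0 < δ ∧ ∀ p q, kahlerEDist Ω p q < ENNReal.ofReal δ → (p, q) ∈ O := by
  have key := (isCompact_univ (X := M)).induction_on
    (p := fun s => ∃ δ : ℝ, 0 < δ ∧ ∀ p ∈ s, ∀ q, kahlerEDist Ω p q < ENNReal.ofReal δ →
      (p, q) ∈ O) ⟨1, one_pos, fun p hp => hp.elim⟩
    (fun s t hst ⟨δ, hδ, h⟩ => ⟨δ, hδ, fun p hp => h p (hst hp)⟩)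
    (fun s t ⟨δ, hδ, h⟩ ⟨δ', hδ', h'⟩ => ⟨min δ δ', lt_min hδ hδ', fun p hp q hq => by
      rcases hp with hp | hp
      · exact h p hp q (hq.trans_le (ENNReal.ofReal_le_ofReal (min_le_left _ _)))
      · exact h' p hp q (hq.trans_le (ENNReal.ofReal_le_ofReal (min_le_right _ _)))⟩) ?_
  · obtain ⟨δ, hδ, h⟩ := key
    exact ⟨δ, hδ, fun p => h p (mem_univ p)⟩
  · intro x _
    let φ := chartAt E x
    have hx : φ x ∈ φ.target := mem_chart_target E x
    have h1 : ContinuousAt (fun z : E × E => (φ.symm z.1, φ.symm z.2)) (φ x, φ x) :=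
      ContinuousAt.prodMk
        (ContinuousAt.comp (f := Prod.fst) (φ.continuousAt_symm hx) continuousAt_fst)
        (ContinuousAt.comp (f := Prod.snd) (φ.continuousAt_symm hx) continuousAt_snd)
    have h2 : ∀ᶠ z : E × E in 𝓝 (φ x, φ x), (φ.symm z.1, φ.symm z.2) ∈ O :=
      h1.preimage_mem_nhds (hO.mem_nhds (by simpa [φ] using hd x))
    obtain ⟨r₁, hr₁, H₁⟩ := Metric.eventually_nhds_iff_ball.1 h2
    obtain ⟨r₂, hr₂, H₂⟩ := Metric.mem_nhds_iff.1 (φ.open_target.mem_nhds hx)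
    let r := min r₁ r₂ / 3
    have hr : 0 < r := div_pos (lt_min hr₁ hr₂) three_pos
    have hK1 : Metric.closedBall (φ x) (2 * r) ⊆ Metric.ball (φ x) r₁ :=
      Metric.closedBall_subset_ball (by have := min_le_left r₁ r₂; simp only [r]; linarith)
    have hK2 : Metric.closedBall (φ x) (2 * r) ⊆ φ.target :=
      (Metric.closedBall_subset_ball
        (by have := min_le_right r₁ r₂; simp only [r]; linarith)).trans H₂
    obtain ⟨c, C, hc, -, hcb⟩ := exists_chartForm_bounds hΩ (isCompact_closedBall (φ x) (2 * r)) hK2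
    refine ⟨φ.source ∩ φ ⁻¹' Metric.ball (φ x) r, mem_nhdsWithin_of_mem_nhds
      ((φ.isOpen_inter_preimage Metric.isOpen_ball).mem_nhds
        ⟨mem_chart_source E x, Metric.mem_ball_self hr⟩), c * r, mul_pos hc hr, ?_⟩
    rintro p ⟨hp, hpb⟩ q hq
    have hsub : Metric.ball (φ p) r ⊆ Metric.closedBall (φ x) (2 * r) := by
      intro z hz
      rw [Metric.mem_closedBall]
      have := Metric.mem_ball.1 hpb
      have := Metric.mem_ball.1 hz
      linarith [dist_triangle z (φ p) (φ x)]
    rw [← φ.left_inv hp] at hq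
    obtain ⟨y₂, hy₂, rfl⟩ := exists_of_kahlerEDist_lt hr hc (hsub.trans hK2)
      (fun y hy v => (hcb y (hsub hy) v).1) hq
    have := H₁ (φ p, y₂) (by
      rw [← ball_prod_same]
      exact ⟨hK1 (hsub (Metric.mem_ball_self hr)), hK1 (hsub hy₂)⟩)
    rwa [φ.left_inv hp] at this

end Distance

/-! ### Second order Taylor bounds on segments. -/

section Convexity

variable {Z : Type*} [NormedAddCommGroup Z] [NormedSpace ℝ Z]

theorem hasDerivAt_fderiv_segment {g : Z → ℝ} {a v w : Z} {t : ℝ} (h : ContDiffAt ℝ 2 g (a + t • v)) :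
    HasDerivAt (fun s : ℝ => fderiv ℝ g (a + s • v) w)
      (fderiv ℝ (fderiv ℝ g) (a + t • v) v w) t := by
  have h1 : HasDerivAt (fun s : ℝ => a + s • v) v t := by
    have h := ((hasDerivAt_id t).smul_const v).const_add a
    rw [one_smul] at h
    exact h
  exact (hasFDerivAt_fderiv_apply h w).comp_hasDerivAt t h1

theorem hasDerivAt_segment {g : Z → ℝ} {a v : Z} {t : ℝ} (h : DifferentiableAt ℝ g (a + t • v)) :
    HasDerivAt (fun s : ℝ => g (a + s • v)) (fderiv ℝ g (a + t • v) v) t := by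
  have h1 : HasDerivAt (fun s : ℝ => a + s • v) v t := by
    have h := ((hasDerivAt_id t).smul_const v).const_add a
    rw [one_smul] at h
    exact h
  exact h.hasFDerivAt.comp_hasDerivAt t h1

theorem monotoneOn_Icc_of_hasDerivAt {h h' : ℝ → ℝ}
    (hd : ∀ t ∈ Icc (0 : ℝ) 1, HasDerivAt h (h' t) t) (h0 : ∀ t ∈ Icc (0 : ℝ) 1, 0 ≤ h' t) :
    MonotoneOn h (Icc 0 1) := by
  refine monotoneOn_of_deriv_nonneg (convex_Icc 0 1)
    (fun t ht => (hd t ht).continuousAt.continuousWithinAt)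
    (fun t ht => (hd t (interior_subset ht)).differentiableAt.differentiableWithinAt) fun t ht => ?_
  rw [(hd t (interior_subset ht)).deriv]
  exact h0 t (interior_subset ht)

/-- A lower bound of the second derivative on a segment gives a quadratic lower bound. -/
theorem segment_lower_bound {g : Z → ℝ} {a v : Z} {m : ℝ}
    (hg : ∀ t ∈ Icc (0 : ℝ) 1, ContDiffAt ℝ 2 g (a + t • v))
    (hm : ∀ t ∈ Icc (0 : ℝ) 1, m ≤ fderiv ℝ (fderiv ℝ g) (a + t • v) v v) :
    g a + fderiv ℝ g a v + m / 2 ≤ g (a + v) := by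
  have h1 : MonotoneOn (fun s : ℝ => fderiv ℝ g (a + s • v) v - m * s) (Icc 0 1) :=
    monotoneOn_Icc_of_hasDerivAt (fun t ht => (hasDerivAt_fderiv_segment (hg t ht)).sub
      ((hasDerivAt_id t).const_mul m)) fun t ht => by simpa using hm t ht
  have h2 : MonotoneOn (fun s : ℝ => g (a + s • v) - (fderiv ℝ g a v * s + m * (s ^ 2 / 2)))
      (Icc 0 1) := by
    refine monotoneOn_Icc_of_hasDerivAt (h' := fun t => fderiv ℝ g (a + t • v) v -
      (fderiv ℝ g a v + m * t)) (fun t ht => ?_) fun t ht => ?_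
    · refine (hasDerivAt_segment ((hg t ht).differentiableAt (by simp))).sub ?_
      have e1 := (hasDerivAt_id t).const_mul (fderiv ℝ g a v)
      have e2 := ((hasDerivAt_pow 2 t).div_const 2).const_mul m
      refine (e1.add e2).congr_deriv ?_
      simp
    · have := h1 (left_mem_Icc.2 zero_le_one) ht ht.1
      simp only [zero_smul, add_zero, mul_zero, sub_zero] at this
      linarith
  have := h2 (left_mem_Icc.2 zero_le_one) (right_mem_Icc.2 zero_le_one) zero_le_one
  simp at this
  linarith

end Convexity

/-! ### Differentiating a continuous solution of an implicit equation. -/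

section Implicit

open Asymptotics

variable {Z P W : Type*} [NormedAddCommGroup Z] [NormedSpace ℝ Z] [NormedAddCommGroup P]
  [NormedSpace ℝ P] [NormedAddCommGroup W] [NormedSpace ℝ W]

/-- The derivative of a continuous solution of an implicit equation. -/
theorem hasFDerivAt_of_implicit {F : Z × P → W} {g : P → Z} {p₀ : P} {F' : Z × P →L[ℝ] W}
    {S : W →L[ℝ] Z} (hF : HasFDerivAt F F' (g p₀, p₀)) (hg : ContinuousAt g p₀)
    (h0 : ∀ᶠ p in 𝓝 p₀, F (g p, p) = 0) (hS : ∀ v, S (F' (v, 0)) = v) :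
    HasFDerivAt g (-(S ∘L F' ∘L ContinuousLinearMap.inr ℝ Z P)) p₀ := by
  have ht : Tendsto (fun p => (g p, p)) (𝓝 p₀) (𝓝 (g p₀, p₀)) := hg.prodMk continuousAt_id
  have h1 := hF.isLittleO.comp_tendsto ht
  have h2 : (fun p => F' (g p - g p₀, p - p₀)) =o[𝓝 p₀] fun p => (g p - g p₀, p - p₀) := by
    refine (h1.neg_left).congr' ?_ (Eventually.of_forall fun p => rfl)
    filter_upwards [h0] with p hp
    simp [hp, h0.self_of_nhds, -map_sub]
  have h3 : (fun p => g p - g p₀ + S (F' (0, p - p₀))) =o[𝓝 p₀]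
      fun p => (g p - g p₀, p - p₀) := by
    refine ((S.isBigO_comp _ _).trans_isLittleO h2).congr_left fun p => ?_
    have : ((g p - g p₀, p - p₀) : Z × P) = (g p - g p₀, 0) + (0, p - p₀) := by simp
    rw [this, map_add, map_add, hS]
  -- The little-o, with constant `1/2`, contributes a term `‖g p - g p₀‖ / 2`, which is absorbed on
  -- the left.
  have h4 : (fun p => g p - g p₀) =O[𝓝 p₀] fun p => p - p₀ := by
    refine IsBigO.of_bound (2 * (‖S ∘L F' ∘L ContinuousLinearMap.inr ℝ Z P‖ + 1)) ?_
    filter_upwards [h3.bound (show (0 : ℝ) < 1 / 2 by norm_num)] with p hp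
    have e1 : ‖S (F' (0, p - p₀))‖ ≤ ‖S ∘L F' ∘L ContinuousLinearMap.inr ℝ Z P‖ * ‖p - p₀‖ :=
      (S ∘L F' ∘L ContinuousLinearMap.inr ℝ Z P).le_opNorm (p - p₀)
    have e2 : ‖g p - g p₀‖ ≤ ‖g p - g p₀ + S (F' (0, p - p₀))‖ + ‖S (F' (0, p - p₀))‖ := by
      simpa using norm_sub_le (g p - g p₀ + S (F' (0, p - p₀))) (S (F' (0, p - p₀)))
    have e3 : ‖((g p - g p₀, p - p₀) : Z × P)‖ ≤ ‖g p - g p₀‖ + ‖p - p₀‖ :=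
      max_le (le_add_of_nonneg_right (norm_nonneg _)) (le_add_of_nonneg_left (norm_nonneg _))
    nlinarith [norm_nonneg (p - p₀)]
  refine HasFDerivAt.of_isLittleO ?_
  refine (h3.trans_isBigO (h4.prod_left (isBigO_refl _ _))).congr_left fun p => ?_
  simp

end Implicit

/-! ### Invertibility of positive definite bilinear forms. -/

section Inverse

variable {E : Type*} [NormedAddCommGroup E] [NormedSpace ℝ E] [FiniteDimensional ℝ E]

theorem exists_equiv_of_pos {A : E →L[ℝ] E →L[ℝ] ℝ} (hA : ∀ v, v ≠ 0 → 0 < A v v) :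
    ∃ e : E ≃L[ℝ] (E →L[ℝ] ℝ), (e : E →L[ℝ] E →L[ℝ] ℝ) = A := by
  have hinj : Function.Injective (A : E →ₗ[ℝ] E →L[ℝ] ℝ) := by
    refine (injective_iff_map_eq_zero _).2 fun v hv => ?_
    by_contra h
    have h1 := hA v h
    have h2 : A v = 0 := hv
    simp [h2] at h1
  have hfr : Module.finrank ℝ E = Module.finrank ℝ (E →L[ℝ] ℝ) := by
    rw [← Subspace.dual_finrank_eq (K := ℝ) (V := E)]
    exact LinearEquiv.finrank_eq (LinearMap.toContinuousLinearMap (𝕜 := ℝ) (E := E) (F' := ℝ))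
  refine ⟨(LinearEquiv.ofInjectiveOfFinrankEq (A : E →ₗ[ℝ] E →L[ℝ] ℝ) hinj
    hfr).toContinuousLinearEquiv, ?_⟩
  ext v w
  rfl

end Inverse

/-! ### Continuity of a unique minimizer. -/

section ArgMin

variable {X Z : Type*} [TopologicalSpace X] [TopologicalSpace Z]

/-- Continuous dependence on parameters of the unique minimizer over a compact set. -/
theorem continuousAt_argmin {K : Set Z} (hK : IsCompact K) {f : X → Z → ℝ} {g : X → Z} {a : X}
    (hf : ∀ z ∈ K, ContinuousAt (fun p : X × Z => f p.1 p.2) (a, z))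
    (hgK : ∀ᶠ b in 𝓝 a, g b ∈ K) (hmin : ∀ᶠ b in 𝓝 a, ∀ z ∈ K, f b (g b) ≤ f b z)
    (huniq : ∀ z ∈ K, z ≠ g a → f a (g a) < f a z) : ContinuousAt g a := by
  have hga : g a ∈ K := hgK.self_of_nhds
  refine fun O hO => ?_
  obtain ⟨O', hO'O, hO'o, hgO'⟩ := mem_nhds_iff.1 hO
  have hK' : IsCompact (K \ O') := hK.diff hO'o
  have h1 : ∀ᶠ b in 𝓝 a, ∀ z ∈ K \ O', f b (g a) < f b z := by
    refine hK'.eventually_forall_of_forall_eventually fun z hz => ?_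
    have hne : z ≠ g a := fun h => hz.2 (h ▸ hgO')
    have e1 : ContinuousAt (fun p : X × Z => f p.1 (g a)) (a, z) :=
      ContinuousAt.comp (f := fun p : X × Z => (p.1, g a)) (x := (a, z)) (hf (g a) hga)
        (continuousAt_fst.prodMk continuousAt_const)
    exact e1.eventually_lt (hf z hz.1) (huniq z hz.1 hne)
  have h4 : ∀ᶠ b in 𝓝 a, g b ∈ O := by
    filter_upwards [h1, hgK, hmin] with b h1 h2 h3
    by_contra h
    exact absurd (h3 _ hga) (not_le.2 (h1 (g b) ⟨h2, fun h' => h (hO'O h')⟩))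
  exact h4

end ArgMin

/-! ### Jets of critical points and of critical values. -/

section LocalTransform

variable {E X : Type*} [NormedAddCommGroup E] [NormedSpace ℝ E]
  [TopologicalSpace X] {F : E × E → ℝ} {e : X → E → ℝ} {g : X → E → E} {a : X} {y : E}

/-- Restriction of a bilinear form on a product to the first factor, in the second variable. -/
def bilinInl : ((E × E) →L[ℝ] (E × E) →L[ℝ] ℝ) →L[ℝ] ((E × E) →L[ℝ] E →L[ℝ] ℝ) :=
  ContinuousLinearMap.compL ℝ (E × E) ((E × E) →L[ℝ] ℝ) (E →L[ℝ] ℝ)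
    ((ContinuousLinearMap.compL ℝ E (E × E) ℝ).flip (ContinuousLinearMap.inl ℝ E E))

/-- The Hessian in `z` of the function `F (z, y) + e z`. -/
def totalHessian (F : E × E → ℝ) (e : E → ℝ) (z y : E) : E →L[ℝ] E →L[ℝ] ℝ :=
  bilinInl (fderiv ℝ (fderiv ℝ F) (z, y)) ∘L ContinuousLinearMap.inl ℝ E E +
    fderiv ℝ (fderiv ℝ e) z

theorem totalHessian_apply (F : E × E → ℝ) (e : E → ℝ) (z y v w : E) :
    totalHessian F e z y v w =
      fderiv ℝ (fderiv ℝ F) (z, y) (v, 0) (w, 0) + fderiv ℝ (fderiv ℝ e) z v w := rfl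

theorem hasFDerivAt_criticalEquation {f : E → ℝ} {z : E} (hF : ContDiffAt ℝ 2 F (z, y))
    (he : ContDiffAt ℝ 2 f z) :
    HasFDerivAt (fun p : E × E => fderiv ℝ F p ∘L ContinuousLinearMap.inl ℝ E E + fderiv ℝ f p.1)
      (bilinInl (fderiv ℝ (fderiv ℝ F) (z, y)) +
        fderiv ℝ (fderiv ℝ f) z ∘L ContinuousLinearMap.fst ℝ E E) (z, y) := by
  have h1 : HasFDerivAt (fderiv ℝ F) (fderiv ℝ (fderiv ℝ F) (z, y)) (z, y) :=
    ((hF.fderiv_right (m := 1) (by norm_num)).differentiableAt (by simp)).hasFDerivAt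
  have h2 : HasFDerivAt (fderiv ℝ f) (fderiv ℝ (fderiv ℝ f) z) z :=
    ((he.fderiv_right (m := 1) (by norm_num)).differentiableAt (by simp)).hasFDerivAt
  have h3 : HasFDerivAt (fun p : E × E => fderiv ℝ F p ∘L ContinuousLinearMap.inl ℝ E E) _ (z, y) :=
    ((ContinuousLinearMap.compL ℝ E (E × E) ℝ).flip
      (ContinuousLinearMap.inl ℝ E E)).hasFDerivAt.comp (z, y) h1
  have h4 : HasFDerivAt (fun p : E × E => fderiv ℝ f p.1) _ (z, y) :=
    HasFDerivAt.comp (f := Prod.fst) (z, y) h2 hasFDerivAt_fst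
  exact h3.add h4

/-- The hypotheses on a family of critical points `g b y` of the functions `F (·, y) + e b`. -/
structure IsCriticalFamilyAt (F : E × E → ℝ) (e : X → E → ℝ) (g : X → E → E) (a : X) (y : E) :
    Prop where
  contDiffAt : ∀ᶠ p : X × E in 𝓝 (a, y), ContDiffAt ℝ ∞ F (g p.1 p.2, p.2)
  critical : ∀ᶠ p : X × E in 𝓝 (a, y), ∀ v,
    fderiv ℝ F (g p.1 p.2, p.2) (v, 0) + fderiv ℝ (e p.1) (g p.1 p.2) v = 0
  pos : ∀ᶠ p : X × E in 𝓝 (a, y), ∀ v, v ≠ 0 → 0 < totalHessian F (e p.1) (g p.1 p.2) p.2 v v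
  continuousAt : ∀ᶠ p : X × E in 𝓝 (a, y), ContinuousAt (fun p : X × E => g p.1 p.2) p

namespace IsCriticalFamilyAt

theorem totalHessian_jetContAt (H : IsCriticalFamilyAt F e g a y) {k : ℕ}
    (he : JetContAt (k + 2) e a (g a y)) (hg : JetContAt k g a y) :
    JetContAt k (fun b z => totalHessian F (e b) (g b z) z) a y := by
  have h1 : JetContAt k (fun b z => fderiv ℝ (fderiv ℝ F) (g b z, z)) a y := by
    refine JetContAt.contDiff_comp (T := fun b z => (g b z, z)) (hg.prodMk JetContAt.id) ?_
    exact ((H.contDiffAt.self_of_nhds.fderiv_right (m := ∞) (by simp)).fderiv_right (m := ∞)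
      (by simp)).of_le (by exact_mod_cast le_top)
  have h2 := h1.clm_comp (((ContinuousLinearMap.compL ℝ E (E × E) (E →L[ℝ] ℝ)).flip
    (ContinuousLinearMap.inl ℝ E E)) ∘L bilinInl)
  exact h2.add (JetContAt.comp (S := fun b => fderiv ℝ (fderiv ℝ (e b))) he.fderiv.fderiv hg)

theorem jetContAt_zero (H : IsCriticalFamilyAt F e g a y) : JetContAt 0 g a y :=
  ComplexLegendre.jetContAt_zero.2 H.continuousAt

end IsCriticalFamilyAt

variable [FiniteDimensional ℝ E]

theorem inverse_apply_of_pos {A : E →L[ℝ] E →L[ℝ] ℝ} (hA : ∀ v, v ≠ 0 → 0 < A v v) (v : E) :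
    A.inverse (A v) = v := by
  obtain ⟨T, rfl⟩ := exists_equiv_of_pos hA
  rw [ContinuousLinearMap.inverse_equiv]
  simp

theorem contDiffAt_inverse_of_pos {A : E →L[ℝ] E →L[ℝ] ℝ} (hA : ∀ v, v ≠ 0 → 0 < A v v) {n : ℕ∞ω} :
    ContDiffAt ℝ n (ContinuousLinearMap.inverse (M := E) (M₂ := E →L[ℝ] ℝ) (R := ℝ)) A := by
  have : CompleteSpace E := FiniteDimensional.complete ℝ E
  obtain ⟨T, rfl⟩ := exists_equiv_of_pos hA
  exact contDiffAt_map_inverse T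

namespace IsCriticalFamilyAt

theorem hasFDerivAt (H : IsCriticalFamilyAt F e g a y) (he : JetContAt 2 e a (g a y)) :
    ∀ᶠ p : X × E in 𝓝 (a, y), HasFDerivAt (g p.1)
      (-((totalHessian F (e p.1) (g p.1 p.2) p.2).inverse ∘L
        bilinInl (fderiv ℝ (fderiv ℝ F) (g p.1 p.2, p.2)) ∘L ContinuousLinearMap.inr ℝ E E)) p.2 := by
  have hc : Tendsto (fun p : X × E => (p.1, g p.1 p.2)) (𝓝 (a, y)) (𝓝 (a, g a y)) :=
    continuousAt_fst.prodMk H.continuousAt.self_of_nhds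
  filter_upwards [H.contDiffAt, H.critical.eventually_nhds, H.pos, H.continuousAt,
    hc.eventually he.eventually] with p h1 h2 h3 h4 h5
  have h6 : ContinuousAt (g p.1) p.2 :=
    ContinuousAt.comp (f := fun z => (p.1, z)) (x := p.2) h4 (by fun_prop)
  have h7 := hasFDerivAt_criticalEquation (h1.of_le (by norm_cast))
    (h5.contDiffAt : ContDiffAt ℝ (2 : ℕ) (e p.1) (g p.1 p.2))
  refine (hasFDerivAt_of_implicit (S := (totalHessian F (e p.1) (g p.1 p.2) p.2).inverse) h7 h6 ?_
    fun v => ?_).congr_fderiv ?_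
  · filter_upwards [eventually_slice h2] with z hz
    ext v
    exact hz v
  · exact inverse_apply_of_pos h3 v
  · ext v
    simp

theorem inverse_jetContAt (H : IsCriticalFamilyAt F e g a y) {k : ℕ}
    (he : JetContAt (k + 2) e a (g a y)) (hg : JetContAt k g a y) :
    JetContAt k (fun b z => (totalHessian F (e b) (g b z) z).inverse) a y :=
  JetContAt.contDiff_comp (H.totalHessian_jetContAt he hg)
    (contDiffAt_inverse_of_pos H.pos.self_of_nhds)

/-- Bootstrap: the derivative of `g` is an expression in `g` and second derivatives of `F` and `e`,
so jets of `g` of order `j` give those of order `j + 1` as long as `e` has jets of order `j + 2`. -/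
theorem jetContAt (H : IsCriticalFamilyAt F e g a y) {k : ℕ}
    (he : JetContAt (k + 2) e a (g a y)) : JetContAt (k + 1) g a y := by
  have key : ∀ j ≤ k + 1, JetContAt j g a y := by
    intro j
    induction j with
    | zero => exact fun _ => H.jetContAt_zero
    | succ j ih =>
      intro hj
      have hgj := ih (by omega)
      have hej : JetContAt (j + 2) e a (g a y) := he.of_le (by omega)
      have hd := H.hasFDerivAt (he.of_le (by omega))
      refine jetContAt_succ.2 ⟨H.continuousAt, hd.mono fun p hp => hp.differentiableAt, ?_⟩
      have h1 : JetContAt j (fun b z => fderiv ℝ (fderiv ℝ F) (g b z, z)) a y := by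
        refine JetContAt.contDiff_comp (T := fun b z => (g b z, z)) (hgj.prodMk JetContAt.id) ?_
        exact ((H.contDiffAt.self_of_nhds.fderiv_right (m := ∞) (by simp)).fderiv_right (m := ∞)
          (by simp)).of_le (by exact_mod_cast le_top)
      have h2 := h1.clm_comp (((ContinuousLinearMap.compL ℝ E (E × E) (E →L[ℝ] ℝ)).flip
        (ContinuousLinearMap.inr ℝ E E)) ∘L bilinInl)
      have h3 := (JetContAt.clm_apply (A := fun b z => ContinuousLinearMap.compL ℝ E (E →L[ℝ] ℝ) E
        (totalHessian F (e b) (g b z) z).inverse)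
        ((H.inverse_jetContAt hej hgj).clm_comp (ContinuousLinearMap.compL ℝ E (E →L[ℝ] ℝ) E)) h2).neg
      exact h3.congr (hd.mono fun p hp => hp.fderiv.symm)
  exact key _ le_rfl

/-- The envelope formula: the motion of the critical point contributes nothing, by the critical
equation. -/
theorem hasFDerivAt_value (H : IsCriticalFamilyAt F e g a y) (he : JetContAt 2 e a (g a y)) :
    ∀ᶠ p : X × E in 𝓝 (a, y), HasFDerivAt (fun z => -F (g p.1 z, z) - e p.1 (g p.1 z))
      (-(fderiv ℝ F (g p.1 p.2, p.2) ∘L ContinuousLinearMap.inr ℝ E E)) p.2 := by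
  have hc : Tendsto (fun p : X × E => (p.1, g p.1 p.2)) (𝓝 (a, y)) (𝓝 (a, g a y)) :=
    continuousAt_fst.prodMk H.continuousAt.self_of_nhds
  filter_upwards [H.contDiffAt, H.critical, H.hasFDerivAt he, hc.eventually he.eventually]
    with p h1 h2 h3 h4
  have e1 : HasFDerivAt (fun z => F (g p.1 z, z)) _ p.2 :=
    HasFDerivAt.comp (f := fun z => (g p.1 z, z)) p.2
      (h1.differentiableAt (by simp)).hasFDerivAt (h3.prodMk (hasFDerivAt_id p.2))
  have e2 : HasFDerivAt (fun z => e p.1 (g p.1 z)) _ p.2 :=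
    HasFDerivAt.comp p.2 (h4.contDiffAt.differentiableAt (by simp)).hasFDerivAt h3
  refine (e1.neg.sub e2).congr_fderiv ?_
  ext v
  have e3 := h2 ((totalHessian F (e p.1) (g p.1 p.2) p.2).inverse
    (bilinInl (fderiv ℝ (fderiv ℝ F) (g p.1 p.2, p.2)) (0, v)))
  set w := (totalHessian F (e p.1) (g p.1 p.2) p.2).inverse
    (bilinInl (fderiv ℝ (fderiv ℝ F) (g p.1 p.2, p.2)) (0, v)) with hw
  have e4 : ((-w, v) : E × E) = -(w, 0) + (0, v) := by simp
  change -(fderiv ℝ F (g p.1 p.2, p.2) (-w, v)) - fderiv ℝ (e p.1) (g p.1 p.2) (-w) =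
    -(fderiv ℝ F (g p.1 p.2, p.2) (0, v))
  rw [e4, map_add, map_neg, map_neg]
  linarith

/-- No derivative is lost: `g` has jets of order `k + 1` only, but the derivative of the value
involves `g` and not its derivative. With `k = 0` this gives continuity of the transform in the
`C²`-topology. -/
theorem value_jetContAt (H : IsCriticalFamilyAt F e g a y) {k : ℕ}
    (he : JetContAt (k + 2) e a (g a y)) :
    JetContAt (k + 2) (fun b z => -F (g b z, z) - e b (g b z)) a y := by
  have hg := H.jetContAt he
  have hF : ContDiffAt ℝ ∞ F (g a y, y) := H.contDiffAt.self_of_nhds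
  have h0 : JetContAt 0 (fun b z => -F (g b z, z) - e b (g b z)) a y :=
    (JetContAt.contDiff_comp (T := fun b z => (g b z, z)) (f := F)
      (H.jetContAt_zero.prodMk JetContAt.id) (hF.of_le (by simp))).neg.sub
      (JetContAt.comp (he.of_le (by omega)) H.jetContAt_zero)
  have hd := H.hasFDerivAt_value (he.of_le (by omega))
  refine jetContAt_succ.2 ⟨ComplexLegendre.jetContAt_zero.1 h0,
    hd.mono fun p hp => hp.differentiableAt, ?_⟩
  have h1 : JetContAt (k + 1) (fun b z => fderiv ℝ F (g b z, z)) a y :=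
    JetContAt.contDiff_comp (T := fun b z => (g b z, z)) (hg.prodMk JetContAt.id)
      ((hF.fderiv_right (m := ∞) (by simp)).of_le (by exact_mod_cast le_top))
  exact (h1.clm_comp ((ContinuousLinearMap.compL ℝ E (E × E) ℝ).flip
    (ContinuousLinearMap.inr ℝ E E))).neg.congr (hd.mono fun p hp => hp.fderiv.symm)

end IsCriticalFamilyAt

end LocalTransform

/-! ### Lower bounds for the diastasis near the diagonal. -/

section LocalBounds

variable {E : Type*} [NormedAddCommGroup E] [NormedSpace ℂ E] {B : Set E} {u : E → ℝ}
  {P : E × E → ℂ}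

namespace IsLocalPolarization

theorem mono (H : IsLocalPolarization B u P) {B' : Set E} (h : B' ⊆ B) :
    IsLocalPolarization B' u P :=
  ⟨fun p hp => H.contDiffAt p ⟨h hp.1, h hp.2⟩, fun p hp => H.sesqui p ⟨h hp.1, h hp.2⟩,
    fun z hz => H.diagonal z (h hz)⟩

/-- Vanishing on the diagonal makes the sum of the two partial derivatives zero, and symmetry makes
them equal. -/
theorem fderiv_localDiastasis_self (H : IsLocalPolarization B u P) (hB : Convex ℝ B)
    (hBo : IsOpen B) {y : E} (hy : y ∈ B) (v : E) :
    fderiv ℝ (localDiastasis u P) (y, y) (v, 0) = 0 := by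
  have hd : HasFDerivAt (localDiastasis u P) (fderiv ℝ (localDiastasis u P) (y, y)) (y, y) :=
    ((H.contDiffAt_localDiastasis hBo ⟨hy, hy⟩).differentiableAt (by simp)).hasFDerivAt
  let Δ : E →L[ℝ] E × E := (ContinuousLinearMap.id ℝ E).prod (ContinuousLinearMap.id ℝ E)
  let σ : E × E →L[ℝ] E × E :=
    (ContinuousLinearMap.snd ℝ E E).prod (ContinuousLinearMap.fst ℝ E E)
  have h1 : HasFDerivAt (fun z : E => localDiastasis u P (z, z))
      (fderiv ℝ (localDiastasis u P) (y, y) ∘L Δ) y :=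
    HasFDerivAt.comp (f := fun z : E => (z, z)) y hd Δ.hasFDerivAt
  have h2 : (fun z : E => localDiastasis u P (z, z)) =ᶠ[𝓝 y] fun _ => 0 := by
    filter_upwards [hBo.mem_nhds hy] with z hz using H.localDiastasis_self hz
  have h3 := (h1.congr_of_eventuallyEq h2.symm).unique (hasFDerivAt_const _ _)
  have h4 : HasFDerivAt (fun z : E × E => localDiastasis u P (σ z))
      (fderiv ℝ (localDiastasis u P) (y, y) ∘L σ) (y, y) :=
    HasFDerivAt.comp (f := σ) (y, y) hd σ.hasFDerivAt
  have h5 : (fun z : E × E => localDiastasis u P (σ z)) =ᶠ[𝓝 (y, y)] localDiastasis u P := by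
    filter_upwards [(hBo.prod hBo).mem_nhds (show (y, y) ∈ B ×ˢ B from ⟨hy, hy⟩)] with z hz
    exact H.localDiastasis_symm hB hBo hz.2 hz.1
  have h6 := (h4.congr_of_eventuallyEq h5.symm).unique hd
  have e1 : fderiv ℝ (localDiastasis u P) (y, y) (v, v) = 0 := congrArg (fun T => T v) h3
  have e2 : fderiv ℝ (localDiastasis u P) (y, y) (0, v) =
      fderiv ℝ (localDiastasis u P) (y, y) (v, 0) := congrArg (fun T => T (v, 0)) h6
  have e3 : ((v, v) : E × E) = (v, 0) + (0, v) := by simp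
  rw [e3, map_add, e2] at e1
  linarith

theorem eventually_hessian_bounds (H : IsLocalPolarization B u P) (hB : Convex ℝ B)
    (hBo : IsOpen B) {a : E} (ha : a ∈ B) {m : ℝ} (hm : 0 < m)
    (hl : ∀ v, 2 * m * ‖v‖ ^ 2 ≤ levi u a v (Complex.I • v)) :
    ∀ᶠ p in 𝓝 (a, a), ∀ v,
      m * ‖v‖ ^ 2 ≤ fderiv ℝ (fderiv ℝ (localDiastasis u P)) p (v, 0) (v, 0) ∧
      fderiv ℝ (fderiv ℝ (localDiastasis u P)) p (0, v) (v, 0) ≤ -(m * ‖v‖ ^ 2) := by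
  have hc : ContinuousAt (fderiv ℝ (fderiv ℝ (localDiastasis u P))) (a, a) :=
    (((H.contDiffAt_localDiastasis hBo (show (a, a) ∈ B ×ˢ B from ⟨ha, ha⟩)).fderiv_right (m := ω)
      (by simp)).fderiv_right (m := ω) (by simp)).continuousAt
  filter_upwards [Metric.continuousAt_iff'.1 hc m hm] with p hp v
  rw [dist_eq_norm] at hp
  set T := fderiv ℝ (fderiv ℝ (localDiastasis u P)) with hT
  have h1 : ∀ V W : E × E, ‖V‖ ≤ ‖v‖ → ‖W‖ ≤ ‖v‖ →
      |T p V W - T (a, a) V W| ≤ m * ‖v‖ ^ 2 := by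
    intro V W hV hW
    have := (T p - T (a, a)).le_opNorm₂ V W
    rw [sub_apply, sub_apply, Real.norm_eq_abs] at this
    refine this.trans ?_
    rw [sq, ← mul_assoc]
    gcongr
  have n1 : ‖((v, 0) : E × E)‖ ≤ ‖v‖ := by simp [Prod.norm_def]
  have n2 : ‖((0, v) : E × E)‖ ≤ ‖v‖ := by simp [Prod.norm_def]
  have h2 := abs_le.1 (h1 (v, 0) (v, 0) n1 n1)
  have h3 := abs_le.1 (h1 (0, v) (v, 0) n2 n1)
  rw [hT, H.hessian_left hB hBo ha] at h2
  rw [hT, H.hessian_mixed hB hBo ha] at h3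
  have := hl v
  constructor <;> linarith [h2.1, h2.2, h3.1, h3.2]

/-- Taylor expansion along the segment from `(w, w)` to `(z, w)`: value and first derivative vanish
at the start. -/
theorem localDiastasis_lower_bound (H : IsLocalPolarization B u P) (hB : Convex ℝ B)
    (hBo : IsOpen B) {m : ℝ}
    (hm : ∀ p ∈ B ×ˢ B, ∀ v,
      m * ‖v‖ ^ 2 ≤ fderiv ℝ (fderiv ℝ (localDiastasis u P)) p (v, 0) (v, 0))
    {z w : E} (hz : z ∈ B) (hw : w ∈ B) : m / 2 * ‖z - w‖ ^ 2 ≤ localDiastasis u P (z, w) := by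
  have hseg : ∀ t ∈ Icc (0 : ℝ) 1, (w, w) + t • (z - w, 0) ∈ B ×ˢ B := by
    intro t ht
    refine ⟨?_, by simpa using hw⟩
    simpa using hB.add_smul_sub_mem hw hz ht
  have h := segment_lower_bound (g := localDiastasis u P) (a := (w, w)) (v := (z - w, 0))
    (m := m * ‖z - w‖ ^ 2)
    (fun t ht => (H.contDiffAt_localDiastasis hBo (hseg t ht)).of_le le_top)
    (fun t ht => hm _ (hseg t ht) _)
  rw [H.localDiastasis_self hw, H.fderiv_localDiastasis_self hB hBo hw] at h
  have e : ((w, w) : E × E) + (z - w, 0) = (z, w) := by simp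
  rw [e] at h
  linarith

end IsLocalPolarization

end LocalBounds

/-! ### Gluing local diastases into an admissible neighbourhood. -/

section Existence

variable {E : Type*} [NormedAddCommGroup E] [NormedSpace ℂ E] [FiniteDimensional ℂ E]
  {M : Type*} [TopologicalSpace M] [ChartedSpace E M] [IsManifold 𝓘(ℂ, E) ω M]
  {Ω : TwoForm E M}

/-- A ball in a chart, with a potential of `Ω` whose diastasis is bounded from below. -/
structure DiastasisBall (Ω : TwoForm E M) (x : M) (r : ℝ) (u : E → ℝ) (P : E × E → ℂ) (C : ℝ) :
    Prop where
  pos : 0 < r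
  subset : Metric.ball (chartAt E x x) r ⊆ (chartAt E x).target
  polarization : IsLocalPolarization (Metric.ball (chartAt E x x) r) u P
  levi : ∀ y ∈ Metric.ball (chartAt E x x) r, ∀ v w, levi u y v w = chartForm Ω x y v w
  const_pos : 0 < C
  bound : ∀ z ∈ Metric.ball (chartAt E x x) r, ∀ w ∈ Metric.ball (chartAt E x x) r,
    ENNReal.ofReal C * kahlerEDist Ω ((chartAt E x).symm z) ((chartAt E x).symm w) ^ 2 ≤
      ENNReal.ofReal (localDiastasis u P (z, w))

theorem exists_diastasisBall (hΩ : IsAnalyticKahlerForm Ω) (x : M) :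
    ∃ r u P C, DiastasisBall Ω x r u P C := by
  obtain ⟨r₁, hr₁, hr₁t, u, P, hP, hl⟩ :=
    exists_isLocalPolarization_chart hΩ (mem_chart_target E x)
  set y := chartAt E x x
  have hy : y ∈ Metric.ball y r₁ := Metric.mem_ball_self hr₁
  have hK : Metric.closedBall y (r₁ / 2) ⊆ Metric.ball y r₁ :=
    Metric.closedBall_subset_ball (half_lt_self hr₁)
  obtain ⟨c, C, hc, hC, hcC⟩ := exists_chartForm_bounds hΩ (x := x)
    (isCompact_closedBall y (r₁ / 2)) (hK.trans hr₁t)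
  have hev := hP.eventually_hessian_bounds (convex_ball _ _) Metric.isOpen_ball hy
    (m := c ^ 2 / 2) (by positivity) (fun v => by
      rw [hl y hy]
      have := (hcC y (Metric.mem_closedBall_self (by positivity)) v).1
      linarith)
  obtain ⟨r₂, hr₂, H₂⟩ := Metric.eventually_nhds_iff_ball.1 hev
  have hr : 0 < min (r₁ / 2) r₂ := lt_min (by positivity) hr₂
  have hsub1 : Metric.ball y (min (r₁ / 2) r₂) ⊆ Metric.closedBall y (r₁ / 2) :=
    (Metric.ball_subset_ball (min_le_left _ _)).trans Metric.ball_subset_closedBall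
  have hP' := hP.mono (hsub1.trans hK)
  -- The diastasis is at least `c² / 4` times the squared norm, the Hessian bound being `c² / 2`,
  -- and the distance is at most `C` times the norm; hence the quotient.
  refine ⟨min (r₁ / 2) r₂, u, P, c ^ 2 / 4 / C ^ 2, hr, (hsub1.trans hK).trans hr₁t, hP',
    fun z hz => hl z (hK (hsub1 hz)), by positivity, fun z hz w hw => ?_⟩
  have h1 := hP'.localDiastasis_lower_bound (convex_ball _ _) Metric.isOpen_ball
    (m := c ^ 2 / 2) (fun p hp v => (H₂ p (by
      rw [← ball_prod_same]
      exact ⟨Metric.ball_subset_ball (min_le_right _ _) hp.1,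
        Metric.ball_subset_ball (min_le_right _ _) hp.2⟩) v).1) hz hw
  have h2 := kahlerEDist_le (Ω := Ω) (x := x) (convex_ball y (min (r₁ / 2) r₂))
    ((hsub1.trans hK).trans hr₁t) hC.le (fun y' hy' v => (hcC y' (hsub1 hy') v).2) hz hw
  calc _ ≤ ENNReal.ofReal (c ^ 2 / 4 / C ^ 2) * ENNReal.ofReal (C * ‖w - z‖) ^ 2 := by gcongr
    _ = ENNReal.ofReal (c ^ 2 / 4 * ‖z - w‖ ^ 2) := by
      rw [← ENNReal.ofReal_pow (by positivity), ← ENNReal.ofReal_mul (by positivity),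
        norm_sub_rev w z]
      congr 1
      field_simp
    _ ≤ _ := ENNReal.ofReal_le_ofReal (by linarith)

/-- Both potentials are potentials of `Ω`; read in the chart at `y` they have the same `levi`, so
their diastases agree. -/
theorem chart_localDiastasis_eq {x y : M} {u u' : E → ℝ} {P P' : E × E → ℂ} {B B' : Set E}
    (hP : IsLocalPolarization B u P) (hBo : IsOpen B) (hB : B ⊆ (chartAt E x).target)
    (hl : ∀ z ∈ B, ∀ v w, levi u z v w = chartForm Ω x z v w)
    (hP' : IsLocalPolarization B' u' P') (hBo' : IsOpen B') (hB' : B' ⊆ (chartAt E y).target)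
    (hc' : Convex ℝ B') (hl' : ∀ z ∈ B', ∀ v w, levi u' z v w = chartForm Ω y z v w)
    (hBB : ∀ z ∈ B', (chartAt E y).symm z ∈ (chartAt E x).source ∩ chartAt E x ⁻¹' B)
    {z w : E} (hz : z ∈ B') (hw : w ∈ B') :
    localDiastasis u P (chartAt E x ((chartAt E y).symm z), chartAt E x ((chartAt E y).symm w)) =
      localDiastasis u' P' (z, w) := by
  have hW := (chartAt E x).isOpen_inter_preimage hBo
  have h1 := isPotentialOn_of_isLocalPolarization hP hBo hB hl
  have h2 := isLocalPolarization_inChart (x := y) (isPolarizationOn_of_isLocalPolarization (x := x) hP)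
    hW hB' hBB
  exact h2.localDiastasis_eq hP' hc' hBo' (fun z hz v w => by
    rw [levi_inChart_of_isPotentialOn h1 hW (hB' hz) (hBB z hz), hl' z hz]) hz hw

variable [T2Space M] [CompactSpace M]

/-- Existence of neighbourhoods of the diagonal on which the diastasis is defined and bounded from
below by the square of the distance. -/
theorem exists_isLegendreDomain (hΩ : IsAnalyticKahlerForm Ω) :
    ∃ (V : Set (M × M)) (D : M → M → ℝ), IsLegendreDomain Ω V D := by
  choose r u P C hball using exists_diastasisBall hΩ
  let W : M → Set M := fun x =>
    (chartAt E x).source ∩ chartAt E x ⁻¹' Metric.ball (chartAt E x x) (r x)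
  let W' : M → Set M := fun x =>
    (chartAt E x).source ∩ chartAt E x ⁻¹' Metric.ball (chartAt E x x) (r x / 2)
  have hWo : ∀ x, IsOpen (W x) := fun x => (chartAt E x).isOpen_inter_preimage Metric.isOpen_ball
  have hcb : ∀ x, Metric.closedBall (chartAt E x x) (r x / 2) ⊆ Metric.ball (chartAt E x x) (r x) :=
    fun x => Metric.closedBall_subset_ball (half_lt_self (hball x).pos)
  let F : M → Set M := fun x =>
    (chartAt E x).symm '' Metric.closedBall (chartAt E x x) (r x / 2)
  have hF : ∀ x, IsClosed (F x) := fun x =>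
    ((isCompact_closedBall _ _).image_of_continuousOn
      ((chartAt E x).continuousOn_symm.mono ((hcb x).trans (hball x).subset))).isClosed
  have hW'F : ∀ x, W' x ⊆ F x := fun x p hp =>
    ⟨chartAt E x p, Metric.ball_subset_closedBall hp.2, (chartAt E x).left_inv hp.1⟩
  have hFW : ∀ x, F x ⊆ W x := by
    rintro x _ ⟨z, hz, rfl⟩
    have hz' := (hball x).subset (hcb x hz)
    exact ⟨(chartAt E x).map_target hz', by
      rw [mem_preimage, (chartAt E x).right_inv hz']
      exact hcb x hz⟩
  obtain ⟨t, ht⟩ := isCompact_univ.elim_nhds_subcover W' fun x _ =>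
    ((chartAt E x).isOpen_inter_preimage Metric.isOpen_ball).mem_nhds
      ⟨mem_chart_source E x, Metric.mem_ball_self (half_pos (hball x).pos)⟩
  have hcov : ∀ p : M, ∃ x ∈ t, p ∈ W' x := fun p => by
    simpa using ht.2 (mem_univ p)
  choose i hit hiW using hcov
  -- The index `i p` is an arbitrary choice; the neighbourhoods `N y` below are so small that `D`
  -- does not depend on it there.
  let D : M → M → ℝ := fun p q =>
    localDiastasis (u (i p)) (P (i p)) (chartAt E (i p) p, chartAt E (i p) q)
  -- Near `y` each closed set `F x` of the finite cover is avoided if `y ∉ F x`, while `W x`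
  -- contains the whole ball if `y ∈ F x`. So a point of `N y` lying in `W' (i p) ⊆ F (i p)` forces
  -- `y ∈ F (i p)` and then `N y ⊆ W (i p)`.
  have hρ : ∀ y : M, ∃ ρ > 0, ρ ≤ r y ∧ ∀ z ∈ Metric.ball (chartAt E y y) ρ, ∀ x ∈ t,
      (y ∈ F x → (chartAt E y).symm z ∈ W x) ∧ (y ∉ F x → (chartAt E y).symm z ∉ F x) := by
    intro y
    have h1 : ∀ᶠ p in 𝓝 y, ∀ x ∈ t, (y ∈ F x → p ∈ W x) ∧ (y ∉ F x → p ∉ F x) := by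
      rw [Filter.eventually_all_finset]
      intro x _
      by_cases h : y ∈ F x
      · filter_upwards [(hWo x).mem_nhds (hFW x h)] with p hp using ⟨fun _ => hp, fun h' => (h' h).elim⟩
      · filter_upwards [(hF x).isOpen_compl.mem_nhds h] with p hp
          using ⟨fun h' => (h h').elim, fun _ => hp⟩
    have h2 : Tendsto (chartAt E y).symm (𝓝 (chartAt E y y)) (𝓝 y) := by
      have := (chartAt E y).continuousAt_symm (mem_chart_target E y)
      rwa [ContinuousAt, (chartAt E y).left_inv (mem_chart_source E y)] at this
    obtain ⟨ρ, hρ, h3⟩ := Metric.eventually_nhds_iff_ball.1 (h2.eventually h1)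
    exact ⟨min ρ (r y), lt_min hρ (hball y).pos, min_le_right _ _, fun z hz =>
      h3 z (Metric.ball_subset_ball (min_le_left _ _) hz)⟩
  choose ρ hρ0 hρr hρ using hρ
  let B : M → Set E := fun y => Metric.ball (chartAt E y y) (ρ y)
  let N : M → Set M := fun y => (chartAt E y).source ∩ chartAt E y ⁻¹' B y
  have hB : ∀ y, B y ⊆ Metric.ball (chartAt E y y) (r y) := fun y => Metric.ball_subset_ball (hρr y)
  have hNW : ∀ y, ∀ p ∈ N y, ∀ q ∈ N y, q ∈ W (i p) := by
    intro y p hp q hq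
    have h1 := (hρ y (chartAt E y p) hp.2 (i p) (hit p))
    have h2 := (hρ y (chartAt E y q) hq.2 (i p) (hit p))
    rw [(chartAt E y).left_inv hp.1] at h1
    rw [(chartAt E y).left_inv hq.1] at h2
    exact h2.1 (by_contra fun h => h1.2 h (hW'F _ (hiW p)))
  have hDN : ∀ y, ∀ p ∈ N y, ∀ q ∈ N y,
      D p q = localDiastasis (u y) (P y) (chartAt E y p, chartAt E y q) := by
    intro y p hp q hq
    have := chart_localDiastasis_eq (Ω := Ω) (hball (i p)).polarization Metric.isOpen_ball
      (hball (i p)).subset (hball (i p)).levi ((hball y).polarization.mono (hB y))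
      Metric.isOpen_ball ((hB y).trans (hball y).subset) (convex_ball _ _)
      (fun z hz => (hball y).levi z (hB y hz)) (fun z hz => by
        have hz' := (hball y).subset (hB y hz)
        exact hNW y p hp _ ⟨(chartAt E y).map_target hz', by
          rwa [mem_preimage, (chartAt E y).right_inv hz']⟩) hp.2 hq.2
    rwa [(chartAt E y).left_inv hp.1, (chartAt E y).left_inv hq.1] at this
  have hNo : ∀ y, IsOpen (N y) := fun y => (chartAt E y).isOpen_inter_preimage Metric.isOpen_ball
  refine ⟨⋃ y, N y ×ˢ N y, D, isOpen_iUnion fun y => (hNo y).prod (hNo y), fun p => ?_,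
    fun p q hpq => ?_, ?_⟩
  · exact mem_iUnion.2 ⟨p, ⟨mem_chart_source E p, Metric.mem_ball_self (hρ0 p)⟩,
      ⟨mem_chart_source E p, Metric.mem_ball_self (hρ0 p)⟩⟩
  · obtain ⟨y, hp, hq⟩ := mem_iUnion.1 hpq
    refine ⟨N y, fun p => u y (chartAt E y p), fun p q => P y (chartAt E y p, chartAt E y q), hNo y,
      ?_, hp, hq, ?_, ?_, fun z hz w hw _ => hDN y z hz w hw⟩
    · have h1 : N y = (chartAt E y).symm '' B y := by
        rw [(chartAt E y).symm_image_eq_source_inter_preimage ((hB y).trans (hball y).subset)]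
      rw [h1]
      exact (convex_ball _ _).isPreconnected.image _
        ((chartAt E y).continuousOn_symm.mono ((hB y).trans (hball y).subset))
    · exact isPotentialOn_of_isLocalPolarization ((hball y).polarization.mono (hB y))
        Metric.isOpen_ball ((hB y).trans (hball y).subset) (fun z hz => (hball y).levi z (hB y hz))
    · exact isPolarizationOn_of_isLocalPolarization ((hball y).polarization.mono (hB y))
  -- Only the finitely many indices in `t` occur in `D`, so one constant serves everywhere.
  · obtain ⟨c, hc, hct⟩ : ∃ c : ℝ, 0 < c ∧ ∀ x ∈ t, c ≤ C x := by
      rcases t.eq_empty_or_nonempty with h | h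
      · exact ⟨1, one_pos, by simp [h]⟩
      · obtain ⟨x, hx, hx'⟩ := t.exists_min_image C h
        exact ⟨C x, (hball x).const_pos, hx'⟩
    refine ⟨c, hc, fun p q hpq => ?_⟩
    obtain ⟨y, hp, hq⟩ := mem_iUnion.1 hpq
    have h1 := hNW y p hp p hp
    have h2 := hNW y p hp q hq
    have h3 := (hball (i p)).bound _ h1.2 _ h2.2
    rw [(chartAt E (i p)).left_inv h1.1, (chartAt E (i p)).left_inv h2.1] at h3
    refine le_trans ?_ h3
    gcongr
    exact hct _ (hit p)

end Existence

/-! ### Finite atlases with uniform bounds for the diastasis. -/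

section LegendreAtlas

variable {E : Type*} [NormedAddCommGroup E] {M : Type*} [TopologicalSpace M] [ChartedSpace E M]

variable (E) in
/-- The points of `M` in a ball of the chart at `x`. -/
def chartBall (x : M) (r : ℝ) : Set M :=
  (chartAt E x).source ∩ chartAt E x ⁻¹' Metric.ball (chartAt E x x) r

theorem isOpen_chartBall (x : M) (r : ℝ) : IsOpen (chartBall E x r) :=
  (chartAt E x).isOpen_inter_preimage Metric.isOpen_ball

variable [NormedSpace ℂ E] {Ω : TwoForm E M} {V : Set (M × M)} {D : M → M → ℝ}

variable (E) in
/-- The function `D` in the chart at `x`. -/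
def chartDiastasis (D : M → M → ℝ) (x : M) (p : E × E) : ℝ :=
  D ((chartAt E x).symm p.1) ((chartAt E x).symm p.2)

/-- A ball in the chart at `x`, on which `D` has the properties of a diastasis, with uniform
bounds. -/
structure LegendreChart (Ω : TwoForm E M) (V : Set (M × M)) (D : M → M → ℝ) (x : M) (r c : ℝ) :
    Prop where
  radius_pos : 0 < r
  const_pos : 0 < c
  subset : Metric.ball (chartAt E x x) (4 * r) ⊆ (chartAt E x).target
  mem : ∀ z ∈ Metric.ball (chartAt E x x) (4 * r), ∀ w ∈ Metric.ball (chartAt E x x) (4 * r),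
    ((chartAt E x).symm z, (chartAt E x).symm w) ∈ V
  contDiffAt : ∀ z ∈ Metric.ball (chartAt E x x) (4 * r),
    ∀ w ∈ Metric.ball (chartAt E x x) (4 * r), ContDiffAt ℝ ∞ (chartDiastasis E D x) (z, w)
  symm : ∀ z ∈ Metric.ball (chartAt E x x) (4 * r), ∀ w ∈ Metric.ball (chartAt E x x) (4 * r),
    chartDiastasis E D x (z, w) = chartDiastasis E D x (w, z)
  self : ∀ z ∈ Metric.ball (chartAt E x x) (4 * r), chartDiastasis E D x (z, z) = 0
  nonneg : ∀ z ∈ Metric.ball (chartAt E x x) (4 * r), ∀ w ∈ Metric.ball (chartAt E x x) (4 * r),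
    0 ≤ chartDiastasis E D x (z, w)
  hessian : ∀ z ∈ Metric.ball (chartAt E x x) (4 * r),
    ∀ w ∈ Metric.ball (chartAt E x x) (4 * r), ∀ v,
    2 * c * ‖v‖ ^ 2 ≤ fderiv ℝ (fderiv ℝ (chartDiastasis E D x)) (z, w) (v, 0) (v, 0) ∧
    fderiv ℝ (fderiv ℝ (chartDiastasis E D x)) (z, w) (0, v) (v, 0) ≤ -(2 * c * ‖v‖ ^ 2)
  form : ∀ z ∈ Metric.ball (chartAt E x x) (4 * r), ∀ v,
    2 * c * ‖v‖ ^ 2 ≤ chartForm Ω x z v (Complex.I • v)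

theorem LegendreChart.mono {x : M} {r c c' : ℝ} (H : LegendreChart Ω V D x r c) (hc' : 0 < c')
    (h : c' ≤ c) : LegendreChart Ω V D x r c' where
  __ := H
  const_pos := hc'
  hessian := fun z hz w hw v => by
    have h1 := H.hessian z hz w hw v
    have h2 : 2 * c' * ‖v‖ ^ 2 ≤ 2 * c * ‖v‖ ^ 2 := by gcongr
    exact ⟨h2.trans h1.1, h1.2.trans (neg_le_neg h2)⟩
  form := fun z hz v => by
    have h2 : 2 * c' * ‖v‖ ^ 2 ≤ 2 * c * ‖v‖ ^ 2 := by gcongr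
    exact h2.trans (H.form z hz v)

/-- Finitely many charts in which the Legendre transform of small functions is a local
operation. -/
structure LegendreAtlas (Ω : TwoForm E M) (V : Set (M × M)) (D : M → M → ℝ) (t : Finset M)
    (r : M → ℝ) (c ε : ℝ) : Prop where
  chart : ∀ x ∈ t, LegendreChart Ω V D x (r x) c
  cover : ∀ q : M, ∃ x ∈ t, q ∈ chartBall E x (r x)
  const_pos : 0 < c
  eps_pos : 0 < ε
  near : ∀ p q : M, (p, q) ∈ V → D p q < 3 * ε → ∀ x ∈ t,
    (q ∈ chartBall E x (r x) → p ∈ chartBall E x (2 * r x)) ∧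
    (q ∈ chartBall E x (2 * r x) → p ∈ chartBall E x (3 * r x))

variable [IsManifold 𝓘(ℂ, E) ω M] [FiniteDimensional ℂ E]

theorem exists_legendreChart (hΩ : IsAnalyticKahlerForm Ω) (hV : IsLegendreDomain Ω V D) (x : M) :
    ∃ r c, LegendreChart Ω V D x r c := by
  obtain ⟨W, u, P, hWo, -, hxW, -, hu, hP, hD⟩ := hV.isDiastasisOn x x (hV.diagonal_subset x)
  set y := chartAt E x x with hy
  have hsymm : ContinuousAt (chartAt E x).symm y :=
    (chartAt E x).continuousAt_symm (mem_chart_target E x)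
  have hyx : (chartAt E x).symm y = x := (chartAt E x).left_inv (mem_chart_source E x)
  have h1 : ∀ᶠ z in 𝓝 y, z ∈ (chartAt E x).target ∧ (chartAt E x).symm z ∈ W :=
    Filter.Eventually.and ((chartAt E x).open_target.mem_nhds (mem_chart_target E x))
      (hsymm.eventually (by rw [hyx]; exact hWo.mem_nhds hxW))
  have h2 : ∀ᶠ p : E × E in 𝓝 (y, y), ((chartAt E x).symm p.1, (chartAt E x).symm p.2) ∈ V := by
    have e1 : ContinuousAt (fun p : E × E => ((chartAt E x).symm p.1, (chartAt E x).symm p.2))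
        (y, y) :=
      (ContinuousAt.comp (f := Prod.fst) (x := (y, y)) hsymm continuousAt_fst).prodMk
        (ContinuousAt.comp (f := Prod.snd) (x := (y, y)) hsymm continuousAt_snd)
    refine e1.eventually ?_
    dsimp only
    rw [hyx]
    exact hV.isOpen.mem_nhds (hV.diagonal_subset x)
  obtain ⟨r₁, hr₁, H₁⟩ := Metric.eventually_nhds_iff_ball.1 h1
  obtain ⟨r₂, hr₂, H₂⟩ := Metric.eventually_nhds_iff_ball.1 h2
  have hy₁ : y ∈ Metric.ball y r₁ := Metric.mem_ball_self hr₁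
  have hK : Metric.closedBall y (r₁ / 2) ⊆ Metric.ball y r₁ :=
    Metric.closedBall_subset_ball (half_lt_self hr₁)
  obtain ⟨c, _, hc, -, hcC⟩ := exists_chartForm_bounds hΩ (x := x)
    (isCompact_closedBall y (r₁ / 2)) (fun z hz => (H₁ z (hK hz)).1)
  have hP₁ := isLocalPolarization_inChart hP hWo (B := Metric.ball y r₁)
    (fun z hz => (H₁ z hz).1) (fun z hz => (H₁ z hz).2)
  have hev := hP₁.eventually_hessian_bounds (convex_ball _ _) Metric.isOpen_ball hy₁
    (m := c ^ 2 / 2) (by positivity) (fun v => by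
      rw [levi_inChart_of_isPotentialOn hu hWo (H₁ y hy₁).1 (H₁ y hy₁).2]
      have := (hcC y (Metric.mem_closedBall_self (by positivity)) v).1
      linarith)
  obtain ⟨r₃, hr₃, H₃⟩ := Metric.eventually_nhds_iff_ball.1 hev
  obtain ⟨r, hr, h4r⟩ : ∃ r, 0 < r ∧ 4 * r = min (r₁ / 2) (min r₂ r₃) :=
    ⟨min (r₁ / 2) (min r₂ r₃) / 4, by positivity, by ring⟩
  have s1 : Metric.ball y (4 * r) ⊆ Metric.closedBall y (r₁ / 2) :=
    (Metric.ball_subset_ball (h4r ▸ min_le_left _ _)).trans Metric.ball_subset_closedBall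
  have s2 : Metric.ball y (4 * r) ⊆ Metric.ball y r₂ :=
    Metric.ball_subset_ball (h4r ▸ (min_le_right _ _).trans (min_le_left _ _))
  have s3 : Metric.ball y (4 * r) ⊆ Metric.ball y r₃ :=
    Metric.ball_subset_ball (h4r ▸ (min_le_right _ _).trans (min_le_right _ _))
  have hmem : ∀ z ∈ Metric.ball y (4 * r), ∀ w ∈ Metric.ball y (4 * r),
      ((chartAt E x).symm z, (chartAt E x).symm w) ∈ V := fun z hz w hw =>
    H₂ (z, w) (by rw [← ball_prod_same]; exact ⟨s2 hz, s2 hw⟩)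
  set Q : E × E → ℂ := fun p => P ((chartAt E x).symm p.1) ((chartAt E x).symm p.2) with hQ
  have hP' : IsLocalPolarization (Metric.ball y (4 * r)) (inChart x u) Q := hP₁.mono (s1.trans hK)
  have heq : ∀ p ∈ Metric.ball y (4 * r) ×ˢ Metric.ball y (4 * r),
      chartDiastasis E D x p = localDiastasis (inChart x u) Q p := fun p hp =>
    hD _ (H₁ _ (hK (s1 hp.1))).2 _ (H₁ _ (hK (s1 hp.2))).2 (hmem _ hp.1 _ hp.2)
  have hev : ∀ p ∈ Metric.ball y (4 * r) ×ˢ Metric.ball y (4 * r),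
      chartDiastasis E D x =ᶠ[𝓝 p] localDiastasis (inChart x u) Q := fun p hp =>
    Filter.eventually_of_mem ((Metric.isOpen_ball.prod Metric.isOpen_ball).mem_nhds hp) heq
  have hess : ∀ p ∈ Metric.ball y (4 * r) ×ˢ Metric.ball y (4 * r), ∀ v,
      c ^ 2 / 2 * ‖v‖ ^ 2 ≤
        fderiv ℝ (fderiv ℝ (localDiastasis (inChart x u) Q)) p (v, 0) (v, 0) ∧
      fderiv ℝ (fderiv ℝ (localDiastasis (inChart x u) Q)) p (0, v) (v, 0) ≤
        -(c ^ 2 / 2 * ‖v‖ ^ 2) := fun p hp v =>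
    H₃ p (by rw [← ball_prod_same]; exact ⟨s3 hp.1, s3 hp.2⟩) v
  -- `2 * (c ^ 2 / 4)` is the Hessian bound `c ^ 2 / 2` found above.
  refine ⟨r, c ^ 2 / 4, hr, by positivity, fun z hz => (H₁ z (hK (s1 hz))).1, hmem,
    fun z hz w hw => ?_, fun z hz w hw => ?_, fun z hz => ?_, fun z hz w hw => ?_,
    fun z hz w hw v => ?_, fun z hz v => ?_⟩
  · exact ((hP'.contDiffAt_localDiastasis Metric.isOpen_ball ⟨hz, hw⟩).of_le le_top).congr_of_eventuallyEq
      (hev (z, w) ⟨hz, hw⟩)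
  · rw [heq (z, w) ⟨hz, hw⟩, heq (w, z) ⟨hw, hz⟩]
    exact hP'.localDiastasis_symm (convex_ball _ _) Metric.isOpen_ball hz hw
  · rw [heq (z, z) ⟨hz, hz⟩]
    exact hP'.localDiastasis_self hz
  · rw [heq (z, w) ⟨hz, hw⟩]
    refine le_trans ?_ (hP'.localDiastasis_lower_bound (convex_ball _ _) Metric.isOpen_ball
      (fun p hp v => (hess p hp v).1) hz hw)
    positivity
  · have e : fderiv ℝ (fderiv ℝ (chartDiastasis E D x)) (z, w) =
        fderiv ℝ (fderiv ℝ (localDiastasis (inChart x u) Q)) (z, w) :=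
      (Filter.EventuallyEq.fderiv (𝕜 := ℝ) (hev (z, w) ⟨hz, hw⟩)).fderiv_eq (𝕜 := ℝ)
    rw [e]
    have := hess (z, w) ⟨hz, hw⟩ v
    constructor <;> linarith [this.1, this.2]
  · have := (hcC z (s1 hz) v).1
    have h0 : 0 ≤ c ^ 2 * ‖v‖ ^ 2 := by positivity
    linarith

variable [T2Space M] [CompactSpace M]

/-- A small value of `D` means a small distance, by the quadratic lower bound, and a small distance
means a common chart, by compactness. -/
theorem exists_legendreAtlas (hΩ : IsAnalyticKahlerForm Ω) (hV : IsLegendreDomain Ω V D) :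
    ∃ t r c ε, LegendreAtlas Ω V D t r c ε := by
  choose r c' hchart using exists_legendreChart hΩ hV
  obtain ⟨t, ht⟩ := isCompact_univ.elim_nhds_subcover (fun x => chartBall E x (r x)) fun x _ =>
    (isOpen_chartBall x (r x)).mem_nhds
      ⟨mem_chart_source E x, Metric.mem_ball_self (hchart x).radius_pos⟩
  have hcov : ∀ p : M, ∃ x ∈ t, p ∈ chartBall E x (r x) := fun p => by
    simpa using ht.2 (mem_univ p)
  obtain ⟨c, hc, hct⟩ : ∃ c : ℝ, 0 < c ∧ ∀ x ∈ t, c ≤ c' x := by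
    rcases t.eq_empty_or_nonempty with h | h
    · exact ⟨1, one_pos, by simp [h]⟩
    · obtain ⟨x, hx, hx'⟩ := t.exists_min_image c' h
      exact ⟨c' x, (hchart x).const_pos, hx'⟩
  let F : M → ℝ → Set M := fun x s => (chartAt E x).symm '' Metric.closedBall (chartAt E x x) s
  have hsub : ∀ x s, s < 4 * r x → Metric.closedBall (chartAt E x x) s ⊆ (chartAt E x).target :=
    fun x s hs => (Metric.closedBall_subset_ball hs).trans (hchart x).subset
  have hF : ∀ x s, s < 4 * r x → IsClosed (F x s) := fun x s hs =>
    ((isCompact_closedBall _ _).image_of_continuousOn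
      ((chartAt E x).continuousOn_symm.mono (hsub x s hs))).isClosed
  have hBF : ∀ x s, chartBall E x s ⊆ F x s := fun x s p hp =>
    ⟨chartAt E x p, Metric.ball_subset_closedBall hp.2, (chartAt E x).left_inv hp.1⟩
  have hFB : ∀ x s s', s < 4 * r x → s < s' → F x s ⊆ chartBall E x s' := by
    rintro x s s' hs hs' _ ⟨z, hz, rfl⟩
    have hz' := hsub x s hs hz
    exact ⟨(chartAt E x).map_target hz', by
      rw [mem_preimage, (chartAt E x).right_inv hz']
      exact Metric.closedBall_subset_ball hs' hz⟩
  -- Each implication "`q` in the closed ball of radius `s` implies `p` in a larger open ball" is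
  -- written as a union of open sets, so `O` is an open neighbourhood of the diagonal.
  let O : Set (M × M) := ⋂ x ∈ t, ((univ ×ˢ (F x (r x))ᶜ ∪ chartBall E x (2 * r x) ×ˢ univ) ∩
    (univ ×ˢ (F x (2 * r x))ᶜ ∪ chartBall E x (3 * r x) ×ˢ univ))
  have hO : IsOpen O := by
    refine isOpen_biInter_finset fun x _ => ?_
    have hr := (hchart x).radius_pos
    exact (((isOpen_univ.prod (hF x _ (by linarith)).isOpen_compl).union
      ((isOpen_chartBall x _).prod isOpen_univ))).inter
      (((isOpen_univ.prod (hF x _ (by linarith)).isOpen_compl).union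
      ((isOpen_chartBall x _).prod isOpen_univ)))
  have hOd : ∀ p, (p, p) ∈ O := by
    intro p
    refine mem_iInter₂.2 fun x _ => ?_
    have hr := (hchart x).radius_pos
    constructor
    · by_cases h : p ∈ F x (r x)
      · exact Or.inr ⟨hFB x _ _ (by linarith) (by linarith) h, mem_univ _⟩
      · exact Or.inl ⟨mem_univ _, h⟩
    · by_cases h : p ∈ F x (2 * r x)
      · exact Or.inr ⟨hFB x _ _ (by linarith) (by linarith) h, mem_univ _⟩
      · exact Or.inl ⟨mem_univ _, h⟩
  obtain ⟨δ, hδ, hδO⟩ := exists_kahlerEDist_lt_imp hΩ hO hOd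
  obtain ⟨C, hC, hCV⟩ := hV.lower_bound
  -- Chosen so that `D p q < 3 * ε` reads `D p q < C δ²`, which excludes distance at least `δ`.
  refine ⟨t, r, c, C * δ ^ 2 / 3, fun x hx => (hchart x).mono hc (hct x hx), hcov, hc,
    by positivity, fun p q hpq hD x hx => ?_⟩
  have hmem : (p, q) ∈ O := by
    refine hδO p q ?_
    by_contra hcon
    rw [not_lt] at hcon
    have h1 := hCV p q hpq
    have h2 : ENNReal.ofReal (C * δ ^ 2) ≤ ENNReal.ofReal (D p q) := by
      refine le_trans ?_ h1
      rw [ENNReal.ofReal_mul hC.le, ENNReal.ofReal_pow hδ.le]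
      gcongr
    have h3 : 0 < C * δ ^ 2 := by positivity
    have h4 := (ENNReal.ofReal_le_ofReal_iff' ).1 h2
    rcases h4 with h4 | h4 <;> linarith
  have h1 := mem_iInter₂.1 hmem x hx
  refine ⟨fun hq => ?_, fun hq => ?_⟩
  · rcases h1.1 with h | h
    · exact (h.2 (hBF x _ hq)).elim
    · exact h.1
  · rcases h1.2 with h | h
    · exact (h.2 (hBF x _ hq)).elim
    · exact h.1

end LegendreAtlas

/-! ### The maximizing point and the maximal value. -/

section LegendrePoint

variable {X : Type*} {V : Set (X × X)} {D : X → X → ℝ} {η : X → ℝ} {q z : X}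

open Classical in
/-- A point at which the supremum that defines the Legendre transform is attained. -/
def legendrePoint (V : Set (X × X)) (D : X → X → ℝ) (η : X → ℝ) (q : X) : X :=
  if h : ∃ z, IsAttainedAt V D η q z then h.choose else q

/-- The value of the Legendre transform, if the supremum is attained. -/
def legendreVal (V : Set (X × X)) (D : X → X → ℝ) (η : X → ℝ) (q : X) : ℝ :=
  -D (legendrePoint V D η q) q - η (legendrePoint V D η q)

theorem isAttainedAt_legendrePoint (h : ∃ z, IsAttainedAt V D η q z) :
    IsAttainedAt V D η q (legendrePoint V D η q) := by
  rw [legendrePoint, dif_pos h]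
  exact h.choose_spec

theorem iSup_eq_legendreVal (h : ∃ z, IsAttainedAt V D η q z) :
    ⨆ (p : X) (_ : (p, q) ∈ V), (-(D p q : EReal) - (η p : EReal)) =
      (legendreVal V D η q : EReal) := by
  have h1 := isAttainedAt_legendrePoint h
  have hc : ∀ p, (-(D p q : EReal) - (η p : EReal)) = ((-D p q - η p : ℝ) : EReal) := fun p => by
    push_cast
    rfl
  refine le_antisymm (iSup₂_le fun p hp => ?_) ?_
  · rw [hc, EReal.coe_le_coe_iff]
    exact h1.2 p hp
  · refine le_trans (le_of_eq ?_) (le_iSup₂ (legendrePoint V D η q) h1.1)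
    rw [hc]
    rfl

end LegendrePoint

/-! ### Change of charts for jets. -/

section Charts

variable {E F X : Type*} [NormedAddCommGroup E] [NormedSpace ℝ E] [NormedAddCommGroup F]
  [NormedSpace ℝ F] {M : Type*} [TopologicalSpace M] [ChartedSpace E M] [TopologicalSpace X]
  [IsManifold 𝓘(ℝ, E) ∞ M]

theorem contDiffAt_transition {x x' : M} {y : E} (hy : y ∈ (chartAt E x').target)
    (hx : (chartAt E x').symm y ∈ (chartAt E x).source) :
    ContDiffAt ℝ ∞ (fun z => chartAt E x ((chartAt E x').symm z)) y := by
  have h1 : ContMDiffAt 𝓘(ℝ, E) 𝓘(ℝ, E) ∞ (chartAt E x) ((chartAt E x').symm y) :=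
    (contMDiffOn_chart (I := 𝓘(ℝ, E)) (n := ∞)).contMDiffAt ((chartAt E x).open_source.mem_nhds hx)
  have h2 : ContMDiffAt 𝓘(ℝ, E) 𝓘(ℝ, E) ∞ (chartAt E x').symm y :=
    (contMDiffOn_chart_symm (I := 𝓘(ℝ, E)) (n := ∞)).contMDiffAt
      ((chartAt E x').open_target.mem_nhds hy)
  exact (ContMDiffAt.comp y h1 h2).contDiffAt

theorem jetContAt_inChart_of_chart {k : ℕ} {f : X → M → F} {a : X} {x x' : M} {y : E}
    (hy : y ∈ (chartAt E x').target) (hx : (chartAt E x').symm y ∈ (chartAt E x).source)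
    (h : JetContAt k (fun b => inChart x (f b)) a (chartAt E x ((chartAt E x').symm y))) :
    JetContAt k (fun b => inChart x' (f b)) a y := by
  have h1 : JetContAt k (fun _ : X => fun z => chartAt E x ((chartAt E x').symm z)) a y :=
    JetContAt.of_contDiffAt ((contDiffAt_transition hy hx).of_le (by exact_mod_cast le_top)) a
  refine (JetContAt.comp (S := fun b => inChart x (f b)) h h1).congr ?_
  have h2 : ∀ᶠ z in 𝓝 y, (chartAt E x').symm z ∈ (chartAt E x).source :=
    ((chartAt E x').continuousAt_symm hy).eventually ((chartAt E x).open_source.mem_nhds hx)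
  filter_upwards [continuousAt_snd.eventually h2] with p hp
  simp [inChart, (chartAt E x).left_inv hp]

end Charts

/-! ### The convex `C²`-neighbourhood of zero. -/

section SmallFunctions

variable {E : Type*} [NormedAddCommGroup E] [NormedSpace ℝ E]
  {M : Type*} [TopologicalSpace M] [ChartedSpace E M]

variable (E) in
/-- The smooth functions with small values and small second derivatives in finitely many charts. -/
def smallFun (t : Finset M) (r : M → ℝ) (c ε : ℝ) : Set (SmoothFun E M) :=
  {η | (∀ p, |η p| < ε) ∧ ∀ x ∈ t, ∀ y ∈ Metric.closedBall (chartAt E x x) (3 * r x),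
    ‖iteratedFDeriv ℝ 2 (inChart x η) y‖ < c}

theorem abs_fderiv_fderiv_le (f : E → ℝ) (y v w : E) :
    |fderiv ℝ (fderiv ℝ f) y v w| ≤ ‖iteratedFDeriv ℝ 2 f y‖ * ‖v‖ * ‖w‖ := by
  have h : ‖fderiv ℝ (fderiv ℝ f) y‖ = ‖iteratedFDeriv ℝ 2 f y‖ := by
    rw [← norm_iteratedFDeriv_fderiv (n := 1), ← norm_iteratedFDeriv_fderiv (n := 0),
      norm_iteratedFDeriv_zero]
  rw [← h, ← Real.norm_eq_abs]
  exact (fderiv ℝ (fderiv ℝ f) y).le_opNorm₂ v w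

theorem zero_mem_smallFun {t : Finset M} {r : M → ℝ} {c ε : ℝ} (hc : 0 < c) (hε : 0 < ε) :
    (0 : SmoothFun E M) ∈ smallFun E t r c ε := by
  refine ⟨fun p => ?_, fun x _ y _ => ?_⟩
  · rw [ContMDiffMap.coe_zero]
    simpa using hε
  · have : inChart (E := E) x ((0 : SmoothFun E M) : M → ℝ) = fun _ => (0 : ℝ) := rfl
    rw [this, iteratedFDeriv_const_of_ne (by norm_num)]
    simpa using hc

variable [IsManifold 𝓘(ℝ, E) ∞ M]

/-- Both conditions describe balls of seminorms. Convexity keeps the segment from `η` to `η + χ`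
inside the set, as the Taylor formula requires. -/
theorem convex_smallFun {t : Finset M} {r : M → ℝ} {c ε : ℝ}
    (hsub : ∀ x ∈ t, Metric.closedBall (chartAt E x x) (3 * r x) ⊆ (chartAt E x).target) :
    Convex ℝ (smallFun E t r c ε) := by
  intro η hη ζ hζ a b ha hb hab
  refine ⟨fun p => ?_, fun x hx y hy => ?_⟩
  · have h := convex_ball (0 : ℝ) ε (by simpa using hη.1 p) (by simpa using hζ.1 p) ha hb hab
    simpa using h
  · have h1 := contDiffAt_inChart_coe η x (hsub x hx hy)
    have h2 := contDiffAt_inChart_coe ζ x (hsub x hx hy)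
    have h1' : ContDiffAt ℝ (2 : ℕ) (inChart x η) y := h1.of_le (by norm_cast)
    have h2' : ContDiffAt ℝ (2 : ℕ) (inChart x ζ) y := h2.of_le (by norm_cast)
    have e : inChart (E := E) x ((a • η + b • ζ : SmoothFun E M) : M → ℝ) =
        a • inChart x η + b • inChart x ζ := rfl
    have h3 : ContDiffAt ℝ (2 : ℕ) (a • inChart x η) y := h1'.const_smul a
    have h4 : ContDiffAt ℝ (2 : ℕ) (b • inChart x ζ) y := h2'.const_smul b
    rw [e, iteratedFDeriv_add_apply h3 h4, iteratedFDeriv_const_smul_apply h1', iteratedFDeriv_const_smul_apply h2']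
    have h := convex_ball (0 : E [×2]→L[ℝ] ℝ) c (by simpa using hη.2 x hx y hy)
      (by simpa using hζ.2 x hx y hy) ha hb hab
    simpa using h

theorem isOpen_smallFun [FiniteDimensional ℝ E] {t : Finset M} {r : M → ℝ} {c ε : ℝ}
    (hsub : ∀ x ∈ t, Metric.closedBall (chartAt E x x) (3 * r x) ⊆ (chartAt E x).target)
    (hcov : ∀ p, ∃ x ∈ t, p ∈ (chartAt E x).source ∧
      chartAt E x p ∈ Metric.closedBall (chartAt E x x) (3 * r x)) {k : ℕ∞} (hk : 2 ≤ k) :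
    IsOpen (X := CkFun E M k) (smallFun E t r c ε) := by
  refine isOpen_iff_mem_nhds.2 fun η hη => ?_
  have h1 : ∀ᶠ ζ : CkFun E M k in 𝓝 η, ∀ x ∈ t,
      ∀ y ∈ Metric.closedBall (chartAt E x x) (3 * r x),
        |inChart x ζ.toSmoothFun y| < ε ∧ ‖iteratedFDeriv ℝ 2 (inChart x ζ.toSmoothFun) y‖ < c := by
    rw [Filter.eventually_all_finset]
    intro x hx
    refine (isCompact_closedBall (chartAt E x x) (3 * r x)).eventually_forall_of_forall_eventually
      fun y hy => ?_
    have h2 := isJetFamilyAt_of_ckFun (E := E) (M := M) (k := k) η (j := 2) (by exact_mod_cast hk)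
      x y (hsub x hx hy)
    refine (h2.continuousAt.abs.eventually_lt_const ?_).and
      ((h2.continuousAt_iteratedFDeriv le_rfl).norm.eventually_lt_const ?_)
    · exact hη.1 _
    · exact hη.2 x hx y hy
  filter_upwards [h1] with ζ hζ
  refine ⟨fun p => ?_, fun x hx y hy => (hζ x hx y hy).2⟩
  obtain ⟨x, hx, hp, hpx⟩ := hcov p
  have := (hζ x hx _ hpx).1
  rwa [inChart, (chartAt E x).left_inv hp] at this

end SmallFunctions

/-! ### Existence, uniqueness and regularity of the minimizer. -/

section Transform

variable {E : Type*} [NormedAddCommGroup E] [NormedSpace ℂ E]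
  {M : Type*} [TopologicalSpace M] [ChartedSpace E M] {Ω : TwoForm E M} {V : Set (M × M)}
  {D : M → M → ℝ} {t : Finset M} {r : M → ℝ} {c ε : ℝ} {η : SmoothFun E M} {q z x : M}

variable (E) in
/-- The minimizing point, in the chart at `x`. -/
def chartPoint (V : Set (M × M)) (D : M → M → ℝ) (x : M) (η : M → ℝ) (y : E) : E :=
  chartAt E x (legendrePoint V D η ((chartAt E x).symm y))

namespace LegendreChart

variable {r : ℝ}

theorem ball_subset (H : LegendreChart Ω V D x r c) {s : ℝ} (hs : s ≤ 4) :
    Metric.ball (chartAt E x x) (s * r) ⊆ Metric.ball (chartAt E x x) (4 * r) :=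
  Metric.ball_subset_ball (mul_le_mul_of_nonneg_right hs H.radius_pos.le)

theorem closedBall_subset (H : LegendreChart Ω V D x r c) {s : ℝ} (hs : s < 4) :
    Metric.closedBall (chartAt E x x) (s * r) ⊆ Metric.ball (chartAt E x x) (4 * r) :=
  Metric.closedBall_subset_ball (mul_lt_mul_of_pos_right hs H.radius_pos)

theorem symm_mem_chartBall (H : LegendreChart Ω V D x r c) {s : ℝ} (hs : s ≤ 4) {y : E}
    (hy : y ∈ Metric.ball (chartAt E x x) (s * r)) :
    (chartAt E x).symm y ∈ chartBall E x (s * r) := by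
  have hy' := H.subset (H.ball_subset hs hy)
  exact ⟨(chartAt E x).map_target hy', by rwa [mem_preimage, (chartAt E x).right_inv hy']⟩

end LegendreChart

namespace LegendreAtlas

theorem closedBall_subset_target (H : LegendreAtlas Ω V D t r c ε) (hx : x ∈ t) :
    Metric.closedBall (chartAt E x x) (3 * r x) ⊆ (chartAt E x).target :=
  ((H.chart x hx).closedBall_subset (by norm_num)).trans (H.chart x hx).subset

theorem chartBall_mono (H : LegendreAtlas Ω V D t r c ε) (hx : x ∈ t) {s s' : ℝ} (h : s ≤ s')
    (hq : q ∈ chartBall E x (s * r x)) : q ∈ chartBall E x (s' * r x) :=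
  ⟨hq.1, Metric.ball_subset_ball
    (mul_le_mul_of_nonneg_right h (H.chart x hx).radius_pos.le) hq.2⟩

theorem exists_mem_chartBall_two (H : LegendreAtlas Ω V D t r c ε) (q : M) :
    ∃ x ∈ t, q ∈ chartBall E x (2 * r x) := by
  obtain ⟨x, hx, hq⟩ := H.cover q
  exact ⟨x, hx, H.chartBall_mono hx (s := 1) (by norm_num) (by rwa [one_mul])⟩

theorem self_eq_zero (H : LegendreAtlas Ω V D t r c ε) (q : M) : (q, q) ∈ V ∧ D q q = 0 := by
  obtain ⟨x, hx, hq⟩ := H.exists_mem_chartBall_two q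
  have h4 := (H.chart x hx).ball_subset (by norm_num) hq.2
  have h1 := (H.chart x hx).mem _ h4 _ h4
  have h2 := (H.chart x hx).self _ h4
  rw [chartDiastasis] at h2
  rw [(chartAt E x).left_inv hq.1] at h1 h2
  exact ⟨h1, h2⟩

/-- A competitor `z` at least as good as `q` itself has `D z q ≤ η q - η z < 2 ε`. -/
theorem near_of_le (H : LegendreAtlas Ω V D t r c ε) (hη : η ∈ smallFun E t r c ε)
    (hz : (z, q) ∈ V) (hle : -η q ≤ -D z q - η z) (hx : x ∈ t) :
    (q ∈ chartBall E x (r x) → z ∈ chartBall E x (2 * r x)) ∧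
    (q ∈ chartBall E x (2 * r x) → z ∈ chartBall E x (3 * r x)) := by
  refine H.near z q hz ?_ x hx
  have h1 := abs_lt.1 (hη.1 q)
  have h2 := abs_lt.1 (hη.1 z)
  linarith [H.eps_pos]

theorem near_of_isAttainedAt (H : LegendreAtlas Ω V D t r c ε) (hη : η ∈ smallFun E t r c ε)
    (hz : IsAttainedAt V D η q z) (hx : x ∈ t) :
    (q ∈ chartBall E x (r x) → z ∈ chartBall E x (2 * r x)) ∧
    (q ∈ chartBall E x (2 * r x) → z ∈ chartBall E x (3 * r x)) := by
  refine H.near_of_le hη hz.1 ?_ hx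
  have := hz.2 q (H.self_eq_zero q).1
  rwa [(H.self_eq_zero q).2, neg_zero, zero_sub] at this

/-- The Hessian of the diastasis is at least `2 * c` and that of `η` is less than `c` in norm. -/
theorem totalHessian_lower (H : LegendreAtlas Ω V D t r c ε) (hη : η ∈ smallFun E t r c ε)
    (hx : x ∈ t) {z y : E} (hz : z ∈ Metric.ball (chartAt E x x) (3 * r x))
    (hy : y ∈ Metric.ball (chartAt E x x) (4 * r x)) (v : E) :
    c * ‖v‖ ^ 2 ≤ totalHessian (chartDiastasis E D x) (inChart x η) z y v v := by
  have HC := H.chart x hx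
  rw [totalHessian_apply]
  have h1 := (HC.hessian z (HC.ball_subset (by norm_num) hz) y hy v).1
  have h2 := (abs_le.1 (abs_fderiv_fderiv_le (inChart x η) z v v)).1
  have h3 := hη.2 x hx z (Metric.ball_subset_closedBall hz)
  have h4 : ‖iteratedFDeriv ℝ 2 (inChart x η) z‖ * ‖v‖ * ‖v‖ ≤ c * ‖v‖ * ‖v‖ := by gcongr
  nlinarith

variable [IsManifold 𝓘(ℝ, E) ∞ M]

theorem continuousAt_inChart_coe (η : SmoothFun E M) {y : E} (hy : y ∈ (chartAt E x).target) :
    ContinuousAt (inChart x η) y :=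
  (contDiffAt_inChart_coe η x hy).continuousAt

/-- Minimize over the closed ball of radius `3 * r x`. A point of `V` outside it does worse than
`q`, which belongs to the ball. -/
theorem exists_isAttainedAt [FiniteDimensional ℝ E] (H : LegendreAtlas Ω V D t r c ε)
    (hη : η ∈ smallFun E t r c ε) (q : M) : ∃ z, IsAttainedAt V D η q z := by
  obtain ⟨x, hx, hq⟩ := H.exists_mem_chartBall_two q
  have HC := H.chart x hx
  have hy := HC.ball_subset (by norm_num) hq.2
  set y := chartAt E x q
  have hyq : (chartAt E x).symm y = q := (chartAt E x).left_inv hq.1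
  have hK := HC.closedBall_subset (s := 3) (by norm_num)
  have hcont : ContinuousOn (fun z => chartDiastasis E D x (z, y) + inChart x η z)
      (Metric.closedBall (chartAt E x x) (3 * r x)) := fun z hz =>
    ((ContinuousAt.comp (f := fun z => (z, y)) (x := z)
      (HC.contDiffAt z (hK hz) y hy).continuousAt (by fun_prop)).add
      (continuousAt_inChart_coe η (HC.subset (hK hz)))).continuousWithinAt
  obtain ⟨z, hz, hmin⟩ := (isCompact_closedBall (chartAt E x x) (3 * r x)).exists_isMinOn
    ⟨y, Metric.ball_subset_closedBall (H.chartBall_mono hx (s' := 3) (by norm_num) hq).2⟩ hcont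
  have hmin' : ∀ p ∈ chartBall E x (3 * r x),
      D ((chartAt E x).symm z) q + η ((chartAt E x).symm z) ≤ D p q + η p := by
    intro p hp
    have h1 := isMinOn_iff.1 hmin _ (Metric.ball_subset_closedBall hp.2)
    simp only [chartDiastasis, inChart] at h1
    rwa [hyq, (chartAt E x).left_inv hp.1] at h1
  refine ⟨(chartAt E x).symm z, ?_, fun p hp => ?_⟩
  · rw [← hyq]
    exact HC.mem z (hK hz) y hy
  · by_cases hpq : -η q ≤ -D p q - η p
    · have := hmin' p ((H.near_of_le hη hp hpq hx).2 hq)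
      linarith
    · have h1 := hmin' q (H.chartBall_mono hx (by norm_num) hq)
      rw [(H.self_eq_zero q).2] at h1
      linarith

/-- An attained point is a critical point in the charts. -/
theorem critical_of_isAttainedAt (H : LegendreAtlas Ω V D t r c ε) (hη : η ∈ smallFun E t r c ε)
    (hx : x ∈ t) (hq : q ∈ chartBall E x (2 * r x)) (hz : IsAttainedAt V D η q z) (v : E) :
    fderiv ℝ (chartDiastasis E D x) (chartAt E x z, chartAt E x q) (v, 0) +
      fderiv ℝ (inChart x η) (chartAt E x z) v = 0 := by
  have HC := H.chart x hx
  have hz3 := (H.near_of_isAttainedAt hη hz hx).2 hq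
  have hy := HC.ball_subset (by norm_num) hq.2
  have hz4 := HC.ball_subset (by norm_num) hz3.2
  have hmin : IsLocalMin
      (fun w => chartDiastasis E D x (w, chartAt E x q) + inChart x η w) (chartAt E x z) := by
    filter_upwards [Metric.isOpen_ball.mem_nhds hz4] with w hw
    have h1 := HC.mem w hw _ hy
    rw [(chartAt E x).left_inv hq.1] at h1
    have h2 := hz.2 _ h1
    simp only [chartDiastasis, inChart]
    rw [(chartAt E x).left_inv hq.1, (chartAt E x).left_inv hz3.1]
    linarith
  have h1 : HasFDerivAt (fun w => chartDiastasis E D x (w, chartAt E x q)) _ (chartAt E x z) :=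
    HasFDerivAt.comp (f := fun w => (w, chartAt E x q)) (chartAt E x z)
      ((HC.contDiffAt _ hz4 _ hy).differentiableAt (by simp)).hasFDerivAt
      ((hasFDerivAt_id _).prodMk (hasFDerivAt_const _ _))
  have h2 := ((contDiffAt_inChart_coe η x (HC.subset hz4)).differentiableAt (by simp)).hasFDerivAt
  have h3 := hmin.hasFDerivAt_eq_zero (h1.add h2)
  exact congrArg (fun T : E →L[ℝ] ℝ => T v) h3

/-- Two minimizers lie in one convex chart ball, and strict convexity along the segment joining them
excludes a second one. -/
theorem isAttainedAt_unique (H : LegendreAtlas Ω V D t r c ε) (hη : η ∈ smallFun E t r c ε)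
    {z' : M} (hz : IsAttainedAt V D η q z) (hz' : IsAttainedAt V D η q z') : z = z' := by
  obtain ⟨x, hx, hq⟩ := H.exists_mem_chartBall_two q
  have HC := H.chart x hx
  have h3 := (H.near_of_isAttainedAt hη hz hx).2 hq
  have h3' := (H.near_of_isAttainedAt hη hz' hx).2 hq
  have hy := HC.ball_subset (by norm_num) hq.2
  set f : E → ℝ := fun w => chartDiastasis E D x (w, chartAt E x q) + inChart x η w with hf
  have hball : ∀ w ∈ Metric.ball (chartAt E x x) (3 * r x),
      w ∈ Metric.ball (chartAt E x x) (4 * r x) := fun w hw => HC.ball_subset (by norm_num) hw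
  have hcd : ∀ w ∈ Metric.ball (chartAt E x x) (3 * r x), ContDiffAt ℝ ∞ f w := fun w hw =>
    (ContDiffAt.comp (f := fun w => (w, chartAt E x q)) w
      (HC.contDiffAt w (hball w hw) _ hy) (contDiffAt_id.prodMk contDiffAt_const)).add
      (contDiffAt_inChart_coe η x (HC.subset (hball w hw)))
  have hfd : ∀ w ∈ Metric.ball (chartAt E x x) (3 * r x), HasFDerivAt f
      (fderiv ℝ (chartDiastasis E D x) (w, chartAt E x q) ∘L ContinuousLinearMap.inl ℝ E E +
        fderiv ℝ (inChart x η) w) w := fun w hw =>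
    (HasFDerivAt.comp (f := fun w => (w, chartAt E x q)) w
      ((HC.contDiffAt _ (hball w hw) _ hy).differentiableAt (by simp)).hasFDerivAt
      ((hasFDerivAt_id _).prodMk (hasFDerivAt_const _ _))).add
      ((contDiffAt_inChart_coe η x (HC.subset (hball w hw))).differentiableAt
        (by simp)).hasFDerivAt
  have hfdd : ∀ w ∈ Metric.ball (chartAt E x x) (3 * r x),
      fderiv ℝ (fderiv ℝ f) w =
        totalHessian (chartDiastasis E D x) (inChart x η) w (chartAt E x q) := by
    intro w hw
    have e1 : fderiv ℝ f =ᶠ[𝓝 w] fun w =>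
        fderiv ℝ (chartDiastasis E D x) (w, chartAt E x q) ∘L ContinuousLinearMap.inl ℝ E E +
        fderiv ℝ (inChart x η) w := by
      filter_upwards [Metric.isOpen_ball.mem_nhds hw] with w' hw' using (hfd w' hw').fderiv
    have e2 := hasFDerivAt_criticalEquation (F := chartDiastasis E D x) (f := inChart x η)
      (z := w) (y := chartAt E x q)
      ((HC.contDiffAt _ (hball w hw) _ hy).of_le (by norm_cast))
      ((contDiffAt_inChart_coe η x (HC.subset (hball w hw))).of_le (by norm_cast))
    have e3 := HasFDerivAt.comp (f := fun w => (w, chartAt E x q)) w e2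
      ((hasFDerivAt_id w).prodMk (hasFDerivAt_const (chartAt E x q) w))
    refine ((e3.congr_of_eventuallyEq e1).fderiv).trans ?_
    ext v w'
    simp [totalHessian]
  have hconv := convex_ball (chartAt E x x) (3 * r x)
  have hseg : ∀ s ∈ Icc (0 : ℝ) 1, chartAt E x z + s • (chartAt E x z' - chartAt E x z) ∈
      Metric.ball (chartAt E x x) (3 * r x) := fun s hs =>
    hconv.add_smul_sub_mem h3.2 h3'.2 hs
  have h := segment_lower_bound (g := f) (a := chartAt E x z)
    (v := chartAt E x z' - chartAt E x z)
    (m := c * ‖chartAt E x z' - chartAt E x z‖ ^ 2)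
    (fun s hs => (hcd _ (hseg s hs)).of_le (by norm_cast))
    (fun s hs => by
      rw [hfdd _ (hseg s hs)]
      exact H.totalHessian_lower hη hx (hseg s hs) hy _)
  have h0 : fderiv ℝ f (chartAt E x z) (chartAt E x z' - chartAt E x z) = 0 := by
    rw [(hfd _ h3.2).fderiv]
    exact H.critical_of_isAttainedAt hη hx hq hz _
  rw [h0, add_sub_cancel] at h
  have hv : ∀ {p : M}, p ∈ chartBall E x (3 * r x) → f (chartAt E x p) = D p q + η p := by
    intro p hp
    simp only [hf, chartDiastasis, inChart]
    rw [(chartAt E x).left_inv hq.1, (chartAt E x).left_inv hp.1]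
  rw [hv h3, hv h3'] at h
  have h5 := hz'.2 z hz.1
  have h6 : c * ‖chartAt E x z' - chartAt E x z‖ ^ 2 ≤ 0 := by linarith
  have h7 : ‖chartAt E x z' - chartAt E x z‖ ^ 2 ≤ 0 := by
    by_contra hcon
    rw [not_le] at hcon
    exact absurd h6 (not_le.2 (mul_pos H.const_pos hcon))
  have h8 : chartAt E x z' - chartAt E x z = 0 := by
    rw [← norm_eq_zero]
    exact pow_eq_zero_iff (two_ne_zero) |>.1 (le_antisymm h7 (sq_nonneg _))
  exact (chartAt E x).injOn h3.1 h3'.1 (sub_eq_zero.1 h8).symm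

variable [FiniteDimensional ℝ E]

theorem isAttainedAt_legendrePoint (H : LegendreAtlas Ω V D t r c ε)
    (hη : η ∈ smallFun E t r c ε) (q : M) : IsAttainedAt V D η q (legendrePoint V D η q) :=
  ComplexLegendre.isAttainedAt_legendrePoint (H.exists_isAttainedAt hη q)

theorem isAttainedAt_iff (H : LegendreAtlas Ω V D t r c ε) (hη : η ∈ smallFun E t r c ε)
    (q z : M) : IsAttainedAt V D η q z ↔ z = legendrePoint V D η q :=
  ⟨fun h => H.isAttainedAt_unique hη h (H.isAttainedAt_legendrePoint hη q),
    fun h => h ▸ H.isAttainedAt_legendrePoint hη q⟩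

theorem chartPoint_mem (H : LegendreAtlas Ω V D t r c ε) (hη : η ∈ smallFun E t r c ε)
    (hx : x ∈ t) {y : E} (hy : y ∈ Metric.ball (chartAt E x x) (2 * r x)) :
    legendrePoint V D η ((chartAt E x).symm y) ∈ chartBall E x (3 * r x) :=
  (H.near_of_isAttainedAt hη (H.isAttainedAt_legendrePoint hη _) hx).2
    ((H.chart x hx).symm_mem_chartBall (by norm_num) hy)

theorem isOpen_smallFun (H : LegendreAtlas Ω V D t r c ε) {k : ℕ∞} (hk : 2 ≤ k) :
    IsOpen (X := CkFun E M k) (smallFun E t r c ε) := by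
  refine ComplexLegendre.isOpen_smallFun (fun x hx => H.closedBall_subset_target hx) (fun p => ?_) hk
  obtain ⟨x, hx, hp⟩ := H.exists_mem_chartBall_two p
  exact ⟨x, hx, hp.1,
    Metric.ball_subset_closedBall (H.chartBall_mono hx (s' := 3) (by norm_num) hp).2⟩

/-- Verifies the hypotheses of the local theory with the function as parameter. Continuity of the
minimizer comes from its uniqueness over a compact ball, positivity from the Hessian bound. -/
theorem isCriticalFamilyAt (H : LegendreAtlas Ω V D t r c ε) {k : ℕ∞} (hk : 2 ≤ k)
    {a : CkFun E M k} (ha : a.toSmoothFun ∈ smallFun E t r c ε) (hx : x ∈ t) {y : E}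
    (hy : y ∈ Metric.ball (chartAt E x x) (2 * r x)) :
    IsCriticalFamilyAt (chartDiastasis E D x) (fun b : CkFun E M k => inChart x b.toSmoothFun)
      (fun b => chartPoint E V D x b.toSmoothFun) a y := by
  have HC := H.chart x hx
  have hev : ∀ᶠ p : CkFun E M k × E in 𝓝 (a, y), p.1.toSmoothFun ∈ smallFun E t r c ε ∧
      p.2 ∈ Metric.ball (chartAt E x x) (2 * r x) :=
    Filter.Eventually.and (continuousAt_fst.eventually ((H.isOpen_smallFun hk).mem_nhds ha))
      (continuousAt_snd.eventually (Metric.isOpen_ball.mem_nhds hy))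
  have h4 : ∀ {z : E}, z ∈ Metric.ball (chartAt E x x) (2 * r x) →
      z ∈ Metric.ball (chartAt E x x) (4 * r x) := fun hz => HC.ball_subset (by norm_num) hz
  have hg : ∀ {p : CkFun E M k × E}, p.1.toSmoothFun ∈ smallFun E t r c ε ∧
      p.2 ∈ Metric.ball (chartAt E x x) (2 * r x) →
      chartPoint E V D x p.1.toSmoothFun p.2 ∈ Metric.ball (chartAt E x x) (4 * r x) := fun hp =>
    HC.ball_subset (by norm_num) (H.chartPoint_mem hp.1 hx hp.2).2
  refine ⟨hev.mono fun p hp => HC.contDiffAt _ (hg hp) _ (h4 hp.2), hev.mono fun p hp v => ?_,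
    hev.mono fun p hp v hv => ?_, hev.eventually_nhds.mono fun p hp => ?_⟩
  · have := H.critical_of_isAttainedAt hp.1 hx (HC.symm_mem_chartBall (by norm_num) hp.2)
      (H.isAttainedAt_legendrePoint hp.1 _) v
    rwa [(chartAt E x).right_inv (HC.subset (h4 hp.2))] at this
  · have := H.totalHessian_lower hp.1 hx (H.chartPoint_mem hp.1 hx hp.2).2 (h4 hp.2) v
    have h0 : 0 < ‖v‖ := norm_pos_iff.2 hv
    exact lt_of_lt_of_le (mul_pos H.const_pos (by positivity)) this
  · have hp0 := hp.self_of_nhds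
    have hK := HC.closedBall_subset (s := 3) (by norm_num)
    have hval : ∀ {p : CkFun E M k × E}, p.1.toSmoothFun ∈ smallFun E t r c ε ∧
        p.2 ∈ Metric.ball (chartAt E x x) (2 * r x) →
        chartDiastasis E D x (chartPoint E V D x p.1.toSmoothFun p.2, p.2) +
          inChart x p.1.toSmoothFun (chartPoint E V D x p.1.toSmoothFun p.2) =
        -(-D (legendrePoint V D p.1.toSmoothFun ((chartAt E x).symm p.2))
          ((chartAt E x).symm p.2) -
          p.1.toSmoothFun (legendrePoint V D p.1.toSmoothFun ((chartAt E x).symm p.2))) := by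
      intro p hp
      simp only [chartDiastasis, inChart, chartPoint]
      rw [(chartAt E x).left_inv (H.chartPoint_mem hp.1 hx hp.2).1]
      ring
    refine continuousAt_argmin (isCompact_closedBall (chartAt E x x) (3 * r x))
      (f := fun p z => chartDiastasis E D x (z, p.2) + inChart x p.1.toSmoothFun z)
      (fun z hz => ?_) (hp.mono fun p' hp' =>
        Metric.ball_subset_closedBall (H.chartPoint_mem hp'.1 hx hp'.2).2)
      (hp.mono fun p' hp' z hz => ?_) fun z hz hne => ?_
    · have e1 : ContinuousAt (fun P : (CkFun E M k × E) × E => chartDiastasis E D x (P.2, P.1.2))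
          (p, z) :=
        ContinuousAt.comp (f := fun P : (CkFun E M k × E) × E => (P.2, P.1.2)) (x := (p, z))
          (HC.contDiffAt z (hK hz) p.2 (h4 hp0.2)).continuousAt (by fun_prop)
      have e2 : ContinuousAt (fun P : CkFun E M k × E => inChart x P.1.toSmoothFun P.2) (p.1, z) :=
        (isJetFamilyAt_of_ckFun (E := E) (M := M) (k := k) p.1 (j := 0) (by simp)
          x z (HC.subset (hK hz))).continuousAt
      exact e1.add (ContinuousAt.comp (f := fun P : (CkFun E M k × E) × E => (P.1.1, P.2))
        (x := (p, z)) e2 (by fun_prop))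
    · rw [hval hp']
      have := (H.isAttainedAt_legendrePoint hp'.1 ((chartAt E x).symm p'.2)).2 _
        (HC.mem z (hK hz) p'.2 (h4 hp'.2))
      simp only [chartDiastasis, inChart]
      linarith
    · rw [hval hp0]
      have hA := H.isAttainedAt_legendrePoint hp0.1 ((chartAt E x).symm p.2)
      have hzV := HC.mem z (hK hz) p.2 (h4 hp0.2)
      have h1 := hA.2 _ hzV
      simp only [chartDiastasis, inChart]
      by_contra hcon
      refine hne ?_
      have hz' : IsAttainedAt V D p.1.toSmoothFun ((chartAt E x).symm p.2)
          ((chartAt E x).symm z) := ⟨hzV, fun w hw => (hA.2 w hw).trans (by linarith)⟩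
      have := (H.isAttainedAt_iff hp0.1 _ _).1 hz'
      rw [chartPoint, ← this, (chartAt E x).right_inv (HC.subset (hK hz))]

end LegendreAtlas

end Transform

/-! ### The transform as a `C²`-continuous involution. -/

section Transform

variable {E : Type*} [NormedAddCommGroup E] [NormedSpace ℂ E]
  {M : Type*} [TopologicalSpace M] [ChartedSpace E M] {Ω : TwoForm E M} {V : Set (M × M)}
  {D : M → M → ℝ} {t : Finset M} {r : M → ℝ} {c ε : ℝ} {η : SmoothFun E M} {p q x : M}

variable (E) in
open Classical in
/-- A function, as an element of the space of smooth functions if it is smooth. -/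
def smoothOf (f : M → ℝ) : SmoothFun E M :=
  if h : ContMDiff 𝓘(ℝ, E) 𝓘(ℝ, ℝ) ∞ f then (⟨f, h⟩ : C^∞⟮𝓘(ℝ, E), M; 𝓘(ℝ, ℝ), ℝ⟯) else 0

theorem coe_smoothOf {f : M → ℝ} (hf : ContMDiff 𝓘(ℝ, E) 𝓘(ℝ, ℝ) ∞ f) :
    (smoothOf E f : M → ℝ) = f := by
  have : smoothOf E f = (⟨f, hf⟩ : C^∞⟮𝓘(ℝ, E), M; 𝓘(ℝ, ℝ), ℝ⟯) := dif_pos hf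
  rw [this]
  rfl

/-- The Legendre transform of a smooth function, if it is smooth. -/
def legendreFun (V : Set (M × M)) (D : M → M → ℝ) (η : SmoothFun E M) : SmoothFun E M :=
  smoothOf E (legendreVal V D η)

/-- The small functions with small Legendre transform. -/
def legendreSet (V : Set (M × M)) (D : M → M → ℝ) (t : Finset M) (r : M → ℝ) (c ε : ℝ) :
    Set (SmoothFun E M) :=
  {η | η ∈ smallFun E t r c ε ∧ legendreFun V D η ∈ smallFun E t r c ε}

namespace LegendreAtlas

variable [IsManifold 𝓘(ℝ, E) ∞ M] [FiniteDimensional ℝ E]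

theorem legendreVal_zero (H : LegendreAtlas Ω V D t r c ε) (q : M) :
    legendreVal V D (0 : SmoothFun E M) q = 0 := by
  have h0 : (0 : SmoothFun E M) ∈ smallFun E t r c ε := zero_mem_smallFun H.const_pos H.eps_pos
  obtain ⟨x, hx, hq⟩ := H.exists_mem_chartBall_two q
  have HC := H.chart x hx
  have hA := H.isAttainedAt_legendrePoint h0 q
  have h3 := (H.near_of_isAttainedAt h0 hA hx).2 hq
  have h1 := HC.nonneg _ (HC.ball_subset (by norm_num) h3.2) _ (HC.ball_subset (by norm_num) hq.2)
  rw [chartDiastasis, (chartAt E x).left_inv h3.1, (chartAt E x).left_inv hq.1] at h1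
  have h2 := hA.2 q (H.self_eq_zero q).1
  rw [(H.self_eq_zero q).2] at h2
  rw [ContMDiffMap.coe_zero] at h1
  simp only [legendreVal, ContMDiffMap.coe_zero, Pi.zero_apply] at h2 ⊢
  linarith

theorem inChart_legendreVal (H : LegendreAtlas Ω V D t r c ε) (hη : η ∈ smallFun E t r c ε)
    (hx : x ∈ t) {y : E} (hy : y ∈ Metric.ball (chartAt E x x) (2 * r x)) :
    inChart x (legendreVal V D η) y =
      -chartDiastasis E D x (chartPoint E V D x η y, y) - inChart x η (chartPoint E V D x η y) := by
  simp only [chartDiastasis, inChart, chartPoint]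
  rw [(chartAt E x).left_inv (H.chartPoint_mem hη hx hy).1]
  rfl

/-- Orders at least two come from the regularity of critical values in some chart of the atlas;
lower orders follow from order two. -/
theorem legendreVal_jetContAt (H : LegendreAtlas Ω V D t r c ε) {k : ℕ∞} (hk : 2 ≤ k)
    {a : CkFun E M k} (ha : a.toSmoothFun ∈ smallFun E t r c ε) {j : ℕ} (hj : (j : ℕ∞) ≤ k)
    {y : E} (hy : y ∈ (chartAt E x).target) :
    JetContAt j (fun b : CkFun E M k => inChart x (legendreVal V D b.toSmoothFun)) a y := by
  obtain ⟨x', hx', hq⟩ := H.exists_mem_chartBall_two ((chartAt E x).symm y)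
  refine jetContAt_inChart_of_chart (x := x') hy hq.1 ?_
  have HC := H.chart x' hx'
  have hI := H.isCriticalFamilyAt hk ha hx' hq.2
  have hev : ∀ᶠ p : CkFun E M k × E in 𝓝 (a, chartAt E x' ((chartAt E x).symm y)),
      p.1.toSmoothFun ∈ smallFun E t r c ε ∧ p.2 ∈ Metric.ball (chartAt E x' x') (2 * r x') :=
    Filter.Eventually.and (continuousAt_fst.eventually ((H.isOpen_smallFun hk).mem_nhds ha))
      (continuousAt_snd.eventually (Metric.isOpen_ball.mem_nhds hq.2))
  have hmem : chartPoint E V D x' a.toSmoothFun (chartAt E x' ((chartAt E x).symm y)) ∈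
      (chartAt E x').target :=
    HC.subset (HC.ball_subset (by norm_num) (H.chartPoint_mem ha hx' hq.2).2)
  have key : ∀ i : ℕ, ((i + 2 : ℕ) : ℕ∞) ≤ k → JetContAt (i + 2)
      (fun b : CkFun E M k => inChart x' (legendreVal V D b.toSmoothFun)) a
      (chartAt E x' ((chartAt E x).symm y)) := by
    intro i hi
    refine (hI.value_jetContAt (isJetFamilyAt_of_ckFun a hi x' _ hmem)).congr ?_
    exact hev.mono fun p hp => (H.inChart_legendreVal hp.1 hx' hp.2).symm
  rcases le_or_gt 2 j with h | h
  · obtain ⟨i, rfl⟩ := Nat.exists_eq_add_of_le' h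
    exact key i hj
  · exact (key 0 (by simpa using hk)).of_le h.le

theorem contMDiff_legendreVal (H : LegendreAtlas Ω V D t r c ε) (hη : η ∈ smallFun E t r c ε) :
    ContMDiff 𝓘(ℝ, E) 𝓘(ℝ, ℝ) ∞ (legendreVal V D η) := fun p =>
  contMDiffAt_of_inChart (mem_chart_source E p) <| contDiffAt_infty.2 fun _ =>
    (H.legendreVal_jetContAt (k := ⊤) le_top (a := η) hη le_top (mem_chart_target E p)).contDiffAt

theorem coe_legendreFun (H : LegendreAtlas Ω V D t r c ε) (hη : η ∈ smallFun E t r c ε) :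
    (legendreFun V D η : M → ℝ) = legendreVal V D η :=
  coe_smoothOf (H.contMDiff_legendreVal hη)

theorem isJetFamilyAt_legendreFun (H : LegendreAtlas Ω V D t r c ε) {k : ℕ∞} (hk : 2 ≤ k)
    {a : CkFun E M k} (ha : a.toSmoothFun ∈ smallFun E t r c ε) {j : ℕ} (hj : (j : ℕ∞) ≤ k) :
    IsJetFamilyAt j (fun b : CkFun E M k => legendreFun V D b.toSmoothFun) a := fun x y hy => by
  refine (H.legendreVal_jetContAt hk ha hj hy).congr ?_
  filter_upwards [continuousAt_fst.eventually ((H.isOpen_smallFun hk).mem_nhds ha)] with b hb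
  rw [H.coe_legendreFun (η := b.1.toSmoothFun) hb]

theorem legendreFun_zero (H : LegendreAtlas Ω V D t r c ε) :
    legendreFun V D (0 : SmoothFun E M) = 0 := by
  refine DFunLike.coe_injective ?_
  rw [H.coe_legendreFun (zero_mem_smallFun H.const_pos H.eps_pos)]
  exact funext H.legendreVal_zero

/-- The supremum is already continuous, so the upper semicontinuous regularization changes nothing.
-/
theorem legendre_eq (H : LegendreAtlas Ω V D t r c ε) (hη : η ∈ smallFun E t r c ε) (q : M) :
    ((legendreFun V D η q : ℝ) : EReal) = legendre V D (fun p => ((η p : ℝ) : EReal)) q := by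
  have h1 : (fun q => ⨆ (p : M) (_ : (p, q) ∈ V), (-(D p q : EReal) - ((η p : ℝ) : EReal))) =
      fun q => ((legendreFun V D η q : ℝ) : EReal) := by
    funext q
    rw [H.coe_legendreFun hη]
    exact iSup_eq_legendreVal (H.exists_isAttainedAt hη q)
  rw [legendre, h1, uscReg]
  have h2 : Continuous fun q => ((legendreFun V D η q : ℝ) : EReal) :=
    continuous_coe_real_ereal.comp (legendreFun V D η).contMDiff.continuous
  exact (h2.continuousAt (x := q)).tendsto.limsup_eq.symm

theorem zero_mem_legendreSet (H : LegendreAtlas Ω V D t r c ε) :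
    (0 : SmoothFun E M) ∈ legendreSet V D t r c ε := by
  have h0 : (0 : SmoothFun E M) ∈ smallFun E t r c ε := zero_mem_smallFun H.const_pos H.eps_pos
  exact ⟨h0, by rwa [H.legendreFun_zero]⟩

/-- The transform is continuous for the `C²`-topology on both sides, so smallness of the transform
is an open condition. -/
theorem isOpen_legendreSet (H : LegendreAtlas Ω V D t r c ε) :
    IsOpen (X := CkFun E M 2) (legendreSet V D t r c ε) := by
  refine isOpen_iff_mem_nhds.2 fun η hη => ?_
  have h1 : Tendsto (fun b : CkFun E M 2 => legendreFun V D b.toSmoothFun) (𝓝 η)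
      (@nhds _ (ckTopology E M 2) (legendreFun V D (CkFun.toSmoothFun η))) :=
    IsJetFamilyAt.tendsto fun j hj => H.isJetFamilyAt_legendreFun le_rfl hη.1 hj
  filter_upwards [(H.isOpen_smallFun le_rfl).mem_nhds hη.1,
    h1 ((H.isOpen_smallFun (k := 2) le_rfl).mem_nhds hη.2)] with b hb hb' using ⟨hb, hb'⟩

/-- The Legendre transform is an involution. -/
theorem legendreVal_legendreFun (H : LegendreAtlas Ω V D t r c ε)
    (hη : η ∈ legendreSet V D t r c ε) (p : M) :
    legendreVal V D (legendreFun V D η) p = η p := by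
  obtain ⟨x, hx, hp⟩ := H.cover p
  have HC := H.chart x hx
  set q := legendrePoint V D (legendreFun V D η) p with hq
  set p' := legendrePoint V D η q with hp'
  have hAq : IsAttainedAt V D (legendreFun V D η) p q := H.isAttainedAt_legendrePoint hη.2 p
  have hAp : IsAttainedAt V D η q p' := H.isAttainedAt_legendrePoint hη.1 q
  have hp2 : p ∈ chartBall E x (2 * r x) :=
    H.chartBall_mono hx (s := 1) (by norm_num) (by rwa [one_mul])
  -- The radius grows from `r` to `2 r` to `3 r` in two successive minimizations; this is why the
  -- atlas records two inclusions.
  have hq2 := (H.near_of_isAttainedAt hη.2 hAq hx).1 hp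
  have hp3' := (H.near_of_isAttainedAt hη.1 hAp hx).2 hq2
  have hp4 := HC.ball_subset (by norm_num) hp2.2
  have hq4 := HC.ball_subset (by norm_num) hq2.2
  have hp4' := HC.ball_subset (by norm_num) hp3'.2
  have hqs : (chartAt E x).symm (chartAt E x q) = q := (chartAt E x).left_inv hq2.1
  have hcp : chartPoint E V D x η (chartAt E x q) = chartAt E x p' := by
    rw [chartPoint, hqs]
  have hI := H.isCriticalFamilyAt (k := ⊤) le_top (a := η) hη.1 hx hq2.2
  have hmem : chartPoint E V D x η (chartAt E x q) ∈ (chartAt E x).target := by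
    rw [hcp]
    exact HC.subset hp4'
  have h1 := (hI.hasFDerivAt_value (isJetFamilyAt_of_ckFun (E := E) (M := M) (k := ⊤) η (j := 2)
    le_top x _ hmem)).self_of_nhds
  have h2 : inChart x (legendreFun V D η) =ᶠ[𝓝 (chartAt E x q)] fun z =>
      -chartDiastasis E D x (chartPoint E V D x η z, z) -
        inChart x η (chartPoint E V D x η z) := by
    filter_upwards [Metric.isOpen_ball.mem_nhds hq2.2] with z hz
    rw [H.coe_legendreFun hη.1]
    exact H.inChart_legendreVal hη.1 hx hz
  have h3 := (h1.congr_of_eventuallyEq h2).fderiv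
  have hcrit := fun v => H.critical_of_isAttainedAt hη.2 hx hp2 hAq v
  -- The critical equation at `q` for the transform of `η`, with the differential of that transform
  -- given by the envelope formula at `p'`.
  have h4 : ∀ v, fderiv ℝ (chartDiastasis E D x) (chartAt E x q, chartAt E x p) (v, 0) =
      fderiv ℝ (chartDiastasis E D x) (chartAt E x p', chartAt E x q) (0, v) := by
    intro v
    have e := hcrit v
    rw [h3] at e
    change _ + -(fderiv ℝ (chartDiastasis E D x)
      (chartPoint E V D x η (chartAt E x q), chartAt E x q) (0, v)) = 0 at e
    rw [hcp] at e
    linarith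
  have h5 : ∀ v, fderiv ℝ (chartDiastasis E D x) (chartAt E x p', chartAt E x q) (0, v) =
      fderiv ℝ (chartDiastasis E D x) (chartAt E x q, chartAt E x p') (v, 0) := by
    intro v
    have e1 : HasFDerivAt (fun z : E × E => chartDiastasis E D x (z.2, z.1)) _
        (chartAt E x p', chartAt E x q) :=
      HasFDerivAt.comp (f := fun z : E × E => (z.2, z.1)) (chartAt E x p', chartAt E x q)
        ((HC.contDiffAt _ hq4 _ hp4').differentiableAt (by simp)).hasFDerivAt
        (hasFDerivAt_snd.prodMk hasFDerivAt_fst)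
    have e2 : chartDiastasis E D x =ᶠ[𝓝 (chartAt E x p', chartAt E x q)]
        fun z : E × E => chartDiastasis E D x (z.2, z.1) := by
      filter_upwards [(Metric.isOpen_ball.prod Metric.isOpen_ball).mem_nhds
        (show (chartAt E x p', chartAt E x q) ∈ Metric.ball (chartAt E x x) (4 * r x) ×ˢ
          Metric.ball (chartAt E x x) (4 * r x) from ⟨hp4', hq4⟩)] with z hz
      exact HC.symm z.1 hz.1 z.2 hz.2
    rw [(e1.congr_of_eventuallyEq e2).fderiv]
    rfl
  -- On the segment from `p` to `p'` the derivative `∂₁D(q, ·) v` is strictly decreasing, by the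
  -- negative mixed Hessian, yet has equal values at the ends; so `v = 0`.
  set v := chartAt E x p' - chartAt E x p with hv
  have hconv := convex_ball (chartAt E x x) (4 * r x)
  let g : ℝ → ℝ := fun s => fderiv ℝ (chartDiastasis E D x)
    (chartAt E x q, chartAt E x p + s • v) (v, 0)
  have hseg : ∀ s ∈ Icc (0 : ℝ) 1, chartAt E x p + s • v ∈ Metric.ball (chartAt E x x) (4 * r x) :=
    fun s hs => hconv.add_smul_sub_mem hp4 hp4' hs
  have hg : ∀ s ∈ Icc (0 : ℝ) 1, HasDerivAt g (fderiv ℝ (fderiv ℝ (chartDiastasis E D x))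
      (chartAt E x q, chartAt E x p + s • v) (0, v) (v, 0)) s := by
    intro s hs
    have hcd := (HC.contDiffAt _ hq4 _ (hseg s hs)).of_le (m := 2) (by norm_cast)
    have e := hasDerivAt_fderiv_segment (g := chartDiastasis E D x)
      (a := (chartAt E x q, chartAt E x p)) (v := (0, v)) (w := (v, 0)) (t := s) (by
        simpa using hcd)
    simpa using e
  have hv0 : v = 0 := by
    by_contra hne
    have hlt : g 1 < g 0 := by
      refine strictAntiOn_of_deriv_neg (convex_Icc (0 : ℝ) 1)
        (fun s hs => (hg s hs).continuousAt.continuousWithinAt) (fun s hs => ?_)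
        (left_mem_Icc.2 zero_le_one) (right_mem_Icc.2 zero_le_one) zero_lt_one
      rw [interior_Icc] at hs
      have hs' := Ioo_subset_Icc_self hs
      rw [(hg s hs').deriv]
      refine lt_of_le_of_lt (HC.hessian _ hq4 _ (hseg s hs') v).2 (neg_neg_of_pos ?_)
      have := H.const_pos
      have := norm_pos_iff.2 hne
      positivity
    have : g 1 = g 0 := by
      simp only [g, hv, one_smul, zero_smul, add_zero, add_sub_cancel]
      rw [h4, h5]
    exact absurd this hlt.ne
  have hpp : p' = p := (chartAt E x).injOn hp3'.1 hp.1 (sub_eq_zero.1 hv0)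
  have e1 : legendreVal V D (legendreFun V D η) p = -D q p - legendreFun V D η q := rfl
  have e2 : legendreFun V D η q = -D p' q - η p' := by
    rw [H.coe_legendreFun hη.1]
    rfl
  have e3 := HC.symm _ hp4 _ hq4
  simp only [chartDiastasis] at e3
  rw [(chartAt E x).left_inv hp.1, hqs] at e3
  rw [e1, e2, hpp]
  linarith

/-- The two defining conditions are exchanged by the involution. -/
theorem mapsTo_legendreSet (H : LegendreAtlas Ω V D t r c ε) :
    MapsTo (legendreFun V D) (legendreSet V D t r c ε : Set (SmoothFun E M))
      (legendreSet V D t r c ε) := by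
  intro η hη
  refine ⟨hη.2, ?_⟩
  have : legendreFun V D (legendreFun V D η) = η := by
    refine DFunLike.coe_injective ?_
    rw [H.coe_legendreFun hη.2]
    exact funext (H.legendreVal_legendreFun hη)
  rw [this]
  exact hη.1

end LegendreAtlas

/-- `i∂∂̄η` on `(w, iw)` is the mean of the Hessian of `η` on `w` and on `iw`, hence greater than
`-c ‖w‖²` for `w ≠ 0`, while the Kähler form is at least `2 c ‖w‖²`. -/
theorem LegendreAtlas.smallFun_subset [IsManifold 𝓘(ℂ, E) ω M] [FiniteDimensional ℂ E]
    (H : LegendreAtlas Ω V D t r c ε) : smallFun E t r c ε ⊆ kahlerPotentials Ω := by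
  have hR : IsManifold 𝓘(ℝ, E) ω M := isManifold_real E M
  have hR' : IsManifold 𝓘(ℝ, E) ∞ M := .of_le (n := ω) le_top
  intro η hη p v hv
  obtain ⟨x, hx, hp⟩ := H.exists_mem_chartBall_two p
  have HC := H.chart x hx
  have hp3 : chartAt E x p ∈ Metric.ball (chartAt E x x) (3 * r x) :=
    (H.chartBall_mono hx (s' := 3) (by norm_num) hp).2
  have hp4 := HC.ball_subset (by norm_num) hp3
  have hy := HC.subset hp4
  set y := chartAt E x p with hy_def
  have hyp : (chartAt E x).symm y = p := (chartAt E x).left_inv hp.1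
  clear_value y
  subst hyp
  obtain ⟨w, rfl⟩ := (LinearMap.injective_iff_surjective (f := (symmDeriv x y).toLinearMap)).1
    (injective_symmDeriv hy) v
  have hw : w ≠ 0 := by
    rintro rfl
    exact hv (map_zero (symmDeriv x y))
  have e1 : chartForm Ω x y w (Complex.I • w) = Ω ((chartAt E x).symm y)
      ![symmDeriv x y w, J ((chartAt E x).symm y) (symmDeriv x y w)] := by
    rw [chartForm_apply, symmDeriv_I hy]
    rfl
  have e2 : levi (inChart x η) y w (Complex.I • w) =
      ddbar (η : M → ℝ) ((chartAt E x).symm y) (symmDeriv x y w)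
        (J ((chartAt E x).symm y) (symmDeriv x y w)) := by
    rw [levi_inChart hy, symmDeriv_I hy]
    · rfl
    · exact (contDiffAt_inChart_coe η ((chartAt E x).symm y)
        (mem_chart_target E ((chartAt E x).symm y))).of_le (by norm_cast)
  refine lt_of_lt_of_eq ?_ (congrArg₂ (· + ·) e1 e2)
  have h1 := HC.form y hp4 w
  have h2 := hη.2 x hx y (Metric.ball_subset_closedBall hp3)
  have h3 := (abs_le.1 (abs_fderiv_fderiv_le (inChart x η) y w w)).1
  have h4 := (abs_le.1 (abs_fderiv_fderiv_le (inChart x η) y (Complex.I • w) (Complex.I • w))).1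
  have h5 : ‖iteratedFDeriv ℝ 2 (inChart x η) y‖ * ‖w‖ * ‖w‖ ≤ c * ‖w‖ * ‖w‖ := by gcongr
  have h6 : ‖Complex.I • w‖ = ‖w‖ := by rw [norm_smul, Complex.norm_I, one_mul]
  rw [h6] at h4
  have h7 : levi (inChart x η) y w (Complex.I • w) =
      (fderiv ℝ (fderiv ℝ (inChart x η)) y (Complex.I • w) (Complex.I • w) +
        fderiv ℝ (fderiv ℝ (inChart x η)) y w w) / 2 := by
    rw [levi, smul_smul, Complex.I_mul_I, neg_one_smul, map_neg]
    ring
  rw [h7]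
  have h8 : 0 < c * ‖w‖ ^ 2 := by
    have := H.const_pos
    have := norm_pos_iff.2 hw
    positivity
  nlinarith

end Transform

/-! ### Moving critical points by a linear perturbation. -/

section ParameterDerivative

variable {E : Type*} [NormedAddCommGroup E] [NormedSpace ℝ E] [FiniteDimensional ℝ E]
  {F : E × E → ℝ} {e f : E → ℝ} {g : ℝ → E} {y : E}

/-- The derivative of critical points of `F (·, y) + e + s f` with respect to `s`, paired with
the differential of `f`. -/
theorem hasDerivAt_comp_critical (hF : ContDiffAt ℝ 2 F (g 0, y)) (he : ContDiffAt ℝ 2 e (g 0))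
    (hf : ContDiffAt ℝ 2 f (g 0)) (hg : ContinuousAt g 0)
    (hcrit : ∀ᶠ s in 𝓝 (0 : ℝ), ∀ v,
      fderiv ℝ F (g s, y) (v, 0) + fderiv ℝ e (g s) v + s * fderiv ℝ f (g s) v = 0)
    (hpos : ∀ v, v ≠ 0 → 0 < totalHessian F e (g 0) y v v) :
    HasDerivAt (fun s => f (g s))
      (-(fderiv ℝ f (g 0) ((totalHessian F e (g 0) y).inverse (fderiv ℝ f (g 0))))) 0 := by
  have h1 := hasFDerivAt_criticalEquation hF he
  have h2 : HasFDerivAt (fun p : E × ℝ =>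
      fderiv ℝ F (p.1, y) ∘L ContinuousLinearMap.inl ℝ E E + fderiv ℝ e p.1) _ (g 0, (0 : ℝ)) :=
    HasFDerivAt.comp (f := fun p : E × ℝ => (p.1, y)) (g 0, (0 : ℝ)) h1
      (hasFDerivAt_fst.prodMk (hasFDerivAt_const y _))
  have h3 : HasFDerivAt (fderiv ℝ f) (fderiv ℝ (fderiv ℝ f) (g 0)) (g 0) :=
    ((hf.fderiv_right (m := 1) (by norm_num)).differentiableAt (by simp)).hasFDerivAt
  have h4 : HasFDerivAt (fun p : E × ℝ => p.2 • fderiv ℝ f p.1) _ (g 0, (0 : ℝ)) :=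
    HasFDerivAt.smul hasFDerivAt_snd
      (HasFDerivAt.comp (f := Prod.fst) (g 0, (0 : ℝ)) h3 hasFDerivAt_fst)
  have h5 := hasFDerivAt_of_implicit (S := (totalHessian F e (g 0) y).inverse) (h2.add h4) hg
    (by
      filter_upwards [hcrit] with s hs
      ext v
      exact hs v)
    (fun v => by
      refine Eq.trans (congrArg _ ?_) (inverse_apply_of_pos hpos v)
      ext w
      simp [totalHessian])
  have h6 := (hf.differentiableAt (by simp)).hasFDerivAt.comp_hasDerivAt (0 : ℝ) h5.hasDerivAt
  refine h6.congr_deriv ?_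
  have h7 : ((0 : E), (0 : E)) = 0 := rfl
  simp [h7]

end ParameterDerivative

/-! ### Taylor expansion and differential of the transform. -/

section Transform

variable {E : Type*} [NormedAddCommGroup E] [NormedSpace ℂ E]
  {M : Type*} [TopologicalSpace M] [ChartedSpace E M] {Ω : TwoForm E M} {V : Set (M × M)}
  {D : M → M → ℝ} {t : Finset M} {r : M → ℝ} {c ε : ℝ} {η : SmoothFun E M} {p q x : M}

/-- The second variation of the Legendre transform at `η` in the direction `ζ`. -/
def secondVariation (V : Set (M × M)) (D : M → M → ℝ) (η ζ : SmoothFun E M) (q : M) : ℝ :=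
  -deriv (fun s : ℝ => ζ (legendrePoint V D (η + s • ζ : SmoothFun E M) q)) 0

theorem secondVariation_smul (η ζ : SmoothFun E M) (a : ℝ) (q : M) :
    secondVariation V D η (a • ζ) q = a ^ 2 * secondVariation V D η ζ q := by
  have h1 : (fun s : ℝ => (a • ζ : SmoothFun E M)
      (legendrePoint V D (η + s • (a • ζ) : SmoothFun E M) q)) =
      fun s : ℝ => a * (fun s : ℝ => ζ (legendrePoint V D (η + s • ζ : SmoothFun E M) q)) (a * s) := by
    funext s
    rw [smul_smul, mul_comm s a, ContMDiffMap.coe_smul]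
    rfl
  rw [secondVariation, h1, deriv_const_mul_field,
    deriv_comp_mul_left a (fun s : ℝ => ζ (legendrePoint V D (η + s • ζ : SmoothFun E M) q)) 0,
    secondVariation, mul_zero, smul_eq_mul]
  ring

/-- The remainder of the first order Taylor expansion of the Legendre transform. -/
def taylorRemainder (V : Set (M × M)) (D : M → M → ℝ) (η χ ζ : SmoothFun E M) (q : M) : ℝ :=
  ∫ s in (0 : ℝ)..1, (1 - s) • secondVariation V D (η + s • χ) ζ q

theorem taylorRemainder_smul (η χ ζ : SmoothFun E M) (a : ℝ) (q : M) :
    taylorRemainder V D η χ (a • ζ) q = a ^ 2 * taylorRemainder V D η χ ζ q := by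
  simp only [taylorRemainder, secondVariation_smul, smul_eq_mul]
  rw [← intervalIntegral.integral_const_mul]
  congr 1
  funext s
  ring

namespace LegendreAtlas

variable [IsManifold 𝓘(ℝ, E) ∞ M] [FiniteDimensional ℝ E]

theorem isCriticalFamilyAt_smoothFun (H : LegendreAtlas Ω V D t r c ε)
    (hη : η ∈ smallFun E t r c ε) (hx : x ∈ t) {y : E}
    (hy : y ∈ Metric.ball (chartAt E x x) (2 * r x)) :
    IsCriticalFamilyAt (chartDiastasis E D x) (fun b : SmoothFun E M => inChart x b)
      (fun b : SmoothFun E M => chartPoint E V D x b) η y :=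
  H.isCriticalFamilyAt (k := ⊤) le_top (a := η) hη hx hy

theorem isOpen_smallFun_top (H : LegendreAtlas Ω V D t r c ε) :
    IsOpen (smallFun E t r c ε : Set (SmoothFun E M)) :=
  H.isOpen_smallFun (k := ⊤) le_top

theorem eventually_add_smul_mem (H : LegendreAtlas Ω V D t r c ε) (hη : η ∈ smallFun E t r c ε)
    (ζ : SmoothFun E M) : ∀ᶠ s in 𝓝 (0 : ℝ), η + s • ζ ∈ smallFun E t r c ε := by
  have h : Continuous fun s : ℝ => η + s • ζ := by fun_prop
  exact (h.tendsto' 0 η (by simp)).eventually (H.isOpen_smallFun_top.mem_nhds hη)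

theorem chartPoint_mem_target (H : LegendreAtlas Ω V D t r c ε) (hη : η ∈ smallFun E t r c ε)
    (hx : x ∈ t) {y : E} (hy : y ∈ Metric.ball (chartAt E x x) (2 * r x)) :
    chartPoint E V D x η y ∈ (chartAt E x).target :=
  (H.chart x hx).subset ((H.chart x hx).ball_subset (by norm_num) (H.chartPoint_mem hη hx hy).2)

theorem inChart_chartPoint (H : LegendreAtlas Ω V D t r c ε) (hη : η ∈ smallFun E t r c ε)
    (hx : x ∈ t) {y : E} (hy : y ∈ Metric.ball (chartAt E x x) (2 * r x)) (f : M → ℝ) :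
    inChart x f (chartPoint E V D x η y) = f (legendrePoint V D η ((chartAt E x).symm y)) := by
  rw [inChart, chartPoint, (chartAt E x).left_inv (H.chartPoint_mem hη hx hy).1]

theorem hasDerivAt_comp_legendrePoint_chart (H : LegendreAtlas Ω V D t r c ε)
    (hη : η ∈ smallFun E t r c ε) (ζ : SmoothFun E M) (hx : x ∈ t) {y : E}
    (hy : y ∈ Metric.ball (chartAt E x x) (2 * r x)) :
    HasDerivAt
      (fun s : ℝ => ζ (legendrePoint V D (η + s • ζ : SmoothFun E M) ((chartAt E x).symm y)))
      (-(fderiv ℝ (inChart x ζ) (chartPoint E V D x η y)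
        ((totalHessian (chartDiastasis E D x) (inChart x η) (chartPoint E V D x η y) y).inverse
          (fderiv ℝ (inChart x ζ) (chartPoint E V D x η y))))) 0 := by
  have hI := H.isCriticalFamilyAt_smoothFun hη hx hy
  let g : ℝ → E := fun s => chartPoint E V D x (η + s • ζ : SmoothFun E M) y
  have hη0 : η + (0 : ℝ) • ζ = η := by simp
  have hg0 : g 0 = chartPoint E V D x η y := by
    simp only [g]
    rw [hη0]
  have hev := H.eventually_add_smul_mem hη ζ
  have hT := H.chartPoint_mem_target hη hx hy
  have hcg : ContinuousAt g 0 :=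
    ContinuousAt.comp (f := fun s : ℝ => ((η + s • ζ : SmoothFun E M), y)) (x := 0)
      (g := fun p : SmoothFun E M × E => chartPoint E V D x p.1 p.2)
      (by rw [hη0]; exact hI.continuousAt.self_of_nhds)
      (by fun_prop)
  have key := hasDerivAt_comp_critical (F := chartDiastasis E D x) (e := inChart x η)
    (f := inChart x ζ) (g := g) (y := y)
    (by rw [hg0]; exact hI.contDiffAt.self_of_nhds.of_le (by norm_cast))
    (by rw [hg0]; exact (contDiffAt_inChart_coe η x hT).of_le (by norm_cast))
    (by rw [hg0]; exact (contDiffAt_inChart_coe ζ x hT).of_le (by norm_cast)) hcg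
    (by
      filter_upwards [hev] with s hs v
      have h1 := (H.isCriticalFamilyAt_smoothFun hs hx hy).critical.self_of_nhds v
      have hTs := H.chartPoint_mem_target hs hx hy
      have h2 : HasFDerivAt (inChart x (η + s • ζ : SmoothFun E M)) (fderiv ℝ (inChart x η) (g s) +
          s • fderiv ℝ (inChart x ζ) (g s)) (g s) :=
        ((contDiffAt_inChart_coe η x hTs).differentiableAt (by simp)).hasFDerivAt.add
        (((contDiffAt_inChart_coe ζ x hTs).differentiableAt (by simp)).hasFDerivAt.const_smul s)
      dsimp only at h1
      rw [h2.fderiv, add_apply, smul_apply, smul_eq_mul] at h1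
      rw [add_assoc]
      exact h1)
    (by rw [hg0]; exact hI.pos.self_of_nhds)
  rw [hg0] at key
  refine key.congr_of_eventuallyEq ?_
  filter_upwards [hev] with s hs
  exact (H.inChart_chartPoint hs hx hy ζ).symm

/-- Turns the derivative in `s` into a closed formula: `dζ` paired with itself by the inverse
Hessian, at the minimizer. It makes the dependence on the pair `(η, ζ)` accessible to jets. -/
theorem inChart_secondVariation (H : LegendreAtlas Ω V D t r c ε)
    (hη : η ∈ smallFun E t r c ε) (ζ : SmoothFun E M) (hx : x ∈ t) {y : E}
    (hy : y ∈ Metric.ball (chartAt E x x) (2 * r x)) :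
    inChart x (secondVariation V D η ζ) y = fderiv ℝ (inChart x ζ) (chartPoint E V D x η y)
        ((totalHessian (chartDiastasis E D x) (inChart x η) (chartPoint E V D x η y) y).inverse
          (fderiv ℝ (inChart x ζ) (chartPoint E V D x η y))) := by
  rw [inChart, secondVariation, (H.hasDerivAt_comp_legendrePoint_chart hη ζ hx hy).deriv, neg_neg]

theorem hasDerivAt_comp_legendrePoint (H : LegendreAtlas Ω V D t r c ε) {ζ : SmoothFun E M} {s : ℝ}
    (hs : η + s • ζ ∈ smallFun E t r c ε) (q : M) :
    HasDerivAt (fun s : ℝ => ζ (legendrePoint V D (η + s • ζ : SmoothFun E M) q))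
      (-secondVariation V D (η + s • ζ) ζ q) s := by
  obtain ⟨x, hx, hq⟩ := H.exists_mem_chartBall_two q
  have h1 := (H.hasDerivAt_comp_legendrePoint_chart hs ζ hx hq.2).differentiableAt.hasDerivAt
  rw [(chartAt E x).left_inv hq.1] at h1
  have h2 : HasDerivAt (fun s' : ℝ => ζ (legendrePoint V D
      (η + s • ζ + s' • ζ : SmoothFun E M) q)) (-secondVariation V D (η + s • ζ) ζ q) (s - s) := by
    rw [sub_self, secondVariation, neg_neg]
    exact h1
  refine (h2.comp_sub_const s s).congr_of_eventuallyEq (Eventually.of_forall fun s' => ?_)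
  dsimp only
  rw [add_assoc, ← add_smul, add_sub_cancel]

/-- The transform is a supremum of functions affine in `η`, so each minimizer yields a supporting
line. The two lines at `s` and `s'` enclose the difference quotient between two values that merge,
by continuity of the minimizer along the line. -/
theorem hasDerivAt_legendreVal (H : LegendreAtlas Ω V D t r c ε) {ζ : SmoothFun E M} {s : ℝ}
    (hs : η + s • ζ ∈ smallFun E t r c ε) (q : M) :
    HasDerivAt (fun s : ℝ => legendreVal V D (η + s • ζ : SmoothFun E M) q)
      (-ζ (legendrePoint V D (η + s • ζ : SmoothFun E M) q)) s := by
  have hcont := (H.hasDerivAt_comp_legendrePoint hs q).continuousAt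
  have hev : ∀ᶠ s' in 𝓝 s, η + s' • ζ ∈ smallFun E t r c ε := by
    have h : Continuous fun s : ℝ => η + s • ζ := by fun_prop
    exact h.continuousAt.eventually (H.isOpen_smallFun_top.mem_nhds hs)
  have hineq : ∀ {a b : ℝ}, η + a • ζ ∈ smallFun E t r c ε → η + b • ζ ∈ smallFun E t r c ε →
      legendreVal V D (η + a • ζ : SmoothFun E M) q -
        (b - a) * ζ (legendrePoint V D (η + a • ζ : SmoothFun E M) q) ≤
      legendreVal V D (η + b • ζ : SmoothFun E M) q := by
    intro a b ha hb
    have h1 := H.isAttainedAt_legendrePoint ha q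
    have h2 := (H.isAttainedAt_legendrePoint hb q).2 _ h1.1
    refine le_trans (le_of_eq ?_) h2
    rw [legendreVal, ContMDiffMap.coe_add, ContMDiffMap.coe_smul, ContMDiffMap.coe_add,
      ContMDiffMap.coe_smul]
    simp only [Pi.add_apply, Pi.smul_apply, smul_eq_mul]
    ring
  rw [hasDerivAt_iff_isLittleO]
  rw [Asymptotics.isLittleO_iff]
  intro δ hδ
  filter_upwards [hev, Metric.continuousAt_iff'.1 hcont δ hδ] with s' hs' hd
  have h1 := hineq hs hs'
  have h2 := hineq hs' hs
  rw [Real.dist_eq] at hd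
  set A := ζ (legendrePoint V D (η + s • ζ : SmoothFun E M) q)
  set B := ζ (legendrePoint V D (η + s' • ζ : SmoothFun E M) q)
  set l := legendreVal V D (η + s • ζ : SmoothFun E M) q
  set l' := legendreVal V D (η + s' • ζ : SmoothFun E M) q
  have h3 : |(s' - s) * (B - A)| ≤ δ * |s' - s| := by
    rw [abs_mul, mul_comm]
    gcongr
  have h4 := (abs_le.1 h3)
  rw [Real.norm_eq_abs, Real.norm_eq_abs, smul_eq_mul, abs_le]
  have h5 : (s' - s) * (B - A) = (s' - s) * B - (s' - s) * A := by ring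
  rw [h5] at h4
  have h6 : 0 ≤ δ * |s' - s| := by positivity
  constructor <;> linarith [h4.1, h4.2]

/-- The formula uses more derivatives of `η` and `ζ` than it controls; in the `C^∞`-topology this
loss is harmless. -/
theorem secondVariation_jetContAt (H : LegendreAtlas Ω V D t r c ε)
    (hη : η ∈ smallFun E t r c ε) (ζ : SmoothFun E M) (k : ℕ) {y : E}
    (hy : y ∈ (chartAt E x).target) :
    JetContAt k (fun p : SmoothFun E M × SmoothFun E M =>
      inChart x (secondVariation V D p.1 p.2)) (η, ζ) y := by
  obtain ⟨x', hx', hq⟩ := H.exists_mem_chartBall_two ((chartAt E x).symm y)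
  refine jetContAt_inChart_of_chart (x := x') hy hq.1 ?_
  have hI := H.isCriticalFamilyAt_smoothFun hη hx' hq.2
  set w := chartAt E x' ((chartAt E x).symm y) with hw
  have hT := H.chartPoint_mem_target hη hx' hq.2
  have he : ∀ j, JetContAt j (fun b : SmoothFun E M => inChart x' b) η (chartPoint E V D x' η w) :=
    fun j => isJetFamilyAt_id η j x' _ hT
  have hg := hI.jetContAt (he (k + 2))
  have hH := hI.inverse_jetContAt (he (k + 2)) (hg.of_le (Nat.le_succ k))
  have hfst : ∀ᶠ b in 𝓝 (η, ζ), ContinuousAt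
      (Prod.fst : SmoothFun E M × SmoothFun E M → SmoothFun E M) b :=
    Eventually.of_forall fun _ => continuousAt_fst
  have hg' := (hg.of_le (Nat.le_succ k)).comp_param (g := Prod.fst) (b := (η, ζ)) rfl hfst
  have hH' := hH.comp_param (g := Prod.fst) (b := (η, ζ)) rfl hfst
  have hζ : JetContAt (k + 1) (fun b : SmoothFun E M × SmoothFun E M => inChart x' b.2) (η, ζ)
      (chartPoint E V D x' η w) :=
    (isJetFamilyAt_id ζ (k + 1) x' _ hT).comp_param (g := Prod.snd) (b := (η, ζ)) rfl
      (Eventually.of_forall fun _ => continuousAt_snd)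
  have hζ' : JetContAt k (fun (b : SmoothFun E M × SmoothFun E M) z =>
      fderiv ℝ (inChart x' b.2) (chartPoint E V D x' b.1 z)) (η, ζ) w :=
    JetContAt.comp (S := fun b : SmoothFun E M × SmoothFun E M => fderiv ℝ (inChart x' b.2))
      hζ.fderiv hg'
  refine (hζ'.clm_apply (hH'.clm_apply hζ')).congr ?_
  filter_upwards [(continuousAt_fst.comp continuousAt_fst).eventually
    (H.isOpen_smallFun_top.mem_nhds hη),
    continuousAt_snd.eventually (Metric.isOpen_ball.mem_nhds hq.2)] with p hp hp'
  exact (H.inChart_secondVariation hp p.1.2 hx' hp').symm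

theorem taylorRemainder_jetContAt (H : LegendreAtlas Ω V D t r c ε)
    (hη : η ∈ smallFun E t r c ε) {χ : SmoothFun E M} (hχ : η + χ ∈ smallFun E t r c ε)
    (ζ : SmoothFun E M) (k : ℕ) {y : E} (hy : y ∈ (chartAt E x).target) :
    JetContAt k (fun p : SmoothFun E M × SmoothFun E M =>
      inChart x (taylorRemainder V D η p.1 p.2)) (χ, ζ) y := by
  refine JetContAt.intervalIntegral (T := fun s (p : SmoothFun E M × SmoothFun E M) z =>
    (1 - s) • inChart x (secondVariation V D (η + s • p.1) p.2) z) fun s hs => ?_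
  -- Convexity: all intermediate functions are small.
  have hmem : η + s • χ ∈ smallFun E t r c ε := by
    have := (convex_smallFun (E := E) (c := c) (ε := ε) (r := r) (t := t) fun x hx =>
      H.closedBall_subset_target hx).add_smul_sub_mem hη hχ hs
    rwa [add_sub_cancel_left] at this
  have h1 := (H.secondVariation_jetContAt hmem ζ k hy).comp_param
    (g := fun p : ℝ × (SmoothFun E M × SmoothFun E M) => (η + p.1 • p.2.1, p.2.2))
    (b := (s, (χ, ζ))) rfl (Eventually.of_forall fun p => by fun_prop)
  exact JetContAt.smul (JetContAt.const_param
    (fun p : ℝ × (SmoothFun E M × SmoothFun E M) => 1 - p.1)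
    (Eventually.of_forall fun p => by fun_prop)) h1

theorem contMDiff_taylorRemainder (H : LegendreAtlas Ω V D t r c ε)
    (hη : η ∈ smallFun E t r c ε) {χ : SmoothFun E M} (hχ : η + χ ∈ smallFun E t r c ε)
    (ζ : SmoothFun E M) : ContMDiff 𝓘(ℝ, E) 𝓘(ℝ, ℝ) ∞ (taylorRemainder V D η χ ζ) := fun p =>
  contMDiffAt_of_inChart (mem_chart_source E p) <| contDiffAt_infty.2 fun k =>
    (H.taylorRemainder_jetContAt hη hχ ζ k (mem_chart_target E p)).contDiffAt

theorem legendreVal_taylor (H : LegendreAtlas Ω V D t r c ε) (hη : η ∈ smallFun E t r c ε)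
    {χ : SmoothFun E M} (hχ : η + χ ∈ smallFun E t r c ε) (q : M) :
    legendreVal V D (η + χ : SmoothFun E M) q - legendreVal V D η q +
      χ (legendrePoint V D η q) = taylorRemainder V D η χ χ q := by
  have hmem : ∀ s ∈ uIcc (0 : ℝ) 1, η + s • χ ∈ smallFun E t r c ε := by
    intro s hs
    rw [uIcc_of_le zero_le_one] at hs
    have := (convex_smallFun (E := E) (c := c) (ε := ε) (r := r) (t := t) fun x hx =>
      H.closedBall_subset_target hx).add_smul_sub_mem hη hχ hs
    rwa [add_sub_cancel_left] at this
  -- Integration by parts in closed form: a primitive of `(1 - s)` times the second derivative of `s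
  -- ↦ L (η + s χ)`.
  have hd : ∀ s ∈ uIcc (0 : ℝ) 1, HasDerivAt (fun s : ℝ =>
      (1 - s) * -χ (legendrePoint V D (η + s • χ : SmoothFun E M) q) +
        legendreVal V D (η + s • χ : SmoothFun E M) q)
      ((1 - s) • secondVariation V D (η + s • χ) χ q) s := by
    intro s hs
    have h1 := (H.hasDerivAt_comp_legendrePoint (hmem s hs) q).neg
    have h2 := H.hasDerivAt_legendreVal (hmem s hs) q
    refine ((((hasDerivAt_id s).const_sub 1).mul h1).add h2).congr_deriv ?_
    simp only [Pi.neg_apply, id_eq, smul_eq_mul]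
    ring
  have hc : ContinuousOn (fun s : ℝ => (1 - s) • secondVariation V D (η + s • χ) χ q)
      (uIcc 0 1) := by
    intro s hs
    have h1 := (H.secondVariation_jetContAt (hmem s hs) χ 0 (mem_chart_target E q)).continuousAt
    have h2 : ContinuousAt (fun s : ℝ => inChart q (secondVariation V D (η + s • χ) χ)
        (chartAt E q q)) s :=
      ContinuousAt.comp (f := fun s : ℝ => (((η + s • χ : SmoothFun E M), χ), chartAt E q q))
        (x := s) h1 (by fun_prop)
    simp only [inChart, (chartAt E q).left_inv (mem_chart_source E q)] at h2
    exact (ContinuousAt.smul (f := fun s : ℝ => 1 - s) (by fun_prop) h2).continuousWithinAt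
  have h := intervalIntegral.integral_eq_sub_of_hasDerivAt hd hc.intervalIntegrable
  rw [taylorRemainder, h]
  simp
  ring

theorem comp_legendrePoint_jetContAt (H : LegendreAtlas Ω V D t r c ε)
    (hη : η ∈ smallFun E t r c ε) (χ : SmoothFun E M) (k : ℕ) {y : E}
    (hy : y ∈ (chartAt E x).target) :
    JetContAt k (fun χ : SmoothFun E M =>
      inChart x fun q => -χ (legendrePoint V D η q)) χ y := by
  obtain ⟨x', hx', hq⟩ := H.exists_mem_chartBall_two ((chartAt E x).symm y)
  refine jetContAt_inChart_of_chart (x := x') hy hq.1 ?_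
  have hI := H.isCriticalFamilyAt_smoothFun hη hx' hq.2
  have hT := H.chartPoint_mem_target hη hx' hq.2
  have hg : JetContAt k (fun _ : SmoothFun E M => chartPoint E V D x' η) χ _ :=
    ((hI.jetContAt (isJetFamilyAt_id η (k + 2) x' _ hT)).of_le (Nat.le_succ k)).comp_param
      (g := fun _ : SmoothFun E M => η) rfl (Eventually.of_forall fun _ => continuousAt_const)
  refine (JetContAt.comp (S := fun b : SmoothFun E M => inChart x' b)
    (isJetFamilyAt_id χ k x' _ hT) hg).neg.congr ?_
  filter_upwards [continuousAt_snd.eventually (Metric.isOpen_ball.mem_nhds hq.2)] with p hp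
  rw [H.inChart_chartPoint hη hx' hp]
  rfl

theorem contMDiff_comp_legendrePoint (H : LegendreAtlas Ω V D t r c ε)
    (hη : η ∈ smallFun E t r c ε) (χ : SmoothFun E M) :
    ContMDiff 𝓘(ℝ, E) 𝓘(ℝ, ℝ) ∞ fun q => -χ (legendrePoint V D η q) := fun p =>
  contMDiffAt_of_inChart (mem_chart_source E p) <| contDiffAt_infty.2 fun k =>
    (H.comp_legendrePoint_jetContAt hη χ k (mem_chart_target E p)).contDiffAt

/-- The differential of the Legendre transform. -/
def differential (H : LegendreAtlas Ω V D t r c ε) (hη : η ∈ smallFun E t r c ε) :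
    SmoothFun E M →L[ℝ] SmoothFun E M where
  toFun χ := smoothOf E fun q => -χ (legendrePoint V D η q)
  map_add' χ ζ := by
    refine DFunLike.coe_injective (funext fun q => ?_)
    have e := fun ξ => congrFun (coe_smoothOf (H.contMDiff_comp_legendrePoint hη ξ)) q
    exact (e (χ + ζ)).trans ((neg_add _ _).trans (congrArg₂ (· + ·) (e χ) (e ζ)).symm)
  map_smul' a χ := by
    refine DFunLike.coe_injective (funext fun q => ?_)
    have e := fun ξ => congrFun (coe_smoothOf (H.contMDiff_comp_legendrePoint hη ξ)) q
    exact (e (a • χ)).trans ((smul_neg a _).symm.trans (congrArg (a • ·) (e χ)).symm)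
  cont := continuous_iff_continuousAt.2 fun χ => IsJetFamilyAt.continuousAt fun k x y hy =>
    (H.comp_legendrePoint_jetContAt hη χ k hy).congr <| Eventually.of_forall fun p => by
      rw [coe_smoothOf (H.contMDiff_comp_legendrePoint hη _)]

theorem differential_apply (H : LegendreAtlas Ω V D t r c ε) (hη : η ∈ smallFun E t r c ε)
    (χ : SmoothFun E M) (q : M) : H.differential hη χ q = -χ (legendrePoint V D η q) :=
  congrFun (coe_smoothOf (H.contMDiff_comp_legendrePoint hη χ)) q

-- The Taylor remainder is evaluated with separate arguments: `χ` moves the base point and `ζ` is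
-- the direction. It is then quadratic in `ζ` and continuous at the origin, and the diagonal `ζ = χ`
-- is the actual remainder.
open Classical in
theorem hasFDerivAt_legendreFun (H : LegendreAtlas Ω V D t r c ε) (hη : η ∈ smallFun E t r c ε) :
    HasFDerivAt (legendreFun V D) (H.differential hη) η := by
  -- The value `0` off the small functions makes the quadratic law hold for every `χ`; only `χ` near
  -- `0` matter otherwise.
  let R : SmoothFun E M → SmoothFun E M → SmoothFun E M := fun χ ζ =>
    if η + χ ∈ smallFun E t r c ε then smoothOf E (taylorRemainder V D η χ ζ) else 0
  have hRc : ∀ {χ : SmoothFun E M}, η + χ ∈ smallFun E t r c ε → ∀ ζ,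
      (R χ ζ : M → ℝ) = taylorRemainder V D η χ ζ := by
    intro χ hχ ζ
    simp only [R, if_pos hχ]
    exact coe_smoothOf (H.contMDiff_taylorRemainder hη hχ ζ)
  have hcont : Continuous fun χ : SmoothFun E M => η + χ := by fun_prop
  have hev : ∀ᶠ χ in 𝓝 (0 : SmoothFun E M), η + χ ∈ smallFun E t r c ε :=
    (hcont.tendsto' 0 η (by simp)).eventually (H.isOpen_smallFun_top.mem_nhds hη)
  have hRs : ∀ (χ ζ : SmoothFun E M) (s : ℝ), R χ (s • ζ) = s ^ 2 • R χ ζ := by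
    intro χ ζ s
    by_cases hχ : η + χ ∈ smallFun E t r c ε
    · refine DFunLike.coe_injective ?_
      rw [ContMDiffMap.coe_smul, hRc hχ, hRc hχ]
      exact funext fun q => taylorRemainder_smul η χ ζ s q
    · simp only [R, if_neg hχ, smul_zero]
  refine hasFDerivAt_of_quadratic_remainder (R := R) ?_ hRs ?_
  · filter_upwards [hev] with χ hχ
    refine DFunLike.coe_injective ?_
    funext q
    rw [hRc hχ, ← H.legendreVal_taylor hη hχ q, ContMDiffMap.coe_sub, Pi.sub_apply,
      ContMDiffMap.coe_sub, Pi.sub_apply, H.differential_apply, H.coe_legendreFun hχ,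
      H.coe_legendreFun hη]
    ring
  · have h0 : R 0 0 = 0 := by
      have := hRs 0 0 0
      rwa [zero_smul, zero_pow two_ne_zero, zero_smul] at this
    have hχ0 : η + 0 ∈ smallFun E t r c ε := by rwa [add_zero]
    have h1 : ContinuousAt (fun p : SmoothFun E M × SmoothFun E M => R p.1 p.2) (0, 0) := by
      refine IsJetFamilyAt.continuousAt fun k x y hy => ?_
      refine (H.taylorRemainder_jetContAt hη hχ0 0 k hy).congr ?_
      filter_upwards [(continuousAt_fst.comp continuousAt_fst).eventually hev] with p hp
      exact congrArg (fun f => inChart x f p.2) (hRc hp p.1.2).symm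
    have h2 := h1.tendsto
    dsimp only at h2
    rwa [h0] at h2

end LegendreAtlas

end Transform

end

end ComplexLegendre

/-! ### The theorem. -/

theorem proposition7p1
    {E : Type*} [NormedAddCommGroup E] [NormedSpace ℂ E] [FiniteDimensional ℂ E]
    {M : Type*} [TopologicalSpace M] [ChartedSpace E M] [IsManifold 𝓘(ℂ, E) ω M]
    [CompactSpace M] [T2Space M]
    (Ω : ComplexLegendre.TwoForm E M) (hΩ : ComplexLegendre.IsAnalyticKahlerForm Ω) :
    (∃ (V : Set (M × M)) (D : M → M → ℝ), ComplexLegendre.IsLegendreDomain Ω V D) ∧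
    ∀ (V : Set (M × M)) (D : M → M → ℝ), ComplexLegendre.IsLegendreDomain Ω V D →
      ∃ U : Set (ComplexLegendre.SmoothFun E M),
        IsOpen[ComplexLegendre.ckTopology E M 2] U ∧ 0 ∈ U ∧
        U ⊆ ComplexLegendre.kahlerPotentials Ω ∧
        ∃ L : ComplexLegendre.SmoothFun E M → ComplexLegendre.SmoothFun E M,
          (∀ η ∈ U, ∀ q : M,
            ((L η q : ℝ) : EReal) =
              ComplexLegendre.legendre V D (fun p => ((η p : ℝ) : EReal)) q) ∧
          MapsTo L U U ∧
          ∀ η ∈ U, ∃ G : M → M,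
            (∀ q z : M, ComplexLegendre.IsAttainedAt V D η q z ↔ z = G q) ∧
            ∃ dL : ComplexLegendre.SmoothFun E M →L[ℝ] ComplexLegendre.SmoothFun E M,
              (∀ (χ : ComplexLegendre.SmoothFun E M) (q : M), dL χ q = -χ (G q)) ∧
              HasFDerivAt L dL η := by
  have hR : IsManifold 𝓘(ℝ, E) ω M := ComplexLegendre.isManifold_real E M
  have hR' : IsManifold 𝓘(ℝ, E) ∞ M := .of_le (n := ω) le_top
  refine ⟨ComplexLegendre.exists_isLegendreDomain hΩ, fun V D hV => ?_⟩
  obtain ⟨t, r, c, ε, H⟩ := ComplexLegendre.exists_legendreAtlas hΩ hV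
  exact ⟨ComplexLegendre.legendreSet V D t r c ε, H.isOpen_legendreSet, H.zero_mem_legendreSet,
    fun η hη => H.smallFun_subset hη.1, ComplexLegendre.legendreFun V D,
    fun η hη q => H.legendre_eq hη.1 q, H.mapsTo_legendreSet, fun η hη =>
    ⟨ComplexLegendre.legendrePoint V D η, H.isAttainedAt_iff hη.1, H.differential hη.1,
      H.differential_apply hη.1, H.hasFDerivAt_legendreFun hη.1⟩⟩
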